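/- A theory is a one-sorted theory of first-order predicate logic with identity in a finite signature (function symbols, constants and zero-ary predicates allowed); it is recursively enumerable if it is axiomatised by a recursively enumerable set of sentences, decidable if its set of theorems is recursive, and essentially undecidable if all its consistent extensions in the same language are undecidable. A (piecewise, multidimensional, relative, non-identity-preserving) translation with parameters from a signature $\Theta$ to a signature $\Sigma$ consists of finitely many pieces, each with a dimension, of a finite number of parameters $\vec p$ with a parameter domain $\alpha(\vec p\,)$, of a domain formula for each piece, and, for each choice of pieces for the arguments (and for the value of a function symbol), of $\Sigma$-formulas, possibly containing $\vec p$, that translate identity, the relation symbols and the graphs of the function symbols of $\Theta$. A theory $U$ of signature $\Sigma$ interprets a theory $V$ of signature $\Theta$, written $U \rhd V$, if there is such a translation $\tau$ for which, in every model of $U$, $\alpha$ is non-empty and, for all parameters in $\alpha$, the elements of the pieces, taken modulo the translation of identity, form under $\tau$ a well-defined model of $V$ (equivalently, $U$ proves $\exists \vec p\,\alpha(\vec p\,)$ and $\forall \vec p\,(\alpha(\vec p\,)\to\phi^{\tau,\vec p})$ for every theorem $\phi$ of $V$). A notion of interpretation is obtained from this by deciding independently, for each of the following features, whether it is admitted: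 more than one piece; dimensions other than $1$ (if admitted, either all positive dimensions or also dimension $0$; dimensions may vary over the pieces); parameters; relativisation (if it is not admitted, all domain formulas are valid); non-preservation of identity (if it is not admitted, two elements are identified only if they are the same tuple in the same piece). Theorem. For each of these notions of interpretation there is no interpretability-minimal recursively enumerable essentially undecidable theory. That is, there is no recursively enumerable essentially undecidable theory $U$ such that every recursively enumerable essentially undecidable theory $V$ with $U \rhd V$ satisfies $V \rhd U$. -/

import Mathlib

namespace Interp

open FirstOrder FirstOrder.Language

/-- A finite one-sorted signature: the list of the arities of its function symbols (constants have
arity `0`) and the list of the arities of its relation symbols (propositional symbols have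
arity `0`). Identity is a logical symbol. -/
structure Signature where
  funcs : List ℕ
  rels : List ℕ

/-- The first-order language of a finite signature: the symbols are positions in the lists. -/
def Signature.lang (S : Signature) : FirstOrder.Language.{0, 0} where
  Functions n := {f : Fin S.funcs.length // S.funcs.get f = n}
  Relations n := {R : Fin S.rels.length // S.rels.get R = n}

section Coding

variable {S : Signature}

/-- Gödel numbers of terms. -/
def codeTerm {n : ℕ} : S.lang.Term (Empty ⊕ Fin n) → ℕ
  | .var (.inl e) => e.elim
  | .var (.inr k) => Nat.pair 0 k
  | .func f ts =>
      Nat.pair 1 (Nat.pair (f.1 : Fin S.funcs.length)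
        (Encodable.encode (List.ofFn fun i => codeTerm (ts i))))

/-- Gödel numbers of formulas whose free variables are among `x_0, …, x_{n-1}`; the universal
quantifier binds the variable `x_n`. -/
def codeFormula : {n : ℕ} → S.lang.BoundedFormula Empty n → ℕ
  | _, .falsum => Nat.pair 0 0
  | _, .equal t u => Nat.pair 1 (Nat.pair (codeTerm t) (codeTerm u))
  | _, .rel R ts =>
      Nat.pair 2 (Nat.pair (R.1 : Fin S.rels.length)
        (Encodable.encode (List.ofFn fun i => codeTerm (ts i))))
  | _, .imp φ ψ => Nat.pair 3 (Nat.pair (codeFormula φ) (codeFormula ψ))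
  | _, .all φ => Nat.pair 4 (codeFormula φ)

/-- The Gödel number of a sentence. -/
def code (φ : S.lang.Sentence) : ℕ := codeFormula φ

/-- A set of sentences is recursively enumerable if the set of its Gödel numbers is. -/
def RESet (A : Set S.lang.Sentence) : Prop :=
  REPred fun m : ℕ => ∃ φ ∈ A, code φ = m

/-- A set of sentences is recursive if the set of its Gödel numbers is. -/
def RecursiveSet (A : Set S.lang.Sentence) : Prop :=
  ComputablePred fun m : ℕ => ∃ φ ∈ A, code φ = m

/-- The set of theorems of a theory. -/
def theorems (T : S.lang.Theory) : Set S.lang.Sentence := {φ | T ⊨ᵇ φ}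

/-- A theory is recursively enumerable if it is axiomatised by a recursively enumerable set of
sentences. -/
def RETheory (T : S.lang.Theory) : Prop :=
  ∃ A : S.lang.Theory, RESet A ∧ theorems A = theorems T

/-- A theory is decidable if its set of theorems is recursive. -/
def DecidableTheory (T : S.lang.Theory) : Prop := RecursiveSet (theorems T)

/-- A theory is essentially undecidable if all its consistent extensions in the same language are
undecidable. -/
def EssentiallyUndecidable (T : S.lang.Theory) : Prop :=
  ∀ T' : S.lang.Theory, theorems T ⊆ theorems T' → T'.IsSatisfiable → ¬ DecidableTheory T'

end Coding

/-- A piecewise, multidimensional, relative translation with parameters and with a translation of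
identity, from the language `L'` to the language `L`. The variables of the formulas are the
parameters, followed by one block of variables for each argument. -/
structure Translation (L L' : FirstOrder.Language.{0, 0}) where
  /-- the number of pieces -/
  pieces : ℕ
  /-- the dimension of each piece -/
  dim : Fin pieces → ℕ
  /-- the number of parameters -/
  params : ℕ
  /-- the parameter domain -/
  paramDom : L.Formula (Fin params)
  /-- the domain of each piece -/
  dom : ∀ i : Fin pieces, L.Formula (Fin params ⊕ Fin (dim i))
  /-- the translation of identity between elements of two pieces -/
  eqv : ∀ i j : Fin pieces, L.Formula (Fin params ⊕ (Fin (dim i) ⊕ Fin (dim j)))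
  /-- the translation of a relation symbol, for each choice of pieces for the arguments -/
  rel : ∀ {n : ℕ}, L'.Relations n → ∀ s : Fin n → Fin pieces,
    L.Formula (Fin params ⊕ (Σ k : Fin n, Fin (dim (s k))))
  /-- the translation of the graph of a function symbol, for each choice of pieces for the
  arguments and the value -/
  func : ∀ {n : ℕ}, L'.Functions n → ∀ (s : Fin n → Fin pieces) (j : Fin pieces),
    L.Formula (Fin params ⊕ ((Σ k : Fin n, Fin (dim (s k))) ⊕ Fin (dim j)))

namespace Translation

variable {L L' : FirstOrder.Language.{0, 0}} (τ : Translation L L')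

/-- The elements that the translation provides in a structure `M` with parameters `p`: tuples,
each in a specified piece, that satisfy the domain formula of that piece. -/
def Elem (M : Type) [L.Structure M] (p : Fin τ.params → M) : Type :=
  Σ i : Fin τ.pieces, {x : Fin (τ.dim i) → M // (τ.dom i).Realize (Sum.elim p x)}

/-- The `L'`-structure `N` is the structure that `τ` defines in `M` with the parameters `p`, that
is, the structure of the elements modulo the translation of identity, with the symbols read by
their translations; `π` is the quotient map. Such `N` and `π` exist iff `M` satisfies the
translations of the axioms of identity, of the totality and functionality of the function symbols
and of the non-emptiness of the domain; then `N` satisfies a sentence iff `M` satisfies its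
translation. -/
structure IsQuotientMap {M : Type} [L.Structure M] {p : Fin τ.params → M} {N : Type}
    [L'.Structure N] (π : τ.Elem M p → N) : Prop where
  surjective : Function.Surjective π
  map_eq : ∀ a b : τ.Elem M p,
    π a = π b ↔ (τ.eqv a.1 b.1).Realize (Sum.elim p (Sum.elim a.2.1 b.2.1))
  map_rel : ∀ {n : ℕ} (R : L'.Relations n) (a : Fin n → τ.Elem M p),
    Structure.RelMap R (fun k => π (a k)) ↔
      (τ.rel R fun k => (a k).1).Realize (Sum.elim p fun q => (a q.1).2.1 q.2)
  map_func : ∀ {n : ℕ} (f : L'.Functions n) (a : Fin n → τ.Elem M p) (b : τ.Elem M p),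
    Structure.funMap f (fun k => π (a k)) = π b ↔
      (τ.func f (fun k => (a k).1) b.1).Realize
        (Sum.elim p (Sum.elim (fun q => (a q.1).2.1 q.2) b.2.1))

/-- A translation is unrelativised if all its domain formulas are logically valid. -/
def Unrelativised : Prop :=
  ∀ (M : Type) [L.Structure M] [Nonempty M] (p : Fin τ.params → M) (i : Fin τ.pieces)
    (x : Fin (τ.dim i) → M), (τ.dom i).Realize (Sum.elim p x)

/-- A translation preserves identity if two elements are identified only when they are the same
tuple in the same piece. -/
def IdentityPreserving : Prop :=
  ∀ (M : Type) [L.Structure M] [Nonempty M] (p : Fin τ.params → M) (i j : Fin τ.pieces)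
    (x : Fin (τ.dim i) → M) (y : Fin (τ.dim j) → M),
    (τ.eqv i j).Realize (Sum.elim p (Sum.elim x y)) ↔
      (⟨i, x⟩ : Σ i : Fin τ.pieces, Fin (τ.dim i) → M) = ⟨j, y⟩

end Translation

/-- The dimensions that a notion of interpretation admits. -/
inductive Dimensions
  | one
  | positive
  | arbitrary

/-- The set of admitted dimensions. -/
def Dimensions.toSet : Dimensions → Set ℕ
  | one => {1}
  | positive => {d | 0 < d}
  | arbitrary => Set.univ

/-- A notion of interpretation, given by the choice of the features that it admits. -/
structure InterpretationNotion where
  dimensions : Dimensions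
  piecewise : Bool
  parameters : Bool
  relativisation : Bool
  nonIdentityPreserving : Bool

/-- The translation uses only features that the notion of interpretation admits. -/
structure InterpretationNotion.Admits (I : InterpretationNotion) {L L' : FirstOrder.Language.{0, 0}}
    (τ : Translation L L') : Prop where
  dimensions : ∀ i, τ.dim i ∈ I.dimensions.toSet
  pieces : I.piecewise = false → τ.pieces = 1
  params : I.parameters = false → τ.params = 0
  unrelativised : I.relativisation = false → τ.Unrelativised
  identity : I.nonIdentityPreserving = false → τ.IdentityPreserving

/-- `U` interprets `V` in the sense of the notion `I`: some admitted translation defines, uniformly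
in all models of `U`, models of `V`, for all choices of parameters in the parameter domain, which
is non-empty. -/
def Interprets (I : InterpretationNotion) {L L' : FirstOrder.Language.{0, 0}}
    (U : L.Theory) (V : L'.Theory) : Prop :=
  ∃ τ : Translation L L', I.Admits τ ∧
    ∀ M : Theory.ModelType.{0, 0, 0} U,
      (∃ p : Fin τ.params → M, τ.paramDom.Realize p) ∧
      ∀ p : Fin τ.params → M, τ.paramDom.Realize p →
        ∃ (N : Theory.ModelType.{0, 0, 0} V) (π : τ.Elem M p → N), τ.IsQuotientMap π

/-- `U` is interpretability-minimal among the recursively enumerable essentially undecidable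
theories in finite signatures, for the notion of interpretation `I`: every such theory that `U`
interprets also interprets `U`. -/
def IsInterpretabilityMinimal (I : InterpretationNotion) {S : Signature} (U : S.lang.Theory) :
    Prop :=
  RETheory U ∧ EssentiallyUndecidable U ∧
    ∀ (S' : Signature) (V : S'.lang.Theory), RETheory V → EssentiallyUndecidable V →
      Interprets I U V → Interprets I V U

end Interp

/-! Let `A` be an r.e. axiom set of `U`. Add to the signature a propositional symbol P and a binary
symbol E, and let V say: if P, then all of `A`; if not P, then E has a class with exactly n + 1
elements for n in X, and none for n in Y. Here x is a computable increasing sequence, X is the set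
of those x k at which the k-th partial recursive function has value 0, and Y consists of those where
it has value 1, together with all numbers off the sequence.

U interprets V by reading P and E as true (`interprets_classTheory`); this translation is admitted
by every notion. V is essentially undecidable (`essentiallyUndecidable_classTheory`): a decidable
consistent extension either has a model of P, and then its consequences under P give a decidable
consistent extension of `A`, or it proves not P, and then its decision procedure separates X from Y,
against the diagonal choice of X and Y.

What remains is to choose x so sparse that V does not interpret U, even by the most general
translations. Consider the model of not P that has one class of size n + 1 for each n in X,
infinitely many infinite classes, and trivial old symbols. Up to N back-and-forth moves it looks
like a finite structure computed from the first N bits of X, because a class with at least N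
elements passes for an infinite one. Applying a translation to these finite structures gives finite
structures, primitive recursive in N and the bits, whose truth values for a sentence φ agree with
the interpreted model as soon as N ≥ K(code φ + 1), for a constant K (`backAndForth_linkSystem`,
`exists_sparse_sequence_not_isQuotientMap`).

Such convergence to a model of `A` is prevented as follows. For a fixed finite set s of bits and a
fixed primitive recursive family, convergence with modulus K to a theory containing `A` would make
the limit a decidable consistent extension of `A`. So it fails, and the failure is witnessed by
finitely much information, which can be searched for. If x grows faster than all these witnesses,
every X inside the range of x looks, for each requirement, like a finite set up to the witness of
failure (`exists_sparse_sequence`). The argument is uniform in X, so the diagonal set, which is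
defined from x and is not recursive, may be used. It is also uniform in the translation and its
parameters: only the index of the resulting primitive recursive family and the constant K enter. -/

namespace Interp

open Nat.Partrec (Code)

/-! ### A computable enumeration of the primitive recursive functions -/

/-- Replaces unbounded search by the zero function. -/
def boundCode : Code → Code
  | .zero => .zero
  | .succ => .succ
  | .left => .left
  | .right => .right
  | .pair cf cg => .pair (boundCode cf) (boundCode cg)
  | .comp cf cg => .comp (boundCode cf) (boundCode cg)
  | .prec cf cg => .prec (boundCode cf) (boundCode cg)
  | .rfind' _ => .zero

theorem primrec_boundCode : Primrec boundCode := by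
  have h := Code.primrec_recOn (α := Code) (σ := Code) (c := id) Primrec.id
    (z := fun _ => .zero) (Primrec.const _) (s := fun _ => .succ) (Primrec.const _)
    (l := fun _ => .left) (Primrec.const _) (r := fun _ => .right) (Primrec.const _)
    (pr := fun _ _ _ a b => .pair a b)
    (Code.primrec₂_pair.comp (Primrec.fst.comp (Primrec.snd.comp (Primrec.snd.comp Primrec.snd)))
      (Primrec.snd.comp (Primrec.snd.comp (Primrec.snd.comp Primrec.snd))))
    (co := fun _ _ _ a b => .comp a b)
    (Code.primrec₂_comp.comp (Primrec.fst.comp (Primrec.snd.comp (Primrec.snd.comp Primrec.snd)))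
      (Primrec.snd.comp (Primrec.snd.comp (Primrec.snd.comp Primrec.snd))))
    (pc := fun _ _ _ a b => .prec a b)
    (Code.primrec₂_prec.comp (Primrec.fst.comp (Primrec.snd.comp (Primrec.snd.comp Primrec.snd)))
      (Primrec.snd.comp (Primrec.snd.comp (Primrec.snd.comp Primrec.snd))))
    (rf := fun _ _ _ => .zero) (Primrec.const _)
  refine h.of_eq fun c => ?_
  simp only [id]
  induction c <;> simp_all [boundCode]

/-- Unbounded search is the only source of partiality. -/
theorem eval_boundCode_dom (c : Code) (n : ℕ) : ((boundCode c).eval n).Dom := by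
  induction c generalizing n with
  | zero => simp [boundCode, Code.eval, pure, PFun.pure]
  | succ => simp [boundCode, Code.eval]
  | left => simp [boundCode, Code.eval]
  | right => simp [boundCode, Code.eval]
  | pair cf cg hf hg => simp [boundCode, Code.eval, Seq.seq, hf, hg]
  | comp cf cg hf hg => exact Part.bind_dom.2 ⟨hg n, hf _⟩
  | prec cf cg hf hg =>
    obtain ⟨a, k, rfl⟩ : ∃ a k, n = Nat.pair a k := ⟨n.unpair.1, n.unpair.2, by simp⟩
    simp only [boundCode]
    induction k with
    | zero => rw [Code.eval_prec_zero]; exact hf a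
    | succ k ih =>
      rw [Code.eval_prec_succ]
      exact Part.bind_dom.2 ⟨ih, hg _⟩
  | rfind' cf hf => simp [boundCode, Code.eval, pure, PFun.pure]

theorem exists_eval_boundCode {f : ℕ → ℕ} (hf : Nat.Primrec f) :
    ∃ c, ∀ n, (boundCode c).eval n = Part.some (f n) := by
  induction hf with
  | zero => exact ⟨.zero, fun n => rfl⟩
  | succ => exact ⟨.succ, fun n => rfl⟩
  | left => exact ⟨.left, fun n => rfl⟩
  | right => exact ⟨.right, fun n => rfl⟩
  | pair _ _ hf hg =>
    obtain ⟨⟨cf, hf⟩, ⟨cg, hg⟩⟩ := And.intro hf hg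
    exact ⟨.pair cf cg, fun n => by simp [boundCode, Code.eval, Seq.seq, hf, hg]⟩
  | comp _ _ hf hg =>
    obtain ⟨⟨cf, hf⟩, ⟨cg, hg⟩⟩ := And.intro hf hg
    refine ⟨.comp cf cg, fun n => ?_⟩
    show ((boundCode cg).eval n).bind (boundCode cf).eval = _
    rw [hg]
    exact (Part.bind_some _ _).trans (hf _)
  | prec _ _ hf hg =>
    obtain ⟨⟨cf, hf⟩, ⟨cg, hg⟩⟩ := And.intro hf hg
    refine ⟨.prec cf cg, fun n => ?_⟩
    obtain ⟨a, k, rfl⟩ : ∃ a k, n = Nat.pair a k := ⟨n.unpair.1, n.unpair.2, by simp⟩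
    simp only [boundCode, Nat.unpaired, Nat.unpair_pair]
    induction k with
    | zero => rw [Code.eval_prec_zero, hf]; rfl
    | succ k ih => rw [Code.eval_prec_succ, ih]; simp [hg]

theorem exists_universal_primrec :
    ∃ E : ℕ → ℕ → ℕ, Computable₂ E ∧ ∀ f : ℕ → ℕ, Nat.Primrec f → ∃ k, ∀ n, E k n = f n := by
  refine ⟨fun k n => ((boundCode (Denumerable.ofNat Code k)).eval n).get (eval_boundCode_dom _ _),
    ?_, fun f hf => ?_⟩
  · have h : Partrec₂ fun k n : ℕ => (boundCode (Denumerable.ofNat Code k)).eval n :=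
      Code.eval_part.comp ((primrec_boundCode.to_comp.comp (Computable.ofNat Code)).comp
        Computable.fst) Computable.snd
    exact Partrec.of_eq_tot h fun n => Part.get_mem _
  · obtain ⟨c, hc⟩ := exists_eval_boundCode hf
    exact ⟨Encodable.encode c, fun n => by simp [hc]⟩

/-! ### Recursively enumerable predicates as projections -/

/-- The decidable matrix is step-bounded evaluation in one direction and is searched in the other.
-/
theorem rePred_iff_exists {α : Type*} [Primcodable α] {p : α → Prop} :
    REPred p ↔ ∃ q : α → ℕ → Bool, Computable₂ q ∧ ∀ a, p a ↔ ∃ k, q a k = true := by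
  constructor
  · intro h
    obtain ⟨c, hc⟩ := Code.exists_code.1 (show Nat.Partrec _ from h)
    refine ⟨fun a k => (c.evaln k (Encodable.encode a)).isSome, ?_, fun a => ?_⟩
    · exact Primrec.to_comp (Primrec.option_isSome.comp (Code.primrec_evaln.comp
        (Primrec.pair (Primrec.pair Primrec.snd (Primrec.const c))
          (Primrec.encode.comp Primrec.fst))))
    · have h1 : (c.eval (Encodable.encode a)).Dom ↔ p a := by
        rw [hc]; simp [Part.assert]
      rw [← h1, Part.dom_iff_mem]
      simp only [Code.evaln_complete, Option.isSome_iff_exists, Option.mem_def]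
      exact exists_comm
  · rintro ⟨q, hq, h⟩
    have h1 : Partrec fun a => Nat.rfind fun k => Part.some (q a k) :=
      Partrec.rfind hq.partrec₂
    refine h1.dom_re.of_eq fun a => ?_
    rw [h a]
    exact Nat.rfind_dom'.trans (by simp)

theorem REPred.exists {α : Type*} [Primcodable α] {p : α → ℕ → Prop}
    (h : REPred fun x : α × ℕ => p x.1 x.2) : REPred fun a => ∃ n, p a n := by
  obtain ⟨q, hq, h⟩ := rePred_iff_exists.1 h
  refine rePred_iff_exists.2 ⟨fun a k => q (a, k.unpair.1) k.unpair.2, ?_, fun a => ?_⟩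
  · exact hq.comp (Computable.pair Computable.fst (Computable.fst.comp
      (Computable.unpair.comp Computable.snd))) (Computable.snd.comp
      (Computable.unpair.comp Computable.snd))
  · constructor
    · rintro ⟨n, hn⟩
      obtain ⟨k, hk⟩ := (h (a, n)).1 hn
      exact ⟨Nat.pair n k, by simpa using hk⟩
    · rintro ⟨k, hk⟩
      exact ⟨_, (h (a, k.unpair.1)).2 ⟨_, hk⟩⟩

theorem REPred.and {α : Type*} [Primcodable α] {p q : α → Prop} (hp : REPred p) (hq : REPred q) :
    REPred fun a => p a ∧ q a := by
  have h : Partrec fun a => (Part.assert (p a) fun _ => Part.some ()).bind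
      fun _ => Part.assert (q a) fun _ => Part.some () :=
    Partrec.bind hp (Partrec.comp (f := fun a => Part.assert (q a) fun _ => Part.some ())
      hq Computable.fst)
  refine h.dom_re.of_eq fun a => ?_
  simp [Part.bind_dom, Part.assert]

theorem REPred.or {α : Type*} [Primcodable α] {p q : α → Prop} (hp : REPred p) (hq : REPred q) :
    REPred fun a => p a ∨ q a := by
  obtain ⟨f, hf, h1⟩ := rePred_iff_exists.1 hp
  obtain ⟨g, hg, h2⟩ := rePred_iff_exists.1 hq
  refine rePred_iff_exists.2 ⟨fun a k => f a k || g a k, ?_, fun a => ?_⟩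
  · exact Primrec.or.to_comp.comp hf hg
  · simp [h1, h2, exists_or]

theorem REPred.comp {α β : Type*} [Primcodable α] [Primcodable β] {p : β → Prop} {f : α → β}
    (hp : REPred p) (hf : Computable f) : REPred fun a => p (f a) :=
  Partrec.comp (f := fun b => Part.assert (p b) fun _ => Part.some ()) hp hf

/-! ### Fast growing sequences -/

theorem computable_sum_range {α : Type*} [Primcodable α] {f : α → ℕ → ℕ} (hf : Computable₂ f) :
    Computable₂ fun (a : α) (n : ℕ) => ∑ i ∈ Finset.range n, f a i := by
  have h : Computable fun x : α × ℕ =>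
      Nat.rec (motive := fun _ => ℕ) 0 (fun i s => s + f x.1 i) x.2 :=
    Computable.nat_rec (f := fun x : α × ℕ => x.2) (g := fun _ => 0)
      (h := fun x p => p.2 + f x.1 p.1) Computable.snd (Computable.const 0)
      (Primrec.nat_add.to_comp.comp (Computable.snd.comp Computable.snd)
        (hf.comp (Computable.fst.comp Computable.fst) (Computable.fst.comp Computable.snd)))
  refine h.of_eq fun x => ?_
  show _ = ∑ i ∈ Finset.range x.2, f x.1 i
  induction x.2 with
  | zero => rfl
  | succ n ih => rw [Finset.sum_range_succ, ← ih]

theorem exists_testBit_eq (X : ℕ → Bool) (n : ℕ) : ∃ s < 2 ^ n, ∀ i < n, s.testBit i = X i := by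
  induction n with
  | zero => exact ⟨0, by simp⟩
  | succ n ih =>
    obtain ⟨s, hs, h⟩ := ih
    refine ⟨s + 2 ^ n * (X n).toNat, ?_, fun i hi => ?_⟩
    · have := (X n).toNat_le
      rw [pow_succ]
      nlinarith [Nat.two_pow_pos n]
    · rcases Nat.lt_succ_iff_lt_or_eq.1 hi with hi | rfl
      · rw [add_comm, Nat.testBit_two_pow_mul_add _ hs]
        simp [hi, h i hi]
      · rw [add_comm, Nat.testBit_two_pow_mul_add _ hs]
        cases X i <;> simp

/-- If every finite set refutes every requirement `d` by a finite part of it, then there is a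
computable sequence so sparse that all sets of members of the sequence do so. -/
theorem exists_sparse_sequence (W : ℕ → ℕ → ℕ → Bool)
    (hW : Computable fun x : (ℕ × ℕ) × ℕ => W x.1.1 x.1.2 x.2)
    (hex : ∀ d s, ∃ t, W d s t = true) :
    ∃ x : ℕ → ℕ, Computable x ∧ StrictMono x ∧
      ∀ X : ℕ → Bool, (∀ n, X n = true → n ∈ Set.range x) →
        ∀ d, ∃ s t, W d s t = true ∧ ∀ i ≤ t, s.testBit i = X i := by
  classical
  let T : ℕ → ℕ → ℕ := fun d s => Nat.find (hex d s)
  have hT : Computable₂ T := by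
    have := Computable.find (α := ℕ × ℕ) (P := fun p n => W p.1 p.2 n = true)
      ((Computable.computablePred (by simpa using hW))) (fun p => hex p.1 p.2)
    exact this
  have hTs : ∀ d s, W d s (T d s) = true := fun d s => Nat.find_spec (hex d s)
  -- The sum serves as a computable upper bound for all witnesses `T d s` with `d < n` and `s`
  -- coding a subset of `{0, …, n - 1}`.
  let H : ℕ → ℕ := fun n => ∑ d ∈ Finset.range n, ∑ s ∈ Finset.range (2 ^ n), T d s
  have hpow : Primrec fun n : ℕ => 2 ^ n :=
    (Primrec₂.unpaired'.1 Nat.Primrec.pow).comp (Primrec.const 2) Primrec.id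
  have hH : Computable H := by
    have h1 : Computable₂ fun (n d : ℕ) => ∑ s ∈ Finset.range (2 ^ n), T d s :=
      (computable_sum_range hT).comp Computable.snd (hpow.to_comp.comp Computable.fst)
    exact (computable_sum_range h1).comp Computable.id Computable.id
  have hHle : ∀ n d s, d < n → s < 2 ^ n → T d s ≤ H n := fun n d s hd hs =>
    (Finset.single_le_sum (f := fun s => T d s) (fun _ _ => Nat.zero_le _)
      (Finset.mem_range.2 hs)).trans
    (Finset.single_le_sum (f := fun d => ∑ s ∈ Finset.range (2 ^ n), T d s)
      (fun _ _ => Nat.zero_le _) (Finset.mem_range.2 hd))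
  let x : ℕ → ℕ := fun k => Nat.rec 0 (fun _ y => y + 1 + H (y + 1)) k
  have hxs : ∀ k, x (k + 1) = x k + 1 + H (x k + 1) := fun k => rfl
  have hmono : StrictMono x := strictMono_nat_of_lt_succ fun k => by rw [hxs]; omega
  refine ⟨x, ?_, hmono, fun X hX d => ?_⟩
  · have hs : Computable fun y : ℕ => y + 1 + H (y + 1) :=
      Primrec.nat_add.to_comp.comp Computable.succ (hH.comp Computable.succ)
    exact Computable.nat_rec (f := fun k : ℕ => k) (g := fun _ => 0)
      (h := fun _ p => p.2 + 1 + H (p.2 + 1)) Computable.id (Computable.const 0)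
      (hs.comp (Computable.snd.comp Computable.snd))
  -- For requirement `d`, let `s` be the part of `X` up to `x d`. Beyond `x d` the bits of `s`
  -- vanish, and `X` has no member before `x (d + 1)`, which exceeds `T d s` because `d < x d + 1`.
  · obtain ⟨s, hs, h⟩ := exists_testBit_eq X (x d + 1)
    refine ⟨s, T d s, hTs d s, fun i hi => ?_⟩
    rcases lt_or_ge i (x d + 1) with hlt | hge
    · exact h i hlt
    · rw [Nat.testBit_lt_two_pow (hs.trans_le (Nat.pow_le_pow_right (by norm_num) hge))]
      have hd : d < x d + 1 := Nat.lt_succ_of_le hmono.le_apply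
      have hi' : i < x (d + 1) := by
        rw [hxs]
        have := hHle _ d s hd hs
        omega
      by_contra hne
      have : X i = true := by cases hXi : X i <;> simp_all
      obtain ⟨j, rfl⟩ := hX i this
      have h1 := (hmono.lt_iff_lt (a := j) (b := d + 1)).1 hi'
      have h2 := (hmono.lt_iff_lt (a := d) (b := j)).1 (Nat.lt_of_succ_le hge)
      omega

end Interp

namespace Interp

open FirstOrder FirstOrder.Language

variable {S : Signature}

/-! ### Injectivity of Gödel numbers, and the size of expressions -/

/-- The arity is not coded, but it is recovered as the length of the list of arguments. -/
theorem codeTerm_injective {n : ℕ} :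
    Function.Injective (codeTerm : S.lang.Term (Empty ⊕ Fin n) → ℕ) := by
  intro t
  induction t with
  | var x =>
    rcases x with e | k
    · exact e.elim
    · intro u h
      rcases u with (e | k') | ⟨g, us⟩
      · exact e.elim
      · simp only [codeTerm, Nat.pair_eq_pair, true_and] at h
        rw [Fin.ext h]
      · simp [codeTerm, Nat.pair_eq_pair] at h
  | @func l f ts ih =>
    intro u h
    rcases u with (e | k') | @⟨l', g, us⟩
    · exact e.elim
    · simp [codeTerm, Nat.pair_eq_pair] at h
    · simp only [codeTerm, Nat.pair_eq_pair, true_and, Encodable.encode_inj] at h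
      obtain ⟨hf, hl⟩ := h
      obtain rfl : l = l' := by simpa using congrArg List.length hl
      obtain rfl : f = g := Subtype.ext (Fin.ext hf)
      have := List.ofFn_injective hl
      congr 1
      funext i
      exact ih i (congrFun this i)

theorem codeFormula_injective {n : ℕ} :
    Function.Injective (codeFormula : S.lang.BoundedFormula Empty n → ℕ) := by
  intro φ
  induction φ with
  | falsum =>
    intro ψ h
    cases ψ <;> simp_all [codeFormula, Nat.pair_eq_pair]
  | equal t u =>
    intro ψ h
    cases ψ <;> simp_all [codeFormula, Nat.pair_eq_pair]
    exact ⟨codeTerm_injective h.1, codeTerm_injective h.2⟩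
  | @rel n l R ts =>
    intro ψ h
    cases ψ with
    | @rel _ l' R' us =>
      simp only [codeFormula, Nat.pair_eq_pair, true_and, Encodable.encode_inj] at h
      obtain ⟨hf, hl⟩ := h
      obtain rfl : l = l' := by simpa using congrArg List.length hl
      obtain rfl : R = R' := Subtype.ext (Fin.ext hf)
      have := List.ofFn_injective hl
      congr 1
      funext i
      exact codeTerm_injective (congrFun this i)
    | _ => simp_all [codeFormula, Nat.pair_eq_pair]
  | imp φ₁ φ₂ h1 h2 =>
    intro ψ h
    cases ψ with
    | imp ψ₁ ψ₂ =>
      simp only [codeFormula, Nat.pair_eq_pair, true_and] at h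
      rw [h1 h.1, h2 h.2]
    | _ => simp_all [codeFormula, Nat.pair_eq_pair]
  | all φ h1 =>
    intro ψ h
    cases ψ with
    | all ψ =>
      simp only [codeFormula, Nat.pair_eq_pair, true_and] at h
      rw [h1 h]
    | _ => simp_all [codeFormula, Nat.pair_eq_pair]

theorem code_injective : Function.Injective (code : S.lang.Sentence → ℕ) :=
  codeFormula_injective

end Interp

/-! ### Closure properties of primitive recursive predicates -/

namespace PrimrecPred

variable {α β : Type*} [Primcodable α] [Primcodable β]

theorem imp {p q : α → Prop} (hp : PrimrecPred p) (hq : PrimrecPred q) :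
    PrimrecPred fun a => p a → q a :=
  (hp.not.or hq).of_eq fun _ => imp_iff_not_or.symm

theorem iff {p q : α → Prop} (hp : PrimrecPred p) (hq : PrimrecPred q) :
    PrimrecPred fun a => p a ↔ q a :=
  ((hp.imp hq).and (hq.imp hp)).of_eq fun _ => iff_def.symm

theorem exists_mem {f : α → List β} (hf : Primrec f) {p : α × β → Prop}
    (hp : PrimrecPred p) : PrimrecPred fun a => ∃ b ∈ f a, p (a, b) :=
  (PrimrecRel.exists_mem_list (R := fun b a => p (a, b))
    (hp.comp (Primrec.pair Primrec.snd Primrec.fst))).comp hf Primrec.id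

theorem forall_mem {f : α → List β} (hf : Primrec f) {p : α × β → Prop}
    (hp : PrimrecPred p) : PrimrecPred fun a => ∀ b ∈ f a, p (a, b) :=
  (PrimrecRel.forall_mem_list (R := fun b a => p (a, b))
    (hp.comp (Primrec.pair Primrec.snd Primrec.fst))).comp hf Primrec.id

theorem forall_lt' {f : α → ℕ} (hf : Primrec f) {p : α × ℕ → Prop}
    (hp : PrimrecPred p) : PrimrecPred fun a => ∀ i < f a, p (a, i) :=
  (forall_mem (Primrec.list_range.comp hf) hp).of_eq fun _ => by simp

theorem const (p : Prop) : PrimrecPred fun _ : α => p := by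
  exact ⟨fun _ => Classical.propDecidable p, Primrec.const _⟩

theorem exists_bool {p : α → Bool → Prop} (hp : ∀ b, PrimrecPred fun a => p a b) :
    PrimrecPred fun a => ∃ b, p a b :=
  ((hp true).or (hp false)).of_eq fun _ => by simp [or_comm]

theorem mem {f : α → List β} {g : α → β} (hf : Primrec f) (hg : Primrec g) :
    PrimrecPred fun a => g a ∈ f a :=
  (exists_mem (p := fun x => x.2 = g x.1) hf
    (Primrec.eq.comp Primrec.snd (hg.comp Primrec.fst))).of_eq fun _ => by simp

theorem exists_fin {n : ℕ} {p : α → Fin n → Prop} (hp : ∀ i, PrimrecPred fun a => p a i) :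
    PrimrecPred fun a => ∃ i, p a i := by
  induction n with
  | zero => exact (const False).of_eq fun _ => by simp
  | succ n ih =>
    exact ((hp 0).or (ih fun i => hp i.succ)).of_eq fun _ => Fin.exists_fin_succ.symm

theorem forall_fin {n : ℕ} {p : α → Fin n → Prop} (hp : ∀ i, PrimrecPred fun a => p a i) :
    PrimrecPred fun a => ∀ i, p a i := by
  induction n with
  | zero => exact (const True).of_eq fun _ => by simp
  | succ n ih =>
    exact ((hp 0).and (ih fun i => hp i.succ)).of_eq fun _ => Fin.forall_fin_succ.symm

end PrimrecPred

namespace Interp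

theorem primrec_filter {α β : Type*} [Primcodable α] [Primcodable β] {f : α → List β}
    (hf : Primrec f) {p : α → β → Prop} [∀ a, DecidablePred (p a)]
    (hp : PrimrecPred fun x : α × β => p x.1 x.2) :
    Primrec fun a => (f a).filter fun b => decide (p a b) :=
  letI : DecidableRel fun (b : β) (a : α) => p a b := fun _ _ => inferInstance
  (PrimrecRel.listFilter (R := fun b a => p a b)
    (hp.comp (Primrec.pair Primrec.snd Primrec.fst))).comp hf Primrec.id

/-- The lists of length `k` with entries from `l`. -/
def listsOver {α : Type*} (l : List α) : ℕ → List (List α)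
  | 0 => [[]]
  | k + 1 => l.flatMap fun x => (listsOver l k).map fun t => x :: t

theorem mem_listsOver {α : Type*} {l : List α} {k : ℕ} {t : List α} :
    t ∈ listsOver l k ↔ t.length = k ∧ ∀ x ∈ t, x ∈ l := by
  induction k generalizing t with
  | zero => cases t <;> simp [listsOver]
  | succ k ih =>
    cases t with
    | nil => simp [listsOver]
    | cons x t => simp [listsOver, ih]; tauto

theorem primrec_listsOver {α : Type*} [Primcodable α] :
    Primrec₂ (listsOver : List α → ℕ → List (List α)) := by
  have h : Primrec₂ fun (l : List α) (k : ℕ) => Nat.rec (motive := fun _ => List (List α)) [[]]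
      (fun _ T => l.flatMap fun x => T.map fun t => x :: t) k :=
    Primrec.nat_rec (f := fun _ : List α => [[]])
      (g := fun l p => l.flatMap fun x => p.2.map fun t => x :: t) (Primrec.const _)
      (Primrec.list_flatMap Primrec.fst (Primrec.list_map
        (Primrec.snd.comp (Primrec.snd.comp Primrec.fst))
        (Primrec.list_cons.comp (Primrec.snd.comp Primrec.fst) Primrec.snd)))
  refine h.of_eq fun l k => ?_
  induction k with
  | zero => rfl
  | succ k ih => simp only [listsOver, ← ih]

open Classical in
/-- The extensions of the predicates `P 0, …, P (m - 1)` in a finite universe. -/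
noncomputable def predTable {β : Type*} (un : List β) (P : ℕ → β → Prop) (m : ℕ) :
    List (List β) :=
  (List.range m).map fun m' => un.filter fun y => decide (P m' y)

theorem length_predTable {β : Type*} (un : List β) (P : ℕ → β → Prop) (m : ℕ) :
    (predTable un P m).length = m := by
  simp [predTable]

theorem mem_getD_predTable {β : Type*} {un : List β} {P : ℕ → β → Prop} {m m' : ℕ} (h : m' < m)
    {x : β} : x ∈ (predTable un P m).getD m' [] ↔ x ∈ un ∧ P m' x := by
  rw [predTable, List.getD_eq_getElem?_getD, List.getElem?_map, List.getElem?_range h]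
  simp

open Classical in
/-- Course-of-values recursion for a predicate on the elements of a finite universe. -/
theorem primrecPred_of_table {α β : Type*} [Primcodable α] [Primcodable β] (un : α → List β)
    (hun : Primrec un) (P : α → ℕ → β → Prop) (Q : α → List (List β) → β → Prop)
    (hQ : PrimrecPred fun x : (α × List (List β)) × β => Q x.1.1 x.1.2 x.2)
    (H : ∀ a m, ∀ x ∈ un a, P a m x ↔
      Q a (predTable (un a) (P a) m) x) :
    PrimrecPred fun x : (α × ℕ) × β => x.2 ∈ un x.1.1 ∧ P x.1.1 x.1.2 x.2 := by
  have h : Primrec₂ fun (a : α) (m : ℕ) => (un a).filter fun y => decide (P a m y) := by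
    refine Primrec.nat_strong_rec _
      (g := fun a T => some ((un a).filter fun y => decide (Q a T y))) ?_ fun a m => ?_
    · exact Primrec.option_some.comp (primrec_filter (hun.comp Primrec.fst)
        (p := fun (x : α × List (List β)) y => Q x.1 x.2 y) hQ)
    · simp only [Option.some.injEq]
      refine List.filter_congr fun x hx => ?_
      rw [decide_eq_decide]
      exact (H a m x hx).symm
  exact (PrimrecPred.mem (f := fun x : (α × ℕ) × β =>
      (un x.1.1).filter fun y => decide (P x.1.1 x.1.2 y)) (g := fun x => x.2)
    (h.comp (Primrec.fst.comp Primrec.fst) (Primrec.snd.comp Primrec.fst)) Primrec.snd).of_eq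
    fun x => by simp

/-! ### Finite structures given by finite data -/

open FirstOrder FirstOrder.Language

/-- The data of a finite structure: a list of elements, a list of positive facts about relation
symbols, and a list of values of function symbols, with the value before the arguments. -/
abbrev FinData : Type := List ℕ × List (ℕ × List ℕ) × List (ℕ × List ℕ)

namespace FinData

/-- The default element. -/
def base (D : FinData) : ℕ := D.1.getD 0 0

/-- The list of the elements. -/
def elems (D : FinData) : List ℕ := D.base :: D.1

/-- The value of the function symbol with index `f`. -/
def value (D : FinData) (f : ℕ) (args : List ℕ) : ℕ :=
  (D.elems.filter fun v => decide ((f, v :: args) ∈ D.2.2)).getD 0 D.base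

/-- Replaces all numbers that are not elements by the default element. -/
def clamp (D : FinData) (x : ℕ) : ℕ := if x ∈ D.elems then x else D.base

theorem base_mem (D : FinData) : D.base ∈ D.elems := List.mem_cons_self

theorem value_mem (D : FinData) (f : ℕ) (args : List ℕ) : D.value f args ∈ D.elems := by
  rw [value, List.getD_eq_getElem?_getD]
  cases h : (D.elems.filter fun v => decide ((f, v :: args) ∈ D.2.2))[0]? with
  | none => exact D.base_mem
  | some x => exact (List.mem_filter.1 (List.mem_of_getElem? h)).1

theorem clamp_mem (D : FinData) (x : ℕ) : D.clamp x ∈ D.elems := by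
  unfold clamp; split_ifs with h
  exacts [h, D.base_mem]

theorem clamp_of_mem {D : FinData} {x : ℕ} (h : x ∈ D.elems) : D.clamp x = x := if_pos h

theorem primrec_base : Primrec base :=
  (Primrec.list_getD 0).comp Primrec.fst (Primrec.const 0)

theorem primrec_elems : Primrec elems := Primrec.list_cons.comp primrec_base Primrec.fst

theorem primrec_clamp : Primrec₂ clamp :=
  Primrec.ite (PrimrecPred.mem (primrec_elems.comp Primrec.fst) Primrec.snd) Primrec.snd
    (primrec_base.comp Primrec.fst)

theorem primrec_value : Primrec fun x : FinData × ℕ × List ℕ => x.1.value x.2.1 x.2.2 := by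
  have h : Primrec fun x : FinData × ℕ × List ℕ =>
      x.1.elems.filter fun v => decide ((x.2.1, v :: x.2.2) ∈ x.1.2.2) :=
    primrec_filter (primrec_elems.comp Primrec.fst)
      (p := fun (x : FinData × ℕ × List ℕ) v => (x.2.1, v :: x.2.2) ∈ x.1.2.2)
      (PrimrecPred.mem (Primrec.snd.comp (Primrec.snd.comp (Primrec.fst.comp Primrec.fst)))
        (Primrec.pair (Primrec.fst.comp (Primrec.snd.comp Primrec.fst))
          (Primrec.list_cons.comp Primrec.snd
            (Primrec.snd.comp (Primrec.snd.comp Primrec.fst)))))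
  exact ((Primrec.option_getD.comp (Primrec.list_getElem?.comp h (Primrec.const 0))
    (primrec_base.comp Primrec.fst))).of_eq fun x => List.getD_eq_getElem?_getD.symm

/-- The finite structure with the given data. -/
def Model (_ : Signature) (D : FinData) : Type := {x : ℕ // x ∈ D.elems}

variable {S : Signature} {D : FinData}

instance : Nonempty (D.Model S) := ⟨⟨D.base, D.base_mem⟩⟩

instance : S.lang.Structure (D.Model S) where
  funMap f args := ⟨D.value (f.1 : Fin S.funcs.length) (List.ofFn fun i => (args i).1),
    D.value_mem _ _⟩
  RelMap R args := ((R.1 : Fin S.rels.length).1, List.ofFn fun i => (args i).1) ∈ D.2.1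

/-- The assignment given by a list of numbers. -/
def assign (D : FinData) (env : List ℕ) {n : ℕ} (i : Fin n) : D.Model S :=
  ⟨D.clamp (env.getD i 0), D.clamp_mem _⟩

end FinData

end Interp

/-! ### Evaluation of terms in finite structures -/

namespace Interp

open FirstOrder FirstOrder.Language

theorem getD_funcs {S : Signature} {l : ℕ} (f : S.lang.Functions l) :
    S.funcs.getD (f.1 : Fin S.funcs.length).1 0 = l := by
  obtain ⟨f, rfl⟩ := f
  simp

theorem getD_rels {S : Signature} {l : ℕ} (R : S.lang.Relations l) :
    S.rels.getD (R.1 : Fin S.rels.length).1 0 = l := by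
  obtain ⟨R, rfl⟩ := R
  simp

namespace FinData

variable {S : Signature} {D : FinData}

/-- The number `t` codes a term whose value under the assignment `env` is `v`. -/
def TermValue (S : Signature) (D : FinData) (env : List ℕ) (t v : ℕ) : Prop :=
  ∃ t' : S.lang.Term (Empty ⊕ Fin env.length), codeTerm t' = t ∧
    (t'.realize (Sum.elim default (D.assign env)) : D.Model S).1 = v

theorem TermValue.mem {env : List ℕ} {t v : ℕ} (h : TermValue S D env t v) : v ∈ D.elems := by
  obtain ⟨t', -, rfl⟩ := h
  exact Subtype.prop _

/-- Exchanges lists of numbers, which a recursive procedure handles, for families of terms. -/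
theorem termValues_iff {env codes args : List ℕ} {l : ℕ} :
    (codes.length = l ∧ args.length = l ∧
      ∀ i < l, TermValue S D env (codes.getD i 0) (args.getD i 0)) ↔
    ∃ ts : Fin l → S.lang.Term (Empty ⊕ Fin env.length),
      codes = List.ofFn (fun i => codeTerm (ts i)) ∧
      args = List.ofFn fun i =>
        ((ts i).realize (Sum.elim default (D.assign env)) : D.Model S).1 := by
  constructor
  · rintro ⟨h1, h2, h⟩
    choose ts h3 h4 using fun i : Fin l => h i i.2
    refine ⟨ts, List.ext_getElem (by simp [h1]) fun i hi hi' => ?_,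
      List.ext_getElem (by simp [h2]) fun i hi hi' => ?_⟩
    · have := h3 ⟨i, h1 ▸ hi⟩
      simpa [List.getD_eq_getElem?_getD, hi] using this.symm
    · have := h4 ⟨i, h2 ▸ hi⟩
      simpa [List.getD_eq_getElem?_getD, hi] using this.symm
  · rintro ⟨ts, rfl, rfl⟩
    refine ⟨by simp, by simp, fun i hi => ⟨ts ⟨i, hi⟩, ?_, ?_⟩⟩ <;>
      simp [List.getD_eq_getElem?_getD, hi]

/-- Guarantees that the codes of subterms precede the code of a term, so that course-of-values
recursion can look them up. -/
theorem lt_of_mem_ofNat {codes : List ℕ} {i : ℕ} (hi : i < codes.length) :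
    codes.getD i 0 < Encodable.encode codes := by
  induction codes generalizing i with
  | nil => simp at hi
  | cons a l ih =>
    rw [Encodable.encode_list_cons]
    cases i with
    | zero => exact Nat.lt_succ_of_le (by simpa using Nat.left_le_pair _ _)
    | succ i =>
      have h1 := ih (i := i) (by simpa using hi)
      have h2 := Nat.right_le_pair (Encodable.encode a) (Encodable.encode l)
      simp only [List.getD_cons_succ]
      exact Nat.lt_succ_of_lt (h1.trans_le h2)

theorem lt_pair_of_pos {a b c : ℕ} (h : 0 < a) (hc : c ≤ b) : c < Nat.pair a b := by
  have := Nat.add_le_pair a b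
  omega

theorem primrecPred_args {γ : Type*} [Primcodable γ] {p : ℕ → ℕ → γ → Prop} {codes : γ → List ℕ}
    {ar : γ → ℕ} (hcodes : Primrec codes) (har : Primrec ar)
    (hp : PrimrecPred fun x : (ℕ × ℕ) × γ => p x.1.1 x.1.2 x.2) :
    PrimrecPred fun x : γ × List ℕ =>
      (codes x.1).length = ar x.1 ∧ ∀ i < ar x.1, p ((codes x.1).getD i 0) (x.2.getD i 0) x.1 := by
  have h1 : Primrec fun x : (γ × List ℕ) × ℕ => x.1.1 := Primrec.fst.comp Primrec.fst
  have h2 : Primrec fun x : (γ × List ℕ) × ℕ => (codes x.1.1).getD x.2 0 :=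
    (Primrec.list_getD 0).comp (hcodes.comp h1) Primrec.snd
  have h3 : Primrec fun x : (γ × List ℕ) × ℕ => x.1.2.getD x.2 0 :=
    (Primrec.list_getD 0).comp (Primrec.snd.comp Primrec.fst) Primrec.snd
  exact (Primrec.eq.comp (Primrec.list_length.comp (hcodes.comp Primrec.fst))
    (har.comp Primrec.fst)).and (PrimrecPred.forall_lt' (har.comp Primrec.fst)
      (hp.comp (Primrec.pair (Primrec.pair h2 h3) h1)))

theorem primrecPred_termValue (S : Signature) :
    PrimrecPred fun x : ((FinData × List ℕ) × ℕ) × ℕ =>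
      TermValue S x.1.1.1 x.1.1.2 x.1.2 x.2 := by
  have h := primrecPred_of_table (α := FinData × List ℕ) (β := ℕ) (fun a => a.1.elems)
    (primrec_elems.comp Primrec.fst) (fun a m v => TermValue S a.1 a.2 m v)
    -- The table `T` holds the values of all smaller codes, so the code under consideration is
    -- `T.length`. The two disjuncts read off its tag: variable or function application.
    (fun a T v =>
      (T.length.unpair.1 = 0 ∧ T.length.unpair.2 < a.2.length ∧
        v = a.1.clamp (a.2.getD T.length.unpair.2 0)) ∨
      (T.length.unpair.1 = 1 ∧ T.length.unpair.2.unpair.1 < S.funcs.length ∧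
        ∃ args ∈ listsOver a.1.elems (S.funcs.getD T.length.unpair.2.unpair.1 0),
          ((Denumerable.ofNat (List ℕ) T.length.unpair.2.unpair.2).length =
            S.funcs.getD T.length.unpair.2.unpair.1 0 ∧
          ∀ i < S.funcs.getD T.length.unpair.2.unpair.1 0, args.getD i 0 ∈
            T.getD ((Denumerable.ofNat (List ℕ) T.length.unpair.2.unpair.2).getD i 0) []) ∧
          v = a.1.value T.length.unpair.2.unpair.1 args)) ?_ ?_
  · exact (h.and (PrimrecPred.const True)).of_eq fun x =>
      ⟨fun h => h.1.2, fun h => ⟨⟨h.mem, h⟩, trivial⟩⟩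
  · have hD : Primrec fun x : ((FinData × List ℕ) × List (List ℕ)) × ℕ => x.1.1.1 :=
      Primrec.fst.comp (Primrec.fst.comp Primrec.fst)
    have henv : Primrec fun x : ((FinData × List ℕ) × List (List ℕ)) × ℕ => x.1.1.2 :=
      Primrec.snd.comp (Primrec.fst.comp Primrec.fst)
    have hT : Primrec fun x : ((FinData × List ℕ) × List (List ℕ)) × ℕ => x.1.2 :=
      Primrec.snd.comp Primrec.fst
    have hu := Primrec.unpair.comp (Primrec.list_length.comp hT)
    have h1 := Primrec.fst.comp hu
    have h2 := Primrec.snd.comp hu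
    have h21 := Primrec.fst.comp (Primrec.unpair.comp h2)
    have h22 := Primrec.snd.comp (Primrec.unpair.comp h2)
    have har := (Primrec.list_getD 0).comp (Primrec.const S.funcs) h21
    have hcodes := (Primrec.ofNat (List ℕ)).comp h22
    have hlook : PrimrecPred fun x : (ℕ × ℕ) × ((FinData × List ℕ) × List (List ℕ)) × ℕ =>
        x.1.2 ∈ x.2.1.2.getD x.1.1 [] :=
      PrimrecPred.mem ((Primrec.list_getD []).comp (hT.comp Primrec.snd)
        (Primrec.fst.comp Primrec.fst)) (Primrec.snd.comp Primrec.fst)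
    have hval := Primrec.eq.comp ((Primrec.snd (β := ℕ)).comp Primrec.fst)
      (primrec_value.comp (Primrec.pair (hD.comp Primrec.fst)
        (Primrec.pair (h21.comp Primrec.fst) (Primrec.snd (β := List ℕ)))))
    have hargs := (primrecPred_args (p := fun c v (x : ((FinData × List ℕ) × List (List ℕ)) × ℕ) =>
      v ∈ x.1.2.getD c []) hcodes har hlook).and hval
    have hex := PrimrecPred.exists_mem (primrec_listsOver.comp (primrec_elems.comp hD) har) hargs
    have hclamp := primrec_clamp.comp hD ((Primrec.list_getD 0).comp henv h2)
    exact ((Primrec.eq.comp h1 (Primrec.const 0)).and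
      ((Primrec.nat_lt.comp h2 (Primrec.list_length.comp henv)).and
        (Primrec.eq.comp Primrec.snd hclamp))).or
      ((Primrec.eq.comp h1 (Primrec.const 1)).and
        ((Primrec.nat_lt.comp h21 (Primrec.const _)).and hex))
  · rintro ⟨D, env⟩ m v hv
    simp only [length_predTable]
    constructor
    · rintro ⟨t', rfl, rfl⟩
      rcases t' with (e | k) | @⟨l, f, ts⟩
      · exact e.elim
      · left
        simp [codeTerm, assign]
      · right
        have hl := getD_funcs f
        obtain ⟨h1, h2, h3⟩ := termValues_iff.2 ⟨ts, rfl, rfl⟩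
        simp only [codeTerm, Nat.unpair_pair, hl, Denumerable.ofNat_encode]
        refine ⟨trivial, f.1.2, _, mem_listsOver.2 ⟨h2, ?_⟩, ⟨h1, fun i hi => ?_⟩, rfl⟩
        · intro x hx
          obtain ⟨i, rfl⟩ := List.mem_ofFn.1 hx
          exact Subtype.prop _
        · refine (mem_getD_predTable ?_).2 ⟨(h3 i hi).mem, h3 i hi⟩
          exact lt_pair_of_pos one_pos ((lt_of_mem_ofNat (h1.symm ▸ hi)).le.trans
            (Nat.right_le_pair _ _))
    · rintro (⟨h1, h2, rfl⟩ | ⟨h1, h2, args, hargs, ⟨h3, h4⟩, rfl⟩)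
      · refine ⟨.var (.inr ⟨_, h2⟩), ?_, rfl⟩
        rw [codeTerm, ← h1, Nat.pair_unpair]
      · rw [mem_listsOver] at hargs
        set l := S.funcs.getD m.unpair.2.unpair.1 0 with hl
        have hm : m = Nat.pair 1 (Nat.pair m.unpair.2.unpair.1 (Encodable.encode
            (Denumerable.ofNat (List ℕ) m.unpair.2.unpair.2))) := by
          rw [Denumerable.encode_ofNat, Nat.pair_unpair, ← h1, Nat.pair_unpair]
        obtain ⟨ts, hc, ha⟩ := (termValues_iff (S := S) (D := D) (env := env)).1 ⟨h3, hargs.1,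
          fun i hi => ((mem_getD_predTable (by
            conv_rhs => rw [hm]
            exact lt_pair_of_pos one_pos ((lt_of_mem_ofNat (h3.symm ▸ hi)).le.trans
              (Nat.right_le_pair _ _)))).1 (h4 i hi)).2⟩
        refine ⟨.func ⟨⟨_, h2⟩, by simp [hl, List.getD_eq_getElem?_getD, h2]⟩ ts, ?_, ?_⟩
        · exact (congrArg (fun l => Nat.pair 1 (Nat.pair _ (Encodable.encode l))) hc.symm).trans
            hm.symm
        · show D.value _ (List.ofFn fun i => _) = _
          rw [ha]

end FinData

end Interp

/-! ### Truth of formulas in finite structures -/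

namespace Interp

open FirstOrder FirstOrder.Language

namespace FinData

variable {S : Signature} {D : FinData}

/-- The number `m` codes a formula whose truth value under the assignment `env` is `b`. -/
def FormulaValue (S : Signature) (D : FinData) (env : List ℕ) (m : ℕ) (b : Bool) : Prop :=
  ∃ n, env.length = n ∧ ∃ φ : S.lang.BoundedFormula Empty n, codeFormula φ = m ∧
    (φ.Realize default (D.assign env : Fin n → D.Model S) ↔ b = true)

/-- The assignments of length at most `K`, with a truth value. -/
def valuations (D : FinData) (K : ℕ) : List (List ℕ × Bool) :=
  (List.range (K + 1)).flatMap fun k => (listsOver D.elems k).flatMap fun e =>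
    [(e, true), (e, false)]

theorem mem_valuations {K : ℕ} {e : List ℕ} {b : Bool} :
    (e, b) ∈ D.valuations K ↔ e.length ≤ K ∧ ∀ x ∈ e, x ∈ D.elems := by
  cases b <;> simp [valuations, mem_listsOver]

theorem primrec_valuations : Primrec₂ valuations :=
  Primrec.list_flatMap (Primrec.list_range.comp (Primrec.succ.comp Primrec.snd))
    (Primrec.list_flatMap (primrec_listsOver.comp
      (primrec_elems.comp (Primrec.fst.comp Primrec.fst)) Primrec.snd)
      (Primrec.list_cons.comp (Primrec.pair Primrec.snd (Primrec.const true))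
        (Primrec.list_cons.comp (Primrec.pair Primrec.snd (Primrec.const false))
          (Primrec.const []))))

theorem snoc_assign (env : List ℕ) (x : D.Model S) :
    (D.assign (env ++ [x.1]) : Fin (env.length + 1) → D.Model S) =
      Fin.snoc (D.assign env : Fin env.length → D.Model S) x := by
  funext i
  refine Fin.lastCases ?_ (fun i => ?_) i
  · simp only [Fin.snoc_last]
    apply Subtype.ext
    simpa [assign, List.getD_eq_getElem?_getD] using clamp_of_mem x.2
  · simp only [Fin.snoc_castSucc]
    apply Subtype.ext
    simp [assign, List.getD_eq_getElem?_getD]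

theorem formulaValue_imp_iff {env : List ℕ} {c₁ c₂ : ℕ} {b : Bool} :
    FormulaValue S D env (Nat.pair 3 (Nat.pair c₁ c₂)) b ↔ ∃ b₁ b₂, FormulaValue S D env c₁ b₁ ∧
      FormulaValue S D env c₂ b₂ ∧ (b = true ↔ (b₁ = true → b₂ = true)) := by
  classical
  constructor
  · rintro ⟨n, rfl, φ, hφ, h⟩
    cases φ with
    | imp φ₁ φ₂ =>
      simp only [codeFormula, Nat.pair_eq_pair, true_and] at hφ
      obtain ⟨rfl, rfl⟩ := hφ
      refine ⟨decide (φ₁.Realize default (D.assign env)), decide (φ₂.Realize default (D.assign env)),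
        ⟨_, rfl, φ₁, rfl, decide_eq_true_iff.symm⟩,
        ⟨_, rfl, φ₂, rfl, decide_eq_true_iff.symm⟩, ?_⟩
      rw [← h, BoundedFormula.realize_imp]
      simp
    | _ => simp [codeFormula, Nat.pair_eq_pair] at hφ
  · rintro ⟨b₁, b₂, ⟨n, rfl, φ₁, rfl, h₁⟩, ⟨_, rfl, φ₂, rfl, h₂⟩, h⟩
    exact ⟨_, rfl, φ₁.imp φ₂, rfl, by rw [BoundedFormula.realize_imp, h₁, h₂, h]⟩

/-- The first conjunct only says that `c` codes a formula with one more free variable; without it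
the second could hold for meaningless codes. -/
theorem formulaValue_all_iff {env : List ℕ} {c : ℕ} {b : Bool} :
    FormulaValue S D env (Nat.pair 4 c) b ↔
      (∀ x ∈ D.elems, ∃ b', FormulaValue S D (env ++ [x]) c b') ∧
      (b = true ↔ ∀ x ∈ D.elems, FormulaValue S D (env ++ [x]) c true) := by
  classical
  have key : ∀ φ : S.lang.BoundedFormula Empty (env.length + 1), ∀ (x : D.Model S) (b : Bool),
      FormulaValue S D (env ++ [x.1]) (codeFormula φ) b ↔
        (φ.Realize default (Fin.snoc (D.assign env) x) ↔ b = true) := by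
    intro φ x b
    rw [← snoc_assign]
    constructor
    · rintro ⟨n, hn, ψ, hψ, h⟩
      obtain rfl : env.length + 1 = n := by simpa using hn
      rwa [← codeFormula_injective hψ]
    · exact fun h => ⟨_, by simp, φ, rfl, h⟩
  constructor
  · rintro ⟨n, rfl, φ, hφ, h⟩
    cases φ with
    | all φ =>
      simp only [codeFormula, Nat.pair_eq_pair, true_and] at hφ
      subst hφ
      refine ⟨fun x hx => ⟨decide (φ.Realize default
        (Fin.snoc (D.assign env) (⟨x, hx⟩ : D.Model S))), (key φ ⟨x, hx⟩ _).2 decide_eq_true_iff.symm⟩, ?_⟩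
      rw [← h, BoundedFormula.realize_all]
      exact ⟨fun h x hx => (key φ ⟨x, hx⟩ _).2 (by simpa using h _),
        fun h x => by simpa using (key φ x true).1 (h x.1 x.2)⟩
    | _ => simp [codeFormula, Nat.pair_eq_pair] at hφ
  · rintro ⟨h1, h2⟩
    obtain ⟨b', n, hn, φ, rfl, -⟩ := h1 D.base D.base_mem
    obtain rfl : env.length + 1 = n := by simpa using hn
    refine ⟨_, rfl, φ.all, rfl, ?_⟩
    rw [h2, BoundedFormula.realize_all]
    exact ⟨fun h x hx => (key φ ⟨x, hx⟩ _).2 (by simpa using h _),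
      fun h x => by simpa using (key φ x true).1 (h x.1 x.2)⟩

theorem formulaValue_falsum_iff {env : List ℕ} {c : ℕ} {b : Bool} :
    FormulaValue S D env (Nat.pair 0 c) b ↔ c = 0 ∧ b = false := by
  constructor
  · rintro ⟨n, rfl, φ, hφ, h⟩
    cases φ with
    | falsum =>
      simp only [codeFormula, Nat.pair_eq_pair, true_and] at hφ
      exact ⟨hφ.symm, by simpa [BoundedFormula.Realize] using h⟩
    | _ => simp [codeFormula, Nat.pair_eq_pair] at hφ
  · rintro ⟨rfl, rfl⟩
    exact ⟨_, rfl, .falsum, rfl, by simp [BoundedFormula.Realize]⟩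

theorem formulaValue_equal_iff {env : List ℕ} {c₁ c₂ : ℕ} {b : Bool} :
    FormulaValue S D env (Nat.pair 1 (Nat.pair c₁ c₂)) b ↔ ∃ x ∈ D.elems, ∃ y ∈ D.elems,
      TermValue S D env c₁ x ∧ TermValue S D env c₂ y ∧ (b = true ↔ x = y) := by
  constructor
  · rintro ⟨n, rfl, φ, hφ, h⟩
    cases φ with
    | equal t u =>
      simp only [codeFormula, Nat.pair_eq_pair, true_and] at hφ
      obtain ⟨rfl, rfl⟩ := hφ
      refine ⟨_, Subtype.prop _, _, Subtype.prop _, ⟨t, rfl, rfl⟩, ⟨u, rfl, rfl⟩, ?_⟩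
      rw [← h]
      exact Subtype.ext_iff
    | _ => simp [codeFormula, Nat.pair_eq_pair] at hφ
  · rintro ⟨_, -, _, -, ⟨t, rfl, rfl⟩, ⟨u, rfl, rfl⟩, h⟩
    refine ⟨_, rfl, .equal t u, rfl, ?_⟩
    rw [h]
    exact Subtype.ext_iff

theorem formulaValue_rel_iff {env : List ℕ} {R c : ℕ} {b : Bool} :
    FormulaValue S D env (Nat.pair 2 (Nat.pair R c)) b ↔ R < S.rels.length ∧
      ∃ args ∈ listsOver D.elems (S.rels.getD R 0),
        ((Denumerable.ofNat (List ℕ) c).length = S.rels.getD R 0 ∧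
          ∀ i < S.rels.getD R 0,
            TermValue S D env ((Denumerable.ofNat (List ℕ) c).getD i 0) (args.getD i 0)) ∧
        (b = true ↔ (R, args) ∈ D.2.1) := by
  constructor
  · rintro ⟨n, rfl, φ, hφ, h⟩
    cases φ with
    | @rel _ l R' ts =>
      simp only [codeFormula, Nat.pair_eq_pair, true_and] at hφ
      obtain ⟨rfl, rfl⟩ := hφ
      obtain ⟨h1, h2, h3⟩ := (termValues_iff (D := D)).2 ⟨ts, rfl, rfl⟩
      rw [getD_rels, Denumerable.ofNat_encode]
      refine ⟨R'.1.2, _, mem_listsOver.2 ⟨h2, ?_⟩, ⟨h1, h3⟩, h.symm⟩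
      intro x hx
      obtain ⟨i, rfl⟩ := List.mem_ofFn.1 hx
      exact Subtype.prop _
    | _ => simp [codeFormula, Nat.pair_eq_pair] at hφ
  · rintro ⟨hR, args, hargs, ⟨h1, h2⟩, h⟩
    obtain ⟨ts, hc, rfl⟩ := termValues_iff.1 ⟨h1, (mem_listsOver.1 hargs).1, h2⟩
    let R' : S.lang.Relations (S.rels.getD R 0) :=
      ⟨⟨R, hR⟩, by simp [List.getD_eq_getElem?_getD, hR]⟩
    refine ⟨_, rfl, .rel R' ts, ?_, h.symm⟩
    exact (congrArg (fun l => Nat.pair 2 (Nat.pair _ (Encodable.encode l))) hc.symm).trans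
      (by rw [Denumerable.encode_ofNat])

theorem formulaValue_tag {env : List ℕ} {m : ℕ} {b : Bool} (h : FormulaValue S D env m b) :
    m.unpair.1 < 5 := by
  obtain ⟨n, rfl, φ, rfl, -⟩ := h
  cases φ <;> simp [codeFormula]

/-- Course-of-values recursion needs a finite universe of assignments, but a quantifier lengthens
the assignment. It also lowers the code, so the bound `length + code ≤ K` is inherited by
subformulas, and assignments of length at most `K` suffice. -/
theorem primrecPred_formulaValue (S : Signature) :
    PrimrecPred fun x : ((FinData × ℕ) × ℕ) × (List ℕ × Bool) =>
      x.2 ∈ valuations x.1.1.1 x.1.1.2 ∧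
        (x.2.1.length + x.1.2 ≤ x.1.1.2 ∧ FormulaValue S x.1.1.1 x.2.1 x.1.2 x.2.2) := by
  refine primrecPred_of_table (α := FinData × ℕ) (β := List ℕ × Bool) (fun a => a.1.valuations a.2)
    (primrec_valuations.comp Primrec.fst Primrec.snd)
    (fun a m x => x.1.length + m ≤ a.2 ∧ FormulaValue S a.1 x.1 m x.2)
    (fun a T x => x.1.length + T.length ≤ a.2 ∧
      ((T.length.unpair.1 = 0 ∧ T.length.unpair.2 = 0 ∧ x.2 = false) ∨
       (T.length.unpair.1 = 1 ∧ ∃ y ∈ a.1.elems, ∃ z ∈ a.1.elems,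
          TermValue S a.1 x.1 T.length.unpair.2.unpair.1 y ∧
          TermValue S a.1 x.1 T.length.unpair.2.unpair.2 z ∧ (x.2 = true ↔ y = z)) ∨
       (T.length.unpair.1 = 2 ∧ T.length.unpair.2.unpair.1 < S.rels.length ∧
          ∃ args ∈ listsOver a.1.elems (S.rels.getD T.length.unpair.2.unpair.1 0),
            ((Denumerable.ofNat (List ℕ) T.length.unpair.2.unpair.2).length =
              S.rels.getD T.length.unpair.2.unpair.1 0 ∧
            ∀ i < S.rels.getD T.length.unpair.2.unpair.1 0, TermValue S a.1 x.1
              ((Denumerable.ofNat (List ℕ) T.length.unpair.2.unpair.2).getD i 0)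
              (args.getD i 0)) ∧
            (x.2 = true ↔ (T.length.unpair.2.unpair.1, args) ∈ a.1.2.1)) ∨
       (T.length.unpair.1 = 3 ∧ ∃ b₁ b₂, (x.1, b₁) ∈ T.getD T.length.unpair.2.unpair.1 [] ∧
          (x.1, b₂) ∈ T.getD T.length.unpair.2.unpair.2 [] ∧
          (x.2 = true ↔ (b₁ = true → b₂ = true))) ∨
       (T.length.unpair.1 = 4 ∧
          (∀ y ∈ a.1.elems, ∃ b', (x.1 ++ [y], b') ∈ T.getD T.length.unpair.2 []) ∧
          (x.2 = true ↔ ∀ y ∈ a.1.elems, (x.1 ++ [y], true) ∈ T.getD T.length.unpair.2 []))))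
    ?_ ?_
  · let γ := ((FinData × ℕ) × List (List (List ℕ × Bool))) × (List ℕ × Bool)
    have hD : Primrec fun x : γ => x.1.1.1 := Primrec.fst.comp (Primrec.fst.comp Primrec.fst)
    have hK : Primrec fun x : γ => x.1.1.2 := Primrec.snd.comp (Primrec.fst.comp Primrec.fst)
    have hT : Primrec fun x : γ => x.1.2 := Primrec.snd.comp Primrec.fst
    have he : Primrec fun x : γ => x.2.1 := Primrec.fst.comp Primrec.snd
    have hb : Primrec fun x : γ => x.2.2 := Primrec.snd.comp Primrec.snd
    have hm := Primrec.list_length.comp hT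
    have hu := Primrec.unpair.comp hm
    have h1 := Primrec.fst.comp hu
    have h2 := Primrec.snd.comp hu
    have h21 := Primrec.fst.comp (Primrec.unpair.comp h2)
    have h22 := Primrec.snd.comp (Primrec.unpair.comp h2)
    have har := (Primrec.list_getD 0).comp (Primrec.const S.rels) h21
    have hcodes := (Primrec.ofNat (List ℕ)).comp h22
    have helems := primrec_elems.comp hD
    have hbt : PrimrecPred fun x : γ => x.2.2 = true := Primrec.eq.comp hb (Primrec.const true)
    have htag : ∀ k, PrimrecPred fun x : γ => x.1.2.length.unpair.1 = k := fun k =>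
      Primrec.eq.comp h1 (Primrec.const k)
    have hlen : PrimrecPred fun x : γ => x.2.1.length + x.1.2.length ≤ x.1.1.2 :=
      Primrec.nat_le.comp (Primrec.nat_add.comp (Primrec.list_length.comp he) hm) hK
    have h0 : PrimrecPred fun x : γ => x.1.2.length.unpair.2 = 0 ∧ x.2.2 = false :=
      (Primrec.eq.comp h2 (Primrec.const 0)).and (Primrec.eq.comp hb (Primrec.const false))
    have htv : ∀ {δ : Type} [Primcodable δ] {f : δ → γ} {t v : δ → ℕ}, Primrec f → Primrec t →
        Primrec v → PrimrecPred fun y => TermValue S (f y).1.1.1 (f y).2.1 (t y) (v y) :=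
      fun hf ht hv => (primrecPred_termValue S).comp
        (Primrec.pair (Primrec.pair (Primrec.pair (hD.comp hf) (he.comp hf)) ht) hv)
    have hfst : Primrec fun x : (γ × ℕ) × ℕ => x.1.1 := Primrec.fst.comp Primrec.fst
    have heq : PrimrecPred fun x : γ => ∃ y ∈ x.1.1.1.elems, ∃ z ∈ x.1.1.1.elems,
          TermValue S x.1.1.1 x.2.1 x.1.2.length.unpair.2.unpair.1 y ∧
          TermValue S x.1.1.1 x.2.1 x.1.2.length.unpair.2.unpair.2 z ∧ (x.2.2 = true ↔ y = z) :=
      PrimrecPred.exists_mem helems (PrimrecPred.exists_mem (helems.comp Primrec.fst)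
        ((htv hfst (h21.comp hfst) (Primrec.snd.comp Primrec.fst)).and
          ((htv hfst (h22.comp hfst) Primrec.snd).and ((hbt.comp hfst).iff
            (Primrec.eq.comp (Primrec.snd.comp Primrec.fst) Primrec.snd)))))
    have hargs := primrecPred_args (p := fun c v (x : γ) => TermValue S x.1.1.1 x.2.1 c v)
      hcodes har (htv Primrec.snd (Primrec.fst.comp Primrec.fst) (Primrec.snd.comp Primrec.fst))
    have hfact : PrimrecPred fun x : γ × List ℕ =>
        (x.1.1.2.length.unpair.2.unpair.1, x.2) ∈ x.1.1.1.1.2.1 :=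
      PrimrecPred.mem (Primrec.fst.comp (Primrec.snd.comp (hD.comp Primrec.fst)))
        (Primrec.pair (h21.comp Primrec.fst) Primrec.snd)
    have hrel := (Primrec.nat_lt.comp h21 (Primrec.const S.rels.length)).and
      (PrimrecPred.exists_mem (primrec_listsOver.comp helems har)
        (hargs.and ((hbt.comp Primrec.fst).iff hfact)))
    have himp : PrimrecPred fun x : γ => ∃ b₁ b₂,
          (x.2.1, b₁) ∈ x.1.2.getD x.1.2.length.unpair.2.unpair.1 [] ∧
          (x.2.1, b₂) ∈ x.1.2.getD x.1.2.length.unpair.2.unpair.2 [] ∧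
          (x.2.2 = true ↔ (b₁ = true → b₂ = true)) :=
      PrimrecPred.exists_bool fun b₁ => PrimrecPred.exists_bool fun b₂ =>
        (PrimrecPred.mem ((Primrec.list_getD []).comp hT h21)
          (Primrec.pair he (Primrec.const b₁))).and
        ((PrimrecPred.mem ((Primrec.list_getD []).comp hT h22)
          (Primrec.pair he (Primrec.const b₂))).and (hbt.iff (PrimrecPred.const _)))
    have hlook : ∀ b, PrimrecPred fun x : γ × ℕ =>
        (x.1.2.1 ++ [x.2], b) ∈ x.1.1.2.getD x.1.1.2.length.unpair.2 [] := fun b =>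
      PrimrecPred.mem ((Primrec.list_getD []).comp (hT.comp Primrec.fst) (h2.comp Primrec.fst))
        (Primrec.pair (Primrec.list_concat.comp (he.comp Primrec.fst) Primrec.snd)
          (Primrec.const b))
    have hall := (PrimrecPred.forall_mem helems (PrimrecPred.exists_bool hlook)).and
      (hbt.iff (PrimrecPred.forall_mem helems (hlook true)))
    exact hlen.and (((htag 0).and h0).or (((htag 1).and heq).or (((htag 2).and hrel).or
      (((htag 3).and himp).or ((htag 4).and hall)))))
  · rintro ⟨D, K⟩ m ⟨env, b⟩ hx
    simp only [length_predTable]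
    refine and_congr_right fun hK => ?_
    rw [mem_valuations] at hx
    obtain ⟨t, r, rfl⟩ : ∃ t r, m = Nat.pair t r := ⟨_, _, (Nat.pair_unpair m).symm⟩
    simp only [Nat.unpair_pair]
    have hlook : ∀ c b', 0 < t → c ≤ r →
        ((env, b') ∈ (predTable (D.valuations K)
          (fun m' y => y.1.length + m' ≤ K ∧ FormulaValue S D y.1 m' y.2) (Nat.pair t r)).getD c [] ↔
          FormulaValue S D env c b') := by
      intro c b' ht hc
      have hlt := lt_pair_of_pos ht hc
      rw [mem_getD_predTable (P := fun m' (y : List ℕ × Bool) =>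
        y.1.length + m' ≤ K ∧ FormulaValue S D y.1 m' y.2) hlt, mem_valuations]
      exact ⟨fun h => h.2.2, fun h => ⟨hx, by dsimp only; omega, h⟩⟩
    have hlook' : ∀ y ∈ D.elems, ∀ b', 0 < t →
        ((env ++ [y], b') ∈ (predTable (D.valuations K)
          (fun m' y => y.1.length + m' ≤ K ∧ FormulaValue S D y.1 m' y.2) (Nat.pair t r)).getD r [] ↔
          FormulaValue S D (env ++ [y]) r b') := by
      intro y hy b' ht
      have hlt := lt_pair_of_pos (b := r) ht le_rfl
      rw [mem_getD_predTable (P := fun m' (y : List ℕ × Bool) =>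
        y.1.length + m' ≤ K ∧ FormulaValue S D y.1 m' y.2) hlt, mem_valuations]
      have hlen : (env ++ [y]).length = env.length + 1 := by simp
      refine ⟨fun h => h.2.2, fun h => ⟨⟨by omega, ?_⟩, by dsimp only; omega, h⟩⟩
      intro z hz
      rcases List.mem_append.1 hz with hz | hz
      · exact hx.2 z hz
      · rwa [List.mem_singleton.1 hz]
    rcases t with _ | _ | _ | _ | _ | t
    · simp [formulaValue_falsum_iff]
    · obtain ⟨c₁, c₂, rfl⟩ : ∃ c₁ c₂, r = Nat.pair c₁ c₂ := ⟨_, _, (Nat.pair_unpair r).symm⟩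
      simp [formulaValue_equal_iff]
    · obtain ⟨c₁, c₂, rfl⟩ : ∃ c₁ c₂, r = Nat.pair c₁ c₂ := ⟨_, _, (Nat.pair_unpair r).symm⟩
      simp only [zero_add, Nat.reduceAdd, formulaValue_rel_iff, Nat.unpair_pair]
      simp
    · obtain ⟨c₁, c₂, rfl⟩ : ∃ c₁ c₂, r = Nat.pair c₁ c₂ := ⟨_, _, (Nat.pair_unpair r).symm⟩
      simp only [Nat.unpair_pair, hlook _ _ (Nat.succ_pos _) (Nat.left_le_pair _ _),
        hlook _ _ (Nat.succ_pos _) (Nat.right_le_pair _ _)]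
      simp only [zero_add, Nat.reduceAdd, formulaValue_imp_iff]
      simp
    · have h1 := forall₂_congr fun y hy => exists_congr fun b' => hlook' y hy b' (Nat.succ_pos _)
      have h2 := forall₂_congr fun y hy => hlook' y hy true (Nat.succ_pos _)
      rw [h1, h2]
      simp only [zero_add, Nat.reduceAdd, formulaValue_all_iff]
      simp
    · constructor
      · intro h
        have := formulaValue_tag h
        simp only [Nat.unpair_pair] at this
        omega
      · rintro (h | h | h | h | h) <;> exact absurd h.1 (by omega)

/-- Truth in finite structures is decidable, uniformly in the data of the structure. -/
theorem primrecPred_models (S : Signature) : PrimrecPred fun x : FinData × ℕ =>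
    ∃ φ : S.lang.Sentence, code φ = x.2 ∧ x.1.Model S ⊨ φ := by
  -- For the empty assignment the code itself is an admissible bound `K`.
  refine ((primrecPred_formulaValue S).comp (f := fun x : FinData × ℕ =>
    (((x.1, x.2), x.2), (([] : List ℕ), true))) (Primrec.pair (Primrec.pair (Primrec.pair
      Primrec.fst Primrec.snd) Primrec.snd) (Primrec.const _))).of_eq fun x => ?_
  rw [mem_valuations]
  have hd : ∀ n (h : 0 = n), (x.1.assign [] : Fin n → x.1.Model S) = h ▸ default := by
    rintro _ rfl; exact Subsingleton.elim _ _
  constructor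
  · rintro ⟨-, -, n, hn, φ, hφ, h⟩
    obtain rfl : 0 = n := hn
    refine ⟨φ, hφ, ?_⟩
    rw [hd 0 rfl] at h
    exact h.2 rfl
  · rintro ⟨φ, hφ, h⟩
    refine ⟨by simp, by simp, 0, rfl, φ, hφ, ?_⟩
    rw [hd 0 rfl]
    exact iff_of_true h rfl

end FinData

/-- Being the Gödel number of a sentence is decidable. -/
theorem primrecPred_exists_code (S : Signature) :
    PrimrecPred fun m : ℕ => ∃ φ : S.lang.Sentence, code φ = m := by
  -- The number `m` codes a sentence iff the code of "m implies m" codes a true sentence, in any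
  -- fixed finite structure.
  refine ((FinData.primrecPred_models S).comp (f := fun m : ℕ =>
    ((([], [], []) : FinData), Nat.pair 3 (Nat.pair m m))) (Primrec.pair (Primrec.const _)
      (Primrec₂.natPair.comp (Primrec.const 3)
        (Primrec₂.natPair.comp Primrec.id Primrec.id)))).of_eq fun m => ?_
  constructor
  · rintro ⟨φ, hφ, -⟩
    change codeFormula φ = Nat.pair 3 (Nat.pair m m) at hφ
    change S.lang.BoundedFormula Empty 0 at φ
    cases φ with
    | imp φ₁ φ₂ =>
      simp only [codeFormula, Nat.pair_eq_pair, true_and] at hφ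
      exact ⟨φ₁, hφ.1⟩
    | _ => simp [codeFormula, Nat.pair_eq_pair] at hφ
  · rintro ⟨φ, rfl⟩
    exact ⟨φ.imp φ, rfl, by simp [Sentence.Realize, Formula.Realize]⟩

end Interp

/-! ### Deductively closed theories, and diagonalisation against converging finite structures -/

namespace Interp

open FirstOrder FirstOrder.Language

variable {S : Signature}

theorem mem_theorems_iff {T : S.lang.Theory} {φ : S.lang.Sentence} :
    φ ∈ theorems T ↔ ∀ M : Theory.ModelType.{0, 0, 0} T, M ⊨ φ :=
  Theory.models_sentence_iff

theorem subset_theorems (T : S.lang.Theory) : T ⊆ theorems T := fun _ hφ =>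
  mem_theorems_iff.2 fun _ => Theory.realize_sentence_of_mem T hφ

theorem theorems_subset_iff {T T' : S.lang.Theory} :
    theorems T ⊆ theorems T' ↔ T ⊆ theorems T' := by
  refine ⟨(subset_theorems T).trans, fun h φ hφ => mem_theorems_iff.2 fun M => ?_⟩
  have : (M : Type) ⊨ T := ⟨fun ψ hψ => mem_theorems_iff.1 (h hψ) M⟩
  exact mem_theorems_iff.1 hφ (Theory.ModelType.of T M)

/-- A set of sentences is consistent and deductively closed if each of its finite subsets, together
with any further sentence, is decided correctly by some structure. -/
theorem theorems_eq_self {T : S.lang.Theory}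
    (h : ∀ (s : Finset S.lang.Sentence), ∃ (M : Type) (_ : S.lang.Structure M) (_ : Nonempty M),
      ∀ φ ∈ s, M ⊨ φ ↔ φ ∈ T) : theorems T = T ∧ T.IsSatisfiable := by
  classical
  -- By compactness a theorem follows from a finite subset; the structure that is correct about this
  -- subset and about the theorem places the theorem in `T`.
  have h1 : theorems T ⊆ T := by
    intro φ hφ
    obtain ⟨T₀, hT₀, hφ₀⟩ := Theory.models_iff_finset_models.1 hφ
    obtain ⟨M, _, _, hM⟩ := h (insert φ T₀)
    refine (hM φ (Finset.mem_insert_self _ _)).1 ?_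
    have : M ⊨ (T₀ : S.lang.Theory) :=
      ⟨fun ψ hψ => (hM ψ (Finset.mem_insert_of_mem hψ)).2 (hT₀ hψ)⟩
    exact Theory.models_sentence_iff.1 hφ₀ (Theory.ModelType.of _ M)
  refine ⟨h1.antisymm (subset_theorems T), ?_⟩
  by_contra hT
  have hbot : (⊥ : S.lang.Sentence) ∈ T :=
    h1 (mem_theorems_iff.2 fun M => absurd ⟨M⟩ hT)
  obtain ⟨M, _, _, hM⟩ := h {⊥}
  exact (hM ⊥ (Finset.mem_singleton_self _)).2 hbot

/-- No uniformly primitive recursive sequence of finite structures, depending on a sufficiently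
sparse set, converges with a linear modulus to a model of an essentially undecidable theory. -/
theorem exists_sparse_sequence_of_essentiallyUndecidable {A : S.lang.Theory} (hA : RESet A)
    (hE : EssentiallyUndecidable A) :
    ∃ x : ℕ → ℕ, Computable x ∧ StrictMono x ∧
      ∀ X : ℕ → Bool, (∀ n, X n = true → n ∈ Set.range x) →
        ∀ (F : ℕ → ℕ → FinData) (_ : Primrec₂ F) (K : ℕ) (T : S.lang.Theory), A ⊆ T →
          ¬ ∀ φ N s, K * (code φ + 1) ≤ N → s < 2 ^ N → (∀ i < N, s.testBit i = X i) →
            ((F N s).Model S ⊨ φ ↔ φ ∈ T) := by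
  classical
  obtain ⟨E, hEc, hEu⟩ := exists_universal_primrec
  obtain ⟨q, hq, hqA⟩ := rePred_iff_exists.1 hA
  -- The structure with index `c` at stage `N`. Reducing `s` modulo `2 ^ N` keeps its first `N` bits
  -- only; undecodable values yield default data, so everything is total.
  let FD : ℕ → ℕ → ℕ → FinData := fun c N s =>
    (Encodable.decode (E c (Nat.pair N (s % 2 ^ N)))).getD default
  let G : ℕ → ℕ → ℕ → ℕ → Bool := fun c N s m =>
    decide (∃ φ : S.lang.Sentence, code φ = m ∧ (FD c N s).Model S ⊨ φ)
  have hGcode : ∀ c N s (φ : S.lang.Sentence),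
      G c N s (code φ) = true ↔ (FD c N s).Model S ⊨ φ := by
    intro c N s φ
    simp only [G, decide_eq_true_eq]
    constructor
    · rintro ⟨ψ, hψ, h⟩
      rwa [← code_injective hψ]
    · exact fun h => ⟨φ, rfl, h⟩
  have hG : ∀ {α : Type} [Primcodable α] {c N s m : α → ℕ}, Computable c → Computable N →
      Computable s → Computable m → Computable fun a => G (c a) (N a) (s a) (m a) := by
    intro α _ c N s m hc hN hs hm
    have h1 : Computable fun a => s a % 2 ^ N a := Primrec.nat_mod.to_comp.comp hs
      ((Primrec₂.unpaired'.1 Nat.Primrec.pow).to_comp.comp (Computable.const 2) hN)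
    have h2 : Computable fun a => E (c a) (Nat.pair (N a) (s a % 2 ^ N a)) :=
      hEc.comp hc (Primrec₂.natPair.to_comp.comp hN h1)
    have h3 : Computable fun a => FD (c a) (N a) (s a) :=
      Computable.option_getD (Computable.decode.comp h2) (Computable.const default)
    exact (FinData.primrecPred_models S).decide.to_comp.comp (Computable.pair h3 hm)
  -- The requirement `d` is a pair (index `c`, modulus `K`), and a refutation `t` is a quadruple
  -- `(m, st, N, N')` with both stages beyond `K * (m + 1)`: either `m` is seen by step `st` to code
  -- an axiom and fails at stage `N`, or stages `N` and `N'` disagree about `m`.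
  let W : ℕ → ℕ → ℕ → Bool := fun d s t =>
    (decide (d.unpair.2 * (t.unpair.1 + 1) ≤ t.unpair.2.unpair.2.unpair.1) &&
      decide (d.unpair.2 * (t.unpair.1 + 1) ≤ t.unpair.2.unpair.2.unpair.2)) &&
    ((q t.unpair.1 t.unpair.2.unpair.1 &&
        !G d.unpair.1 t.unpair.2.unpair.2.unpair.1 s t.unpair.1) ||
      (G d.unpair.1 t.unpair.2.unpair.2.unpair.1 s t.unpair.1 !=
        G d.unpair.1 t.unpair.2.unpair.2.unpair.2 s t.unpair.1))
  have hW : Computable fun x : (ℕ × ℕ) × ℕ => W x.1.1 x.1.2 x.2 := by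
    have hd := Computable.unpair.comp ((Computable.fst (α := ℕ) (β := ℕ)).comp
      (Computable.fst (α := ℕ × ℕ) (β := ℕ)))
    have hs := (Computable.snd (α := ℕ) (β := ℕ)).comp (Computable.fst (α := ℕ × ℕ) (β := ℕ))
    have ht := Computable.unpair.comp (Computable.snd (α := ℕ × ℕ) (β := ℕ))
    have hm := Computable.fst.comp ht
    have ht2 := Computable.unpair.comp (Computable.snd.comp ht)
    have ht22 := Computable.unpair.comp (Computable.snd.comp ht2)
    have hN := Computable.fst.comp ht22
    have hN' := Computable.snd.comp ht22
    have hmu := Primrec.nat_mul.to_comp.comp (Computable.snd.comp hd) (Computable.succ.comp hm)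
    have hle : Computable₂ fun a b : ℕ => decide (a ≤ b) := Primrec.nat_le.decide.to_comp
    have hg := hG (Computable.fst.comp hd) hN hs hm
    have hg' := hG (Computable.fst.comp hd) hN' hs hm
    exact Primrec.and.to_comp.comp
      (Primrec.and.to_comp.comp (hle.comp hmu hN) (hle.comp hmu hN'))
      (Primrec.or.to_comp.comp
        (Primrec.and.to_comp.comp (hq.comp hm (Computable.fst.comp ht2))
          (Primrec.not.to_comp.comp hg))
        ((Primrec.dom_bool₂ fun a b => a != b).to_comp.comp hg hg'))
  have hWpair : ∀ c K s m st N N', W (Nat.pair c K) s (Nat.pair m (Nat.pair st (Nat.pair N N'))) =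
      true ↔ (K * (m + 1) ≤ N ∧ K * (m + 1) ≤ N') ∧
        ((q m st = true ∧ G c N s m = false) ∨ G c N s m ≠ G c N' s m) := by
    intro c K s m st N N'
    simp [W]
  have hex : ∀ d s, ∃ t, W d s t = true := by
    intro d s
    obtain ⟨c, K, rfl⟩ : ∃ c K, d = Nat.pair c K := ⟨_, _, (Nat.pair_unpair d).symm⟩
    by_contra hno
    have hno : ∀ m st N N', K * (m + 1) ≤ N → K * (m + 1) ≤ N' →
        (q m st = true → G c N s m = true) ∧ G c N s m = G c N' s m := by
      intro m st N N' h h'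
      have := fun hh => hno ⟨_, (hWpair c K s m st N N').2 hh⟩
      constructor
      · intro hqm
        by_contra hg
        exact this ⟨⟨h, h'⟩, .inl ⟨hqm, by simpa using hg⟩⟩
      · by_contra hg
        exact this ⟨⟨h, h'⟩, .inr hg⟩
    -- The limit theory. Without a refutation, each truth value is final at the stage given by the
    -- modulus, so `T` is decidable, contains the axioms, and is consistent and deductively closed.
    let T : S.lang.Theory := {φ | G c (K * (code φ + 1)) s (code φ) = true}
    have hT : theorems T = T ∧ T.IsSatisfiable := by
      refine theorems_eq_self fun Φ => ?_
      -- The sum is a stage beyond the moduli of all sentences in `Φ`, so one finite structure is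
      -- correct about all of them.
      refine ⟨(FD c (∑ φ ∈ Φ, K * (code φ + 1)) s).Model S, inferInstance, inferInstance,
        fun φ hφ => ?_⟩
      rw [← hGcode, (hno (code φ) 0 (∑ φ ∈ Φ, K * (code φ + 1)) (K * (code φ + 1))
        (Finset.single_le_sum (f := fun φ => K * (code φ + 1)) (fun _ _ => Nat.zero_le _) hφ)
        le_rfl).2]
      rfl
    refine hE T ?_ hT.2 ?_
    · rw [theorems_subset_iff, hT.1]
      intro φ hφ
      obtain ⟨st, hst⟩ := (hqA (code φ)).1 ⟨φ, hφ, rfl⟩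
      exact (hno (code φ) st _ _ le_rfl le_rfl).1 hst
    · refine ComputablePred.computable_iff.2 ⟨fun m => G c (K * (m + 1)) s m, ?_, ?_⟩
      · exact hG (Computable.const c) (Primrec.nat_mul.to_comp.comp (Computable.const K)
          Computable.succ) (Computable.const s) Computable.id
      · funext m
        rw [hT.1]
        refine propext ⟨?_, fun h => ?_⟩
        · rintro ⟨φ, hφ, rfl⟩
          exact hφ
        · obtain ⟨φ, rfl, -⟩ := of_decide_eq_true h
          exact ⟨φ, h, rfl⟩
  obtain ⟨x, hx, hmono, hdiag⟩ := exists_sparse_sequence W hW hex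
  refine ⟨x, hx, hmono, fun X hX F hF K T hAT hconv => ?_⟩
  -- The family `F` has an index `c` in the enumeration. The refutation for `(c, K)` involves only
  -- bits below `N` and `N'`, which are at most `t`, and there `s` agrees with `X`; so it
  -- contradicts convergence along `X`.
  obtain ⟨c, hc⟩ := hEu (fun n => Encodable.encode (F n.unpair.1 n.unpair.2))
    (Primrec.nat_iff.1 (Primrec.encode.comp (hF.comp (Primrec.fst.comp Primrec.unpair)
      (Primrec.snd.comp Primrec.unpair))))
  obtain ⟨s, t, hst, hbit⟩ := hdiag X hX (Nat.pair c K)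
  obtain ⟨m, st, N, N', rfl⟩ : ∃ m st N N', t = Nat.pair m (Nat.pair st (Nat.pair N N')) :=
    ⟨t.unpair.1, t.unpair.2.unpair.1, t.unpair.2.unpair.2.unpair.1,
      t.unpair.2.unpair.2.unpair.2, by simp⟩
  have hFD : ∀ N, FD c N s = F N (s % 2 ^ N) := fun N => by
    simp only [FD, hc, Nat.unpair_pair, Encodable.encodek, Option.getD_some]
  have hNt : N ≤ Nat.pair m (Nat.pair st (Nat.pair N N')) :=
    (Nat.left_le_pair _ _).trans ((Nat.right_le_pair _ _).trans (Nat.right_le_pair _ _))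
  have hNt' : N' ≤ Nat.pair m (Nat.pair st (Nat.pair N N')) :=
    (Nat.right_le_pair _ _).trans ((Nat.right_le_pair _ _).trans (Nat.right_le_pair _ _))
  have key : ∀ M, M ≤ Nat.pair m (Nat.pair st (Nat.pair N N')) → K * (m + 1) ≤ M →
      (G c M s m = true ↔ ∃ φ ∈ T, code φ = m) := by
    intro M hM hKM
    have hb : ∀ i < M, (s % 2 ^ M).testBit i = X i := fun i hi => by
      rw [Nat.testBit_mod_two_pow, ← hbit i (hi.le.trans hM)]
      simp [hi]
    constructor
    · intro h
      obtain ⟨φ, rfl, hφ⟩ := of_decide_eq_true h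
      rw [hFD] at hφ
      exact ⟨φ, (hconv φ M _ hKM (Nat.mod_lt _ (by positivity)) hb).1 hφ, rfl⟩
    · rintro ⟨φ, hφ, rfl⟩
      rw [hGcode, hFD]
      exact (hconv φ M _ hKM (Nat.mod_lt _ (by positivity)) hb).2 hφ
  obtain ⟨⟨h1, h2⟩, ⟨h3, h4⟩ | h3⟩ := (hWpair c K s m st N N').1 hst
  · obtain ⟨φ, hφ, rfl⟩ := (hqA m).2 ⟨st, h3⟩
    rw [(key N hNt h1).2 ⟨φ, hAT hφ, rfl⟩] at h4
    exact Bool.noConfusion h4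
  · exact h3 (Bool.eq_iff_iff.2 ((key N hNt h1).trans (key N' hNt' h2).symm))

end Interp

namespace Interp

open FirstOrder FirstOrder.Language

/-! ### Back-and-forth systems -/

variable {L : FirstOrder.Language.{0, 0}}

/-- The number of occurrences of function symbols in a term. -/
def termSize {α : Type} : L.Term α → ℕ
  | .var _ => 0
  | .func _ ts => 1 + ∑ i, termSize (ts i)

/-- The number of values that have to be picked in order to evaluate a formula. -/
def formulaSize {α : Type} : {n : ℕ} → L.BoundedFormula α n → ℕ
  | _, .falsum => 0
  | _, .equal t u => 1 + (termSize t + termSize u)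
  | _, .rel _ ts => ∑ i, termSize (ts i)
  | _, .imp φ ψ => formulaSize φ + formulaSize ψ
  | _, .all φ => 1 + formulaSize φ

/-- A graded system of finite partial isomorphisms, given by lists of pairs, in which every pair of
grade `r + 1` extends by any further element, on either side, to one of grade `r`. -/
structure BackAndForth (M N : Type) [L.Structure M] [L.Structure N]
    (Z : ℕ → List (M × N) → Prop) : Prop where
  mono : ∀ {r r' l l'}, Z r l → r' ≤ r → (∀ x ∈ l', x ∈ l) → Z r' l'
  forth : ∀ {r l}, Z (r + 1) l → ∀ x, ∃ y, Z r ((x, y) :: l)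
  back : ∀ {r l}, Z (r + 1) l → ∀ y, ∃ x, Z r ((x, y) :: l)
  eq_iff : ∀ {r l}, Z r l → ∀ p ∈ l, ∀ q ∈ l, p.1 = q.1 ↔ p.2 = q.2
  rel_iff : ∀ {r l}, Z r l → ∀ {n} (R : L.Relations n) (a : Fin n → M × N), (∀ i, a i ∈ l) →
    (Structure.RelMap R (fun i => (a i).1) ↔ Structure.RelMap R fun i => (a i).2)
  fun_iff : ∀ {r l}, Z r l → ∀ {n} (f : L.Functions n) (a : Fin n → M × N), (∀ i, a i ∈ l) →
    ∀ p ∈ l, Structure.funMap f (fun i => (a i).1) = p.1 ↔ Structure.funMap f (fun i => (a i).2) = p.2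

namespace BackAndForth

variable {M N : Type} [L.Structure M] [L.Structure N] {Z : ℕ → List (M × N) → Prop}

/-- A family of extension steps can be carried out one after the other. -/
theorem exists_family {r n : ℕ} (k : Fin n → ℕ) (C : Fin n → M × N → Prop) {l : List (M × N)}
    (step : ∀ i r l', Z (r + k i) l' → (∀ x ∈ l, x ∈ l') → ∃ p, C i p ∧ Z r (p :: l'))
    (h : Z (r + ∑ i, k i) l) :
    ∃ (a : Fin n → M × N) (l' : List (M × N)), Z r l' ∧ (∀ x ∈ l, x ∈ l') ∧
      (∀ i, a i ∈ l') ∧ ∀ i, C i (a i) := by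
  induction n generalizing r with
  | zero => exact ⟨Fin.elim0, l, by simpa using h, fun _ => id, fun i => i.elim0, fun i => i.elim0⟩
  | succ n ih =>
    rw [Fin.sum_univ_castSucc, ← add_assoc, add_right_comm] at h
    obtain ⟨a, l', h1, h2, h3, h4⟩ := ih (fun i => k i.castSucc) (fun i => C i.castSucc)
      (fun i => step i.castSucc) h
    obtain ⟨p, hp, h5⟩ := step (Fin.last n) r l' h1 h2
    refine ⟨Fin.snoc a p, p :: l', h5, fun x hx => List.mem_cons_of_mem _ (h2 x hx), ?_, ?_⟩
    · intro i
      refine Fin.lastCases ?_ (fun i => ?_) i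
      · simp
      · simpa using Or.inr (h3 i)
    · intro i
      refine Fin.lastCases ?_ (fun i => ?_) i
      · simpa using hp
      · simpa using h4 i

/-- Each occurrence of a function symbol costs one move: the value on the left is added, and
`fun_iff` forces its partner to be the value on the right. The systems themselves need not be closed
under functions. -/
theorem exists_pair_realize (hZ : BackAndForth (L := L) M N Z) {α : Type} (t : L.Term α) {r : ℕ}
    {l : List (M × N)} (h : Z (r + termSize t) l) (v : α → M × N) (hv : ∀ i, v i ∈ l) :
    ∃ l', (∀ x ∈ l, x ∈ l') ∧ Z r l' ∧
      (t.realize fun i => (v i).1, t.realize fun i => (v i).2) ∈ l' := by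
  induction t generalizing r l with
  | var i => exact ⟨l, fun _ => id, h, hv i⟩
  | @func n f ts ih =>
    rw [termSize, ← add_assoc] at h
    obtain ⟨a, l', h1, h2, h3, h4⟩ := exists_family (fun i => termSize (ts i))
      (fun i p => p = ((ts i).realize fun i => (v i).1, (ts i).realize fun i => (v i).2))
      (fun i r l' hl' hl => by
        obtain ⟨l'', h1, h2, h3⟩ := ih i hl' fun i => hl _ (hv i)
        refine ⟨_, rfl, hZ.mono h2 le_rfl ?_⟩
        rintro x hx
        rcases List.mem_cons.1 hx with rfl | hx
        exacts [h3, h1 x hx]) h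
    obtain ⟨y, hy⟩ := hZ.forth h1 (Structure.funMap f fun i => (a i).1)
    have h5 := (hZ.fun_iff hy f a (fun i => List.mem_cons_of_mem _ (h3 i)) _
      List.mem_cons_self).1 rfl
    refine ⟨_, fun x hx => List.mem_cons_of_mem _ (h2 x hx), hy, ?_⟩
    simp only at h5
    rw [Term.realize_func, Term.realize_func, ← h5]
    simp [h4]

theorem realize_iff (hZ : BackAndForth (L := L) M N Z) {α : Type} {n : ℕ}
    (φ : L.BoundedFormula α n) {l : List (M × N)} (h : Z (formulaSize φ) l) (v : α → M × N)
    (hv : ∀ i, v i ∈ l) (w : Fin n → M × N) (hw : ∀ i, w i ∈ l) :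
    φ.Realize (fun i => (v i).1) (fun i => (w i).1) ↔
      φ.Realize (fun i => (v i).2) fun i => (w i).2 := by
  have hsum : ∀ {m : ℕ} (w : Fin m → M × N),
      ((Sum.elim (fun i => (v i).1) fun i => (w i).1) = fun i => (Sum.elim v w i).1) ∧
      (Sum.elim (fun i => (v i).2) fun i => (w i).2) = fun i => (Sum.elim v w i).2 :=
    fun w => ⟨by funext i; cases i <;> rfl, by funext i; cases i <;> rfl⟩
  induction φ generalizing l with
  | falsum => rfl
  | equal t u =>
    rw [formulaSize, ← add_assoc] at h
    have hvw : ∀ i, Sum.elim v w i ∈ l := fun i => by cases i <;> simp [hv, hw]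
    obtain ⟨l₁, h1, h2, h3⟩ := hZ.exists_pair_realize u h _ hvw
    obtain ⟨l₂, h4, h5, h6⟩ := hZ.exists_pair_realize t h2 _ fun i => h1 _ (hvw i)
    have := hZ.eq_iff h5 _ h6 _ (h4 _ h3)
    simpa only [BoundedFormula.Realize, (hsum w).1, (hsum w).2] using this
  | @rel m k R ts =>
    have hvw : ∀ i, Sum.elim v w i ∈ l := fun i => by cases i <;> simp [hv, hw]
    rw [formulaSize, ← zero_add (∑ i, _)] at h
    obtain ⟨a, l', h1, h2, h3, h4⟩ := exists_family (fun i => termSize (ts i))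
      (fun i p => p = ((ts i).realize fun i => (Sum.elim v w i).1,
        (ts i).realize fun i => (Sum.elim v w i).2))
      (fun i r l' hl' hl => by
        obtain ⟨l'', h1, h2, h3⟩ := hZ.exists_pair_realize (ts i) hl' _ fun i => hl _ (hvw i)
        refine ⟨_, rfl, hZ.mono h2 le_rfl ?_⟩
        rintro x hx
        rcases List.mem_cons.1 hx with rfl | hx
        exacts [h3, h1 x hx]) h
    have := hZ.rel_iff h1 R a h3
    simpa only [BoundedFormula.Realize, (hsum w).1, (hsum w).2, h4] using this
  | imp φ ψ h1 h2 =>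
    rw [formulaSize] at h
    exact imp_congr (h1 (hZ.mono h (Nat.le_add_right _ _) fun _ => id) hv w hw)
      (h2 (hZ.mono h (Nat.le_add_left _ _) fun _ => id) hv w hw)
  | all φ ih =>
    rw [formulaSize, add_comm] at h
    have key : ∀ x y, Z (formulaSize φ) ((x, y) :: l) →
        (φ.Realize (fun i => (v i).1) (Fin.snoc (fun i => (w i).1) x) ↔
          φ.Realize (fun i => (v i).2) (Fin.snoc (fun i => (w i).2) y)) := by
      intro x y hxy
      have h1 : (Fin.snoc (fun i => (w i).1) x : Fin _ → M) =
          fun i => ((Fin.snoc w (x, y) : Fin _ → M × N) i).1 := by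
        funext i
        refine Fin.lastCases ?_ (fun i => ?_) i <;> simp
      have h2 : (Fin.snoc (fun i => (w i).2) y : Fin _ → N) =
          fun i => ((Fin.snoc w (x, y) : Fin _ → M × N) i).2 := by
        funext i
        refine Fin.lastCases ?_ (fun i => ?_) i <;> simp
      rw [h1, h2]
      refine ih hxy (fun i => List.mem_cons_of_mem _ (hv i)) _ fun i => ?_
      refine Fin.lastCases ?_ (fun i => ?_) i
      · simp
      · simpa using Or.inr (hw i)
    rw [BoundedFormula.realize_all, BoundedFormula.realize_all]
    constructor
    · intro H y
      obtain ⟨x, hx⟩ := hZ.back h y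
      exact (key x y hx).1 (H x)
    · intro H x
      obtain ⟨y, hy⟩ := hZ.forth h x
      exact (key x y hy).2 (H y)

theorem realize_formula_iff (hZ : BackAndForth (L := L) M N Z) {α : Type} (φ : L.Formula α)
    {l : List (M × N)} (h : Z (formulaSize φ) l) (v : α → M × N) (hv : ∀ i, v i ∈ l) :
    φ.Realize (fun i => (v i).1) ↔ φ.Realize fun i => (v i).2 := by
  have := hZ.realize_iff φ h v hv Fin.elim0 fun i => i.elim0
  rwa [Subsingleton.elim (fun i : Fin 0 => (Fin.elim0 i : M × N).1) default,
    Subsingleton.elim (fun i : Fin 0 => (Fin.elim0 i : M × N).2) default] at this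

theorem realize_sentence_iff (hZ : BackAndForth (L := L) M N Z) (φ : L.Sentence)
    {l : List (M × N)} (h : Z (formulaSize φ) l) : M ⊨ φ ↔ N ⊨ φ := by
  have := hZ.realize_formula_iff φ h Empty.elim fun i => i.elim
  rwa [Subsingleton.elim (fun i : Empty => (Empty.elim i : M × N).1) default,
    Subsingleton.elim (fun i : Empty => (Empty.elim i : M × N).2) default] at this

end BackAndForth

variable {S : Signature}

theorem sum_le_encode_list {n : ℕ} (f g : Fin n → ℕ) (h : ∀ i, f i ≤ g i) :
    ∑ i, f i ≤ Encodable.encode (List.ofFn g) := by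
  induction n with
  | zero => simp
  | succ n ih =>
    rw [Fin.sum_univ_succ, List.ofFn_succ, Encodable.encode_list_cons]
    have h1 := ih (fun i => f i.succ) (fun i => g i.succ) fun i => h i.succ
    have h2 := Nat.add_le_pair (g 0) (Encodable.encode (List.ofFn fun i => g i.succ))
    have h3 := h 0
    simp only [Encodable.encode_nat]
    omega

theorem termSize_le_codeTerm {n : ℕ} (t : S.lang.Term (Empty ⊕ Fin n)) :
    termSize t ≤ codeTerm t := by
  induction t with
  | var x => exact Nat.zero_le _
  | func f ts ih =>
    have h1 := sum_le_encode_list _ _ ih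
    have h2 := Nat.right_le_pair (f.1 : Fin S.funcs.length)
      (Encodable.encode (List.ofFn fun i => codeTerm (ts i)))
    have h3 := Nat.add_le_pair 1 (Nat.pair (f.1 : Fin S.funcs.length)
      (Encodable.encode (List.ofFn fun i => codeTerm (ts i))))
    simp only [termSize, codeTerm]
    omega

/-- Turns the number of moves that a sentence requires into a bound linear in its Gödel number, the
form of modulus used in the diagonalisation. -/
theorem formulaSize_le_codeFormula {n : ℕ} (φ : S.lang.BoundedFormula Empty n) :
    formulaSize φ ≤ codeFormula φ := by
  induction φ with
  | falsum => exact Nat.zero_le _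
  | equal t u =>
    have h1 := termSize_le_codeTerm t
    have h2 := termSize_le_codeTerm u
    have h3 := Nat.add_le_pair (codeTerm t) (codeTerm u)
    have h4 := Nat.add_le_pair 1 (Nat.pair (codeTerm t) (codeTerm u))
    simp only [formulaSize, codeFormula]
    omega
  | rel R ts =>
    have h1 := sum_le_encode_list _ _ fun i => termSize_le_codeTerm (ts i)
    simp only [formulaSize, codeFormula]
    exact h1.trans ((Nat.right_le_pair _ _).trans (Nat.right_le_pair _ _))
  | imp φ ψ h1 h2 =>
    have h3 := Nat.add_le_pair (codeFormula φ) (codeFormula ψ)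
    have h4 := Nat.right_le_pair 3 (Nat.pair (codeFormula φ) (codeFormula ψ))
    simp only [formulaSize, codeFormula]
    omega
  | all φ h1 =>
    have h4 := Nat.add_le_pair 4 (codeFormula φ)
    simp only [formulaSize, codeFormula]
    omega

end Interp

namespace Interp

open FirstOrder FirstOrder.Language

/-! ### Adding a propositional symbol and a binary relation symbol to a signature -/

/-- The signature with an additional propositional symbol and an additional binary relation
symbol. -/
def Signature.extend (S : Signature) : Signature := ⟨S.funcs, S.rels ++ [0, 2]⟩

variable {S : Signature}

/-- The relation symbols of the original signature in the extended signature. -/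
def oldRel {n : ℕ} (R : S.lang.Relations n) : S.extend.lang.Relations n :=
  ⟨⟨(R.1 : Fin S.rels.length).1, by simp [Signature.extend]; omega⟩, by
    obtain ⟨R, rfl⟩ := R
    simp [Signature.extend, List.getElem_append_left]⟩

/-- The additional propositional symbol. -/
def symP (S : Signature) : S.extend.lang.Relations 0 :=
  ⟨⟨S.rels.length, by simp [Signature.extend]⟩, by simp [Signature.extend]⟩

/-- The additional binary relation symbol. -/
def symE (S : Signature) : S.extend.lang.Relations 2 :=
  ⟨⟨S.rels.length + 1, by simp [Signature.extend]⟩, by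
    simp [Signature.extend, List.getElem_append_right]⟩

/-- The inclusion of languages. -/
def inclusion (S : Signature) : S.lang →ᴸ S.extend.lang where
  onFunction _ f := f
  onRelation _ R := oldRel R

theorem codeTerm_onTerm {n : ℕ} (t : S.lang.Term (Empty ⊕ Fin n)) :
    codeTerm ((inclusion S).onTerm t) = codeTerm t := by
  induction t with
  | var x => rcases x with e | k <;> [exact e.elim; rfl]
  | func f ts ih =>
    show Nat.pair 1 (Nat.pair _ (Encodable.encode (List.ofFn fun i =>
      codeTerm ((inclusion S).onTerm (ts i))))) = _
    simp only [ih]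
    rfl

theorem codeFormula_onBoundedFormula {n : ℕ} (φ : S.lang.BoundedFormula Empty n) :
    codeFormula ((inclusion S).onBoundedFormula φ) = codeFormula φ := by
  induction φ with
  | falsum => rfl
  | equal t u =>
    show Nat.pair 1 (Nat.pair (codeTerm ((inclusion S).onTerm t))
      (codeTerm ((inclusion S).onTerm u))) = _
    rw [codeTerm_onTerm, codeTerm_onTerm]
    rfl
  | rel R ts =>
    show Nat.pair 2 (Nat.pair _ (Encodable.encode (List.ofFn fun i =>
      codeTerm ((inclusion S).onTerm (ts i))))) = _
    simp only [codeTerm_onTerm]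
    rfl
  | imp φ ψ h1 h2 =>
    show Nat.pair 3 (Nat.pair (codeFormula ((inclusion S).onBoundedFormula φ))
      (codeFormula ((inclusion S).onBoundedFormula ψ))) = _
    rw [h1, h2]
    rfl
  | all φ h1 =>
    show Nat.pair 4 (codeFormula ((inclusion S).onBoundedFormula φ)) = _
    rw [h1]
    rfl

/-- New relation symbols are appended at the end, so the old ones keep their positions, and
enumerations of sentences carry over without recoding. -/
theorem code_onSentence (φ : S.lang.Sentence) : code ((inclusion S).onSentence φ) = code φ :=
  codeFormula_onBoundedFormula φ

/-! ### Structures of equivalence classes -/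

/-- The class of an element. -/
def cls (x : ℕ) : ℕ := x.unpair.1

/-- The default element. -/
def basePoint : ℕ := Nat.pair 1 0

/-- The elements of `D`, together with the default element. -/
def Carrier (_ : Signature) (D : Set ℕ) : Type := {x : ℕ // x = basePoint ∨ x ∈ D}

instance (D : Set ℕ) : Nonempty (Carrier S D) := ⟨⟨basePoint, .inl rfl⟩⟩

theorem Carrier.ext_iff {D : Set ℕ} {x y : Carrier S D} : x = y ↔ x.1 = y.1 := Subtype.ext_iff

/-- The symbols of the original signature are interpreted trivially; the additional propositional
symbol is false, and the additional relation symbol is the equivalence relation given by `cls`. -/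
instance (D : Set ℕ) : S.extend.lang.Structure (Carrier S D) where
  funMap _ _ := ⟨basePoint, .inl rfl⟩
  RelMap R xs := (R.1 : Fin S.extend.rels.length).1 = S.rels.length + 1 ∧
    cls ((List.ofFn fun i => (xs i).1).getD 0 0) = cls ((List.ofFn fun i => (xs i).1).getD 1 0)

theorem not_relMap_symP {D : Set ℕ} (xs : Fin 0 → Carrier S D) :
    ¬ Structure.RelMap (symP S) xs := fun h => by
  have h1 : S.rels.length = S.rels.length + 1 := h.1
  omega

theorem relMap_symE {D : Set ℕ} (xs : Fin 2 → Carrier S D) :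
    Structure.RelMap (symE S) xs ↔ cls (xs 0).1 = cls (xs 1).1 :=
  ⟨fun h => h.2, fun h => ⟨rfl, h⟩⟩

/-- The value of a term in structures of equivalence classes. -/
def classTerm {α : Type} (v : α → ℕ) : S.extend.lang.Term α → ℕ
  | .var x => v x
  | .func _ _ => basePoint

/-- The truth value of a formula in the structure of equivalence classes with domain `D`. -/
def classSat (D : Set ℕ) {α : Type} (v : α → ℕ) :
    {n : ℕ} → S.extend.lang.BoundedFormula α n → (Fin n → ℕ) → Prop
  | _, .falsum, _ => False
  | _, .equal t u, xs => classTerm (Sum.elim v xs) t = classTerm (Sum.elim v xs) u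
  | _, .rel R ts, xs => (R.1 : Fin S.extend.rels.length).1 = S.rels.length + 1 ∧
      cls ((List.ofFn fun i => classTerm (Sum.elim v xs) (ts i)).getD 0 0) =
        cls ((List.ofFn fun i => classTerm (Sum.elim v xs) (ts i)).getD 1 0)
  | _, .imp φ ψ, xs => classSat D v φ xs → classSat D v ψ xs
  | _, .all φ, xs => ∀ x, (x = basePoint ∨ x ∈ D) → classSat D v φ (Fin.snoc xs x)

theorem classTerm_eq {D : Set ℕ} {α : Type} (v : α → Carrier S D) (t : S.extend.lang.Term α) :
    classTerm (fun i => (v i).1) t = (t.realize v).1 := by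
  cases t <;> rfl

/-- Truth restated with plain numbers instead of elements of a type depending on `D`, so that it can
be computed uniformly when `D` varies over finite lists. -/
theorem classSat_iff {D : Set ℕ} {α : Type} (v : α → Carrier S D) {n : ℕ}
    (φ : S.extend.lang.BoundedFormula α n) (xs : Fin n → Carrier S D) :
    classSat D (fun i => (v i).1) φ (fun i => (xs i).1) ↔ φ.Realize v xs := by
  have hsum : ∀ {m : ℕ} (w : Fin m → Carrier S D),
      (Sum.elim (fun i => (v i).1) fun i => (w i).1) = fun i => (Sum.elim v w i).1 :=
    fun w => by funext i; cases i <;> rfl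
  induction φ with
  | falsum => rfl
  | equal t u =>
    simp only [classSat, hsum, classTerm_eq]
    exact Subtype.ext_iff.symm
  | rel R ts =>
    simp only [classSat, hsum, classTerm_eq]
    rfl
  | imp φ ψ h1 h2 => exact imp_congr (h1 xs) (h2 xs)
  | all φ ih =>
    have : ∀ x : Carrier S D, (Fin.snoc (fun i => (xs i).1) x.1 : Fin _ → ℕ) =
        fun i => ((Fin.snoc xs x : Fin _ → Carrier S D) i).1 := by
      intro x
      funext i
      refine Fin.lastCases ?_ (fun i => ?_) i <;> simp
    rw [BoundedFormula.realize_all]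
    constructor
    · intro h x
      have hx := h x.1 x.2
      rw [this x] at hx
      exact (ih _).1 hx
    · intro h x hx
      have hx' := (ih _).2 (h ⟨x, hx⟩)
      rwa [← this ⟨x, hx⟩] at hx'

theorem primrec_classTerm {β : Type} [Primcodable β] {α : Type} {v : α → β → ℕ}
    (hv : ∀ a, Primrec (v a)) (t : S.extend.lang.Term α) :
    Primrec fun b => classTerm (fun a => v a b) t := by
  cases t with
  | var x => exact hv x
  | func f ts => exact Primrec.const _

/-- Truth of a fixed formula in finite structures of equivalence classes is primitive recursive. -/
theorem primrecPred_classSat {α : Type} {n : ℕ} (φ : S.extend.lang.BoundedFormula α n) {β : Type}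
    [Primcodable β] {l : β → List ℕ} (hl : Primrec l) {v : α → β → ℕ} (hv : ∀ a, Primrec (v a))
    {xs : Fin n → β → ℕ} (hxs : ∀ i, Primrec (xs i)) :
    PrimrecPred fun b => classSat {x | x ∈ l b} (fun a => v a b) φ fun i => xs i b := by
  have hsum : ∀ {γ : Type} [Primcodable γ] {v : α → γ → ℕ} (_ : ∀ a, Primrec (v a)) {m : ℕ}
      {w : Fin m → γ → ℕ} (_ : ∀ a, Primrec (w a)) (t : S.extend.lang.Term (α ⊕ Fin m)),
      Primrec fun b => classTerm (Sum.elim (fun a => v a b) fun i => w i b) t := by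
    intro γ _ v hv m w hw t
    refine (primrec_classTerm (v := Sum.elim v w) (fun a => ?_) t).of_eq fun b => ?_
    · cases a
      exacts [hv _, hw _]
    · congr 1
      funext i
      cases i <;> rfl
  induction φ generalizing β with
  | falsum => exact PrimrecPred.const False
  | equal t u => exact Primrec.eq.comp (hsum hv hxs t) (hsum hv hxs u)
  | @rel m k R ts =>
    have h : Primrec fun b => List.ofFn fun i =>
        classTerm (Sum.elim (fun a => v a b) fun i => xs i b) (ts i) :=
      Primrec.list_ofFn fun i => hsum hv hxs (ts i)
    have hc : Primrec cls := Primrec.fst.comp Primrec.unpair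
    exact (PrimrecPred.const _).and (Primrec.eq.comp
      (hc.comp ((Primrec.list_getD 0).comp h (Primrec.const 0)))
      (hc.comp ((Primrec.list_getD 0).comp h (Primrec.const 1))))
  | imp φ ψ h1 h2 => exact (h1 hl hv hxs).imp (h2 hl hv hxs)
  | @all m φ ih =>
    have h1 := ih (β := β × ℕ) (l := fun b => l b.1) (hl.comp Primrec.fst)
      (v := fun a b => v a b.1) (fun a => (hv a).comp Primrec.fst)
      (xs := Fin.snoc (fun i b => xs i b.1) fun b => b.2) (fun i => by
        refine Fin.lastCases ?_ (fun i => ?_) i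
        · simpa using Primrec.snd
        · simpa using (hxs i).comp Primrec.fst)
    refine (PrimrecPred.forall_mem (Primrec.list_cons.comp (Primrec.const basePoint) hl)
      h1).of_eq fun b => ?_
    have : ∀ x : ℕ, (fun i => (Fin.snoc (fun i b => xs i b.1) (fun b => b.2) :
        Fin (m + 1) → β × ℕ → ℕ) i (b, x)) = Fin.snoc (fun i => xs i b) x := by
      intro x
      funext i
      refine Fin.lastCases ?_ (fun i => ?_) i <;> simp
    simp only [this, List.mem_cons]
    rfl

/-! ### Back-and-forth between structures of equivalence classes -/

/-- The classes that are determined by the first `N` values of a set. -/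
def Small (N i : ℕ) : Prop := i % 2 = 0 ∧ i < 2 * N

/-- There are many large classes, and all classes are large or small. -/
structure Rich (N : ℕ) (D : Set ℕ) : Prop where
  odd : ∀ i < N, ∀ j < N, Nat.pair (2 * i + 1) j ∈ D
  large : ∀ x ∈ D, Small N (cls x) ∨ ∀ j < N, Nat.pair (cls x) j ∈ D

/-- A finite partial isomorphism that is the identity on small classes. -/
structure Matching (N : ℕ) (l : List (ℕ × ℕ)) : Prop where
  eq_iff : ∀ p ∈ l, ∀ q ∈ l, p.1 = q.1 ↔ p.2 = q.2
  cls_iff : ∀ p ∈ l, ∀ q ∈ l, cls p.1 = cls q.1 ↔ cls p.2 = cls q.2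
  small : ∀ p ∈ l, Small N (cls p.1) ∨ Small N (cls p.2) → p.1 = p.2

theorem Matching.swap {N : ℕ} {l : List (ℕ × ℕ)} (h : Matching N l) :
    Matching N (l.map Prod.swap) where
  eq_iff := by
    simp only [List.forall_mem_map]
    exact fun p hp q hq => (h.eq_iff p hp q hq).symm
  cls_iff := by
    simp only [List.forall_mem_map]
    exact fun p hp q hq => (h.cls_iff p hp q hq).symm
  small := by
    simp only [List.forall_mem_map]
    exact fun p hp hs => (h.small p hp hs.symm).symm

theorem matching_cons {N : ℕ} {l : List (ℕ × ℕ)} (h : Matching N l) {x y : ℕ}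
    (h1 : ∀ p ∈ l, x = p.1 ↔ y = p.2) (h2 : ∀ p ∈ l, cls x = cls p.1 ↔ cls y = cls p.2)
    (h3 : Small N (cls x) ∨ Small N (cls y) → x = y) : Matching N ((x, y) :: l) where
  eq_iff := by
    simp only [List.forall_mem_cons, iff_self, true_and]
    exact ⟨h1, fun p hp => ⟨by rw [eq_comm, h1 p hp, eq_comm], h.eq_iff p hp⟩⟩
  cls_iff := by
    simp only [List.forall_mem_cons, iff_self, true_and]
    exact ⟨h2, fun p hp => ⟨by rw [eq_comm, h2 p hp, eq_comm], h.cls_iff p hp⟩⟩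
  small := by
    simp only [List.forall_mem_cons]
    exact ⟨h3, h.small⟩

theorem exists_notMem_of_length_lt {f : ℕ → ℕ} (hf : Function.Injective f) {l : List ℕ} {N : ℕ}
    (h : l.length < N) : ∃ j < N, f j ∉ l := by
  by_contra hno
  push Not at hno
  have h1 : (Finset.range N).image f ⊆ l.toFinset := by
    intro x hx
    obtain ⟨j, hj, rfl⟩ := Finset.mem_image.1 hx
    exact List.mem_toFinset.2 (hno j (Finset.mem_range.1 hj))
  have h2 := (Finset.card_le_card h1).trans (List.toFinset_card_le l)
  rw [Finset.card_image_of_injective _ hf, Finset.card_range] at h2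
  omega

@[simp] theorem cls_pair (i j : ℕ) : cls (Nat.pair i j) = i := by simp [cls]

/-- An element of a small class answers itself, and an old element is answered by its partner. A new
element of a large class already met is answered by an unused one in the partner class, which is
large as well; an element of a new large class is answered in an unused odd class. With fewer than
`N` pairs present, there is always room. -/
theorem Matching.exists_extension {N : ℕ} {D D' : Set ℕ} (hD' : Rich N D')
    (hagree : ∀ x, Small N (cls x) → (x ∈ D ↔ x ∈ D')) {l : List (ℕ × ℕ)} (h : Matching N l)
    (hl : ∀ p ∈ l, p.2 ∈ D') (hlen : l.length < N) {x : ℕ} (hx : x ∈ D) :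
    ∃ y ∈ D', Matching N ((x, y) :: l) := by
  by_cases hs : Small N (cls x)
  · refine ⟨x, (hagree x hs).1 hx, matching_cons h (fun p hp => ?_) (fun p hp => ?_)
      fun _ => rfl⟩
    · constructor
      · rintro rfl
        exact h.small p hp (.inl hs)
      · rintro rfl
        exact (h.small p hp (.inr hs)).symm
    · constructor
      · intro e
        rw [← h.small p hp (.inl (e ▸ hs)), e]
      · intro e
        rw [h.small p hp (.inr (e ▸ hs)), e]
  · by_cases hx' : ∃ p ∈ l, p.1 = x
    · obtain ⟨p, hp, rfl⟩ := hx'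
      exact ⟨p.2, hl p hp, matching_cons h (h.eq_iff p hp) (h.cls_iff p hp) (h.small p hp)⟩
    · push Not at hx'
      by_cases hc : ∃ p ∈ l, cls p.1 = cls x
      · obtain ⟨p, hp, hpx⟩ := hc
        have hs' : ¬ Small N (cls p.2) := fun hs' => hs (by
          rwa [← hpx, h.small p hp (.inr hs')])
        obtain ⟨j, hj, hjl⟩ := exists_notMem_of_length_lt (f := fun j => Nat.pair (cls p.2) j)
          (fun a b hab => (Nat.pair_eq_pair.1 hab).2) (l := l.map Prod.snd) (N := N)
          (by simpa using hlen)
        refine ⟨Nat.pair (cls p.2) j, (hD'.large _ (hl p hp)).resolve_left hs' j hj,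
          matching_cons h (fun q hq => ?_) (fun q hq => ?_) ?_⟩
        · exact iff_of_false (fun e => hx' q hq e.symm)
            fun e => hjl (e ▸ List.mem_map_of_mem hq)
        · rw [cls_pair, ← hpx]
          exact h.cls_iff p hp q hq
        · rw [cls_pair]
          rintro (h | h)
          exacts [absurd h hs, absurd h hs']
      · push Not at hc
        obtain ⟨i, hi, hil⟩ := exists_notMem_of_length_lt (f := fun i => 2 * i + 1)
          (fun a b hab => by simpa using hab) (l := l.map fun p => cls p.2) (N := N)
          (by simpa using hlen)
        have hcl : ∀ q ∈ l, ¬ 2 * i + 1 = cls q.2 := fun q hq e =>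
          hil (e ▸ List.mem_map_of_mem (f := fun p : ℕ × ℕ => cls p.2) hq)
        refine ⟨Nat.pair (2 * i + 1) 0, hD'.odd i hi 0 (by omega),
          matching_cons h (fun q hq => ?_) (fun q hq => ?_) ?_⟩
        · exact iff_of_false (fun e => hx' q hq e.symm)
            fun e => hcl q hq (by rw [← e, cls_pair])
        · rw [cls_pair]
          exact iff_of_false (fun e => hc q hq e.symm) (hcl q hq)
        · rw [cls_pair]
          rintro (h | h)
          · exact absurd h hs
          · unfold Small at h
            omega

/-- The back-and-forth system between structures of equivalence classes. -/
def classSystem (S : Signature) (N : ℕ) (D D' : Set ℕ) (r : ℕ)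
    (l : List (Carrier S D × Carrier S D')) : Prop :=
  ∃ l₀ : List (Carrier S D × Carrier S D'), (∀ p ∈ l, p ∈ l₀) ∧ l₀.length + r ≤ N ∧
    (∃ p ∈ l₀, p.1.1 = basePoint ∧ p.2.1 = basePoint) ∧
    Matching N (l₀.map fun p => (p.1.1, p.2.1))

/-- The grade is the room left below `N`. The equivalence relation is the only relation that can
hold, and all functions take the default value, so it suffices that this element is matched with
itself. -/
theorem backAndForth_classSystem {N : ℕ} {D D' : Set ℕ} (hD : Rich N D) (hD' : Rich N D')
    (hagree : ∀ x, Small N (cls x) → (x ∈ D ↔ x ∈ D')) :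
    BackAndForth (L := S.extend.lang) (Carrier S D) (Carrier S D') (classSystem S N D D') := by
  have hmem : ∀ {D : Set ℕ}, Rich N D → 0 < N → ∀ x : Carrier S D, x.1 ∈ D := by
    rintro D hD hN ⟨x, rfl | hx⟩
    exacts [hD.odd 0 hN 0 hN, hx]
  refine ⟨?_, ?_, ?_, ?_, ?_, ?_⟩
  · rintro r r' l l' ⟨l₀, h1, h2, h3⟩ hr hl
    exact ⟨l₀, fun p hp => h1 p (hl p hp), by omega, h3⟩
  · rintro r l ⟨l₀, h1, h2, ⟨p, hp, hpb⟩, h4⟩ x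
    obtain ⟨y, hy, hm⟩ := h4.exists_extension hD' hagree (by
      simp only [List.forall_mem_map]
      exact fun p _ => hmem hD' (by omega) p.2) (by simp; omega) (hmem hD (by omega) x)
    refine ⟨⟨y, .inr hy⟩, (x, ⟨y, .inr hy⟩) :: l₀, ?_, by simp; omega,
      ⟨p, List.mem_cons_of_mem _ hp, hpb⟩, hm⟩
    intro q hq
    rcases List.mem_cons.1 hq with rfl | hq
    exacts [List.mem_cons_self, List.mem_cons_of_mem _ (h1 q hq)]
  · rintro r l ⟨l₀, h1, h2, ⟨p, hp, hpb⟩, h4⟩ y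
    obtain ⟨x, hx, hm⟩ := h4.swap.exists_extension hD (fun x hx => (hagree x hx).symm) (by
      simp only [List.forall_mem_map]
      exact fun p _ => hmem hD (by omega) p.1) (by simp; omega) (hmem hD' (by omega) y)
    refine ⟨⟨x, .inr hx⟩, (⟨x, .inr hx⟩, y) :: l₀, ?_, by simp; omega,
      ⟨p, List.mem_cons_of_mem _ hp, hpb⟩, ?_⟩
    · intro q hq
      rcases List.mem_cons.1 hq with rfl | hq
      exacts [List.mem_cons_self, List.mem_cons_of_mem _ (h1 q hq)]
    · have := hm.swap
      simpa [Function.comp_def] using this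
  · rintro r l ⟨l₀, h1, -, -, h4⟩ p hp q hq
    rw [Carrier.ext_iff, Carrier.ext_iff]
    exact h4.eq_iff _ (List.mem_map_of_mem (h1 p hp)) _ (List.mem_map_of_mem (h1 q hq))
  · rintro r l ⟨l₀, h1, -, -, h4⟩ n R a ha
    refine and_congr_right fun hR => ?_
    have hn : n = 2 := by
      rw [← getD_rels R, hR]
      simp [Signature.extend]
    subst hn
    simpa using h4.cls_iff _ (List.mem_map_of_mem (h1 _ (ha 0))) _
      (List.mem_map_of_mem (h1 _ (ha 1)))
  · rintro r l ⟨l₀, h1, -, ⟨b, hb, hb1, hb2⟩, h4⟩ n f a - p hp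
    have := h4.eq_iff _ (List.mem_map_of_mem hb) _ (List.mem_map_of_mem (h1 p hp))
    simp only [hb1, hb2] at this
    rw [Carrier.ext_iff, Carrier.ext_iff]
    exact this

/-! ### The infinite structures and their finite approximations -/

/-- For each `k` there is a class with `k + 1` elements if `k` is in the set `X`; moreover there
are infinitely many infinite classes. -/
def infDom (X : ℕ → Bool) : Set ℕ :=
  {x | cls x % 2 = 1 ∨ (cls x % 2 = 0 ∧ X (cls x / 2) = true ∧ x.unpair.2 ≤ cls x / 2)}

/-- The elements of the finite approximation given by the first `N` values of the set of binary
digits of `s`. -/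
def finDom (N s : ℕ) : List ℕ :=
  (List.range ((2 * N + 1) * (2 * N + 1))).filter fun x => decide
    ((cls x % 2 = 1 ∧ cls x < 2 * N ∧ x.unpair.2 ≤ N) ∨
      (cls x % 2 = 0 ∧ cls x < 2 * N ∧ s / 2 ^ (cls x / 2) % 2 = 1 ∧ x.unpair.2 ≤ cls x / 2))

theorem mem_finDom {N s x : ℕ} : x ∈ finDom N s ↔
    (cls x % 2 = 1 ∧ cls x < 2 * N ∧ x.unpair.2 ≤ N) ∨
      (cls x % 2 = 0 ∧ cls x < 2 * N ∧ s.testBit (cls x / 2) = true ∧ x.unpair.2 ≤ cls x / 2) := by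
  simp only [finDom, List.mem_filter, List.mem_range, decide_eq_true_eq,
    Nat.testBit_eq_decide_div_mod_eq]
  refine and_iff_right_of_imp fun h => ?_
  have h1 : cls x < 2 * N ∧ x.unpair.2 ≤ 2 * N := by omega
  have h2 := Nat.pair_lt_max_add_one_sq x.unpair.1 x.unpair.2
  rw [Nat.pair_unpair] at h2
  have h3 : max x.unpair.1 x.unpair.2 + 1 ≤ 2 * N + 1 :=
    Nat.succ_le_succ (max_le h1.1.le h1.2)
  rw [pow_two] at h2
  exact h2.trans_le (Nat.mul_le_mul h3 h3)

theorem primrec_finDom : Primrec₂ finDom := by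
  have hx : Primrec fun a : (ℕ × ℕ) × ℕ => a.2 := Primrec.snd
  have hN : Primrec fun a : (ℕ × ℕ) × ℕ => 2 * a.1.1 :=
    Primrec.nat_double.comp (Primrec.fst.comp Primrec.fst)
  have hc : Primrec fun a : (ℕ × ℕ) × ℕ => cls a.2 := Primrec.fst.comp (Primrec.unpair.comp hx)
  have hi : Primrec fun a : (ℕ × ℕ) × ℕ => a.2.unpair.2 := Primrec.snd.comp (Primrec.unpair.comp hx)
  have hm := Primrec.nat_mod.comp hc (Primrec.const 2)
  have hd := Primrec.nat_div.comp hc (Primrec.const 2)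
  have hlt := Primrec.nat_lt.comp hc hN
  have hb := Primrec.nat_mod.comp (Primrec.nat_div.comp (Primrec.snd.comp Primrec.fst)
    ((Primrec₂.unpaired'.1 Nat.Primrec.pow).comp (Primrec.const 2) hd)) (Primrec.const 2)
  have h1 : Primrec fun a : ℕ × ℕ => 2 * a.1 + 1 := Primrec.nat_double_succ.comp Primrec.fst
  exact primrec_filter (Primrec.list_range.comp (Primrec.nat_mul.comp h1 h1))
    (p := fun (a : ℕ × ℕ) x => (cls x % 2 = 1 ∧ cls x < 2 * a.1 ∧ x.unpair.2 ≤ a.1) ∨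
      (cls x % 2 = 0 ∧ cls x < 2 * a.1 ∧ a.2 / 2 ^ (cls x / 2) % 2 = 1 ∧ x.unpair.2 ≤ cls x / 2))
    (((Primrec.eq.comp hm (Primrec.const 1)).and (hlt.and (Primrec.nat_le.comp hi
      (Primrec.fst.comp Primrec.fst)))).or ((Primrec.eq.comp hm (Primrec.const 0)).and (hlt.and
      ((Primrec.eq.comp hb (Primrec.const 1)).and (Primrec.nat_le.comp hi hd)))))

/-- The finite classes not determined by the first `N` bits have more than `N` elements, so within
`N` moves they are as good as infinite. -/
theorem rich_infDom (X : ℕ → Bool) (N : ℕ) : Rich N (infDom X) where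
  odd i _ j _ := .inl (by rw [cls_pair]; omega)
  large x hx := by
    rcases hx with hx | ⟨h1, h2, h3⟩
    · exact .inr fun j _ => .inl (by rwa [cls_pair])
    · by_cases hN : cls x < 2 * N
      · exact .inl ⟨h1, hN⟩
      · refine .inr fun j hj => .inr ?_
        rw [cls_pair, Nat.unpair_pair]
        exact ⟨h1, h2, by dsimp only; omega⟩

theorem rich_finDom (N s : ℕ) : Rich N {x | x ∈ finDom N s} where
  odd i hi j hj := mem_finDom.2 (.inl (by rw [cls_pair, Nat.unpair_pair]; dsimp only; omega))
  large x hx := by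
    rcases mem_finDom.1 hx with ⟨h1, h2, -⟩ | ⟨h1, h2, -⟩
    · refine .inr fun j hj => mem_finDom.2 (.inl ?_)
      rw [cls_pair, Nat.unpair_pair]
      exact ⟨h1, h2, hj.le⟩
    · exact .inl ⟨h1, h2⟩

theorem infDom_agree_finDom {X : ℕ → Bool} {N s : ℕ} (h : ∀ i < N, s.testBit i = X i) (x : ℕ)
    (hx : Small N (cls x)) : x ∈ infDom X ↔ x ∈ {x | x ∈ finDom N s} := by
  obtain ⟨h1, h2⟩ := hx
  change _ ↔ x ∈ finDom N s
  rw [mem_finDom, h _ (by omega)]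
  simp [infDom, h1, h2]

end Interp

/-! ### Transfer of a translation along a back-and-forth system -/

namespace Interp

open FirstOrder FirstOrder.Language

namespace Translation

variable {L L' : FirstOrder.Language.{0, 0}} (τ : Translation L L')

/-- Tuples in a specified piece. -/
abbrev Pre (M : Type) : Type := Σ i : Fin τ.pieces, Fin (τ.dim i) → M

variable {τ} {M : Type} [L.Structure M] (p : Fin τ.params → M)

/-- The tuple satisfies the domain formula. -/
def DomHolds (e : τ.Pre M) : Prop := (τ.dom e.1).Realize (Sum.elim p e.2)

/-- The tuples are identified by the translation. -/
def EqvHolds (e e' : τ.Pre M) : Prop :=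
  (τ.eqv e.1 e'.1).Realize (Sum.elim p (Sum.elim e.2 e'.2))

/-- The translation of the relation symbol holds. -/
def RelHolds {n : ℕ} (R : L'.Relations n) (a : Fin n → τ.Pre M) : Prop :=
  (τ.rel R fun k => (a k).1).Realize (Sum.elim p fun q => (a q.1).2 q.2)

/-- The translation of the graph of the function symbol holds. -/
def FunHolds {n : ℕ} (f : L'.Functions n) (a : Fin n → τ.Pre M) (b : τ.Pre M) : Prop :=
  (τ.func f (fun k => (a k).1) b.1).Realize
    (Sum.elim p (Sum.elim (fun q => (a q.1).2 q.2) b.2))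

/-- The translation of identity is an equivalence relation on the domain. -/
structure IsEquivalence : Prop where
  refl : ∀ e : τ.Pre M, DomHolds p e → EqvHolds p e e
  symm : ∀ e e' : τ.Pre M, DomHolds p e → DomHolds p e' → EqvHolds p e e' → EqvHolds p e' e
  trans : ∀ e e' e'' : τ.Pre M, DomHolds p e → DomHolds p e' → DomHolds p e'' →
    EqvHolds p e e' → EqvHolds p e' e'' → EqvHolds p e e''

/-- The element given by a tuple. -/
def Pre.toElem {p : Fin τ.params → M} (e : τ.Pre M) (h : DomHolds p e) : τ.Elem M p :=
  ⟨e.1, e.2, h⟩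

/-- The image of a tuple. -/
def Pre.map {M N : Type} (g : M → N) (e : τ.Pre M) : τ.Pre N := ⟨e.1, fun k => g (e.2 k)⟩

/-- All entries of the tuple are in the list. -/
def Pre.In {M : Type} (e : τ.Pre M) (l : List M) : Prop := ∀ k, e.2 k ∈ l

theorem Pre.In.mono {M : Type} {e : τ.Pre M} {l l' : List M} (h : e.In l)
    (hl : ∀ x ∈ l, x ∈ l') : e.In l' := fun k => hl _ (h k)

/-- A bound for the dimensions of the pieces. -/
def dimBound (τ : Translation L L') : ℕ := ∑ i, τ.dim i

theorem dim_le_dimBound (i : Fin τ.pieces) : τ.dim i ≤ τ.dimBound :=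
  Finset.single_le_sum (f := τ.dim) (fun _ _ => Nat.zero_le _) (Finset.mem_univ i)

/-- The number `R` bounds the sizes of all formulas of the translation. -/
structure SizeBound (τ : Translation L L') (R : ℕ) : Prop where
  dom : ∀ i, formulaSize (τ.dom i) ≤ R
  eqv : ∀ i j, formulaSize (τ.eqv i j) ≤ R
  rel : ∀ {n} (P : L'.Relations n) s, formulaSize (τ.rel P s) ≤ R
  func : ∀ {n} (f : L'.Functions n) s j, formulaSize (τ.func f s j) ≤ R

section Transfer

variable {B : Type} [L.Structure B] {p} {p' : Fin τ.params → B} {Z : ℕ → List (M × B) → Prop}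
  (hZ : BackAndForth (L := L) M B Z) {R r : ℕ} (hR : τ.SizeBound R) {l : List (M × B)}
  (hr : R ≤ r) (h : Z r l) (hp : ∀ i, (p i, p' i) ∈ l)

include hZ hr h hp

theorem realize_transfer {α : Type} (φ : L.Formula (Fin τ.params ⊕ α)) (hφ : formulaSize φ ≤ R)
    (v : α → M × B) (hv : ∀ a, v a ∈ l) :
    φ.Realize (Sum.elim p fun a => (v a).1) ↔ φ.Realize (Sum.elim p' fun a => (v a).2) := by
  have := hZ.realize_formula_iff φ (hZ.mono h (hφ.trans hr) fun _ => id)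
    (Sum.elim (fun i => (p i, p' i)) v) (by rintro (i | a); exacts [hp i, hv a])
  have h1 : (fun i => (Sum.elim (fun i => (p i, p' i)) v i).1) = Sum.elim p fun a => (v a).1 := by
    funext i; cases i <;> rfl
  have h2 : (fun i => (Sum.elim (fun i => (p i, p' i)) v i).2) = Sum.elim p' fun a => (v a).2 := by
    funext i; cases i <;> rfl
  rwa [h1, h2] at this

include hR

theorem domHolds_iff {e : τ.Pre (M × B)} (he : e.In l) :
    DomHolds p (e.map Prod.fst) ↔ DomHolds p' (e.map Prod.snd) :=
  realize_transfer hZ hr h hp (τ.dom e.1) (hR.dom _) e.2 he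

theorem eqvHolds_iff {e e' : τ.Pre (M × B)} (he : e.In l) (he' : e'.In l) :
    EqvHolds p (e.map Prod.fst) (e'.map Prod.fst) ↔
      EqvHolds p' (e.map Prod.snd) (e'.map Prod.snd) := by
  have := realize_transfer hZ hr h hp (τ.eqv e.1 e'.1) (hR.eqv _ _) (Sum.elim e.2 e'.2)
    (by rintro (k | k); exacts [he k, he' k])
  have h1 : (fun a => (Sum.elim e.2 e'.2 a).1) =
      Sum.elim (fun k => (e.2 k).1) fun k => (e'.2 k).1 := by
    funext i; cases i <;> rfl
  have h2 : (fun a => (Sum.elim e.2 e'.2 a).2) =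
      Sum.elim (fun k => (e.2 k).2) fun k => (e'.2 k).2 := by
    funext i; cases i <;> rfl
  rwa [h1, h2] at this

theorem relHolds_iff {n : ℕ} (P : L'.Relations n) {a : Fin n → τ.Pre (M × B)}
    (ha : ∀ k, (a k).In l) :
    RelHolds p P (fun k => (a k).map Prod.fst) ↔ RelHolds p' P fun k => (a k).map Prod.snd :=
  realize_transfer hZ hr h hp (τ.rel P fun k => (a k).1) (hR.rel _ _)
    (fun q => (a q.1).2 q.2) fun q => ha q.1 q.2

theorem funHolds_iff {n : ℕ} (f : L'.Functions n) {a : Fin n → τ.Pre (M × B)}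
    {b : τ.Pre (M × B)} (ha : ∀ k, (a k).In l) (hb : b.In l) :
    FunHolds p f (fun k => (a k).map Prod.fst) (b.map Prod.fst) ↔
      FunHolds p' f (fun k => (a k).map Prod.snd) (b.map Prod.snd) := by
  have := realize_transfer hZ hr h hp (τ.func f (fun k => (a k).1) b.1) (hR.func _ _ _)
    (Sum.elim (fun q : Σ k, Fin (τ.dim (a k).1) => (a q.1).2 q.2) b.2)
    (by rintro (q | k); exacts [ha q.1 q.2, hb k])
  have h1 : (fun i => (Sum.elim (fun q : Σ k, Fin (τ.dim (a k).1) => (a q.1).2 q.2) b.2 i).1) =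
      Sum.elim (fun q => ((a q.1).2 q.2).1) fun k => (b.2 k).1 := by
    funext i; cases i <;> rfl
  have h2 : (fun i => (Sum.elim (fun q : Σ k, Fin (τ.dim (a k).1) => (a q.1).2 q.2) b.2 i).2) =
      Sum.elim (fun q => ((a q.1).2 q.2).2) fun k => (b.2 k).2 := by
    funext i; cases i <;> rfl
  rwa [h1, h2] at this

end Transfer

section Extend

variable {B : Type} [L.Structure B] {Z : ℕ → List (M × B) → Prop}
  (hZ : BackAndForth (L := L) M B Z) {r : ℕ} {l : List (M × B)}

include hZ

/-- A tuple is matched entry by entry, at the cost of at most `τ.dimBound` moves in any piece. -/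
theorem exists_forth (h : Z (r + τ.dimBound) l) (e : τ.Pre M) :
    ∃ (e' : τ.Pre (M × B)) (l' : List (M × B)), e'.map Prod.fst = e ∧ (∀ x ∈ l, x ∈ l') ∧
      e'.In l' ∧ Z r l' := by
  obtain ⟨a, l', h1, h2, h3, h4⟩ := BackAndForth.exists_family (Z := Z) (r := r) (fun _ => 1)
    (fun k x => x.1 = e.2 k) (fun k r l' hl' _ => by
      obtain ⟨y, hy⟩ := hZ.forth hl' (e.2 k)
      exact ⟨_, rfl, hy⟩)
    (hZ.mono h (by simpa using dim_le_dimBound e.1) fun _ => id)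
  exact ⟨⟨e.1, a⟩, l', by obtain ⟨i, t⟩ := e; simp [Pre.map, h4], h2, h3, h1⟩

theorem exists_back (h : Z (r + τ.dimBound) l) (e : τ.Pre B) :
    ∃ (e' : τ.Pre (M × B)) (l' : List (M × B)), e'.map Prod.snd = e ∧ (∀ x ∈ l, x ∈ l') ∧
      e'.In l' ∧ Z r l' := by
  obtain ⟨a, l', h1, h2, h3, h4⟩ := BackAndForth.exists_family (Z := Z) (r := r) (fun _ => 1)
    (fun k x => x.2 = e.2 k) (fun k r l' hl' _ => by
      obtain ⟨y, hy⟩ := hZ.back hl' (e.2 k)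
      exact ⟨_, rfl, hy⟩)
    (hZ.mono h (by simpa using dim_le_dimBound e.1) fun _ => id)
  exact ⟨⟨e.1, a⟩, l', by obtain ⟨i, t⟩ := e; simp [Pre.map, h4], h2, h3, h1⟩

end Extend

end Translation

/-! ### Back-and-forth between an interpreted structure and its finite approximation -/

open Translation

variable {L : FirstOrder.Language.{0, 0}} {S : Signature}

/-- The data `D` present the finite structure that the translation defines, by representatives of
the classes of tuples. -/
structure Presents (τ : Translation L S.lang) {B : Type} [L.Structure B] (p : Fin τ.params → B)
    (D : FinData) (enc : τ.Pre B → ℕ) (reps : Set (τ.Pre B)) : Prop where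
  enc_injective : Function.Injective enc
  mem_iff : ∀ v, v ∈ D.1 ↔ ∃ e ∈ reps, enc e = v
  domHolds : ∀ e ∈ reps, DomHolds p e
  exists_rep : IsEquivalence p → ∀ e, DomHolds p e → ∃ e' ∈ reps, EqvHolds p e' e
  unique : IsEquivalence p → ∀ e ∈ reps, ∀ e' ∈ reps, EqvHolds p e e' → e = e'
  rel_iff : ∀ {n : ℕ} (R : S.lang.Relations n) (a : Fin n → τ.Pre B), (∀ k, a k ∈ reps) →
    (((R.1 : Fin S.rels.length).1, List.ofFn fun k => enc (a k)) ∈ D.2.1 ↔ RelHolds p R a)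
  func_iff : ∀ {n : ℕ} (f : S.lang.Functions n) (a : Fin n → τ.Pre B) (b : τ.Pre B),
    (∀ k, a k ∈ reps) → b ∈ reps →
    (((f.1 : Fin S.funcs.length).1, enc b :: List.ofFn fun k => enc (a k)) ∈ D.2.2 ↔
      FunHolds p f a b)

section

variable {τ : Translation L S.lang} {M B : Type} [L.Structure M] [L.Structure B]
  {p : Fin τ.params → M} {p' : Fin τ.params → B} {Z : ℕ → List (M × B) → Prop} {R : ℕ}
  {D : FinData} {enc : τ.Pre B → ℕ} {reps : Set (τ.Pre B)} {Q : Type} [S.lang.Structure Q]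
  {π : τ.Elem M p → Q}

/-- The element of the interpreted structure and the element of the finite structure are given by
corresponding tuples. -/
def Linked (π : τ.Elem M p → Q) (enc : τ.Pre B → ℕ) (l : List (M × B)) (x : Q) (y : ℕ) : Prop :=
  ∃ (e : τ.Pre (M × B)) (h : DomHolds p (e.map Prod.fst)), e.In l ∧
    π ((e.map Prod.fst).toElem h) = x ∧ enc (e.map Prod.snd) = y

omit [L.Structure B] [S.lang.Structure Q] in
theorem Linked.mono {l l' : List (M × B)} {x : Q} {y : ℕ} (h : Linked π enc l x y)
    (hl : ∀ x ∈ l, x ∈ l') : Linked π enc l' x y := by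
  obtain ⟨e, h1, h2, h3⟩ := h
  exact ⟨e, h1, h2.mono hl, h3⟩

/-- The back-and-forth system between an interpreted structure and a finite structure. -/
def linkSystem (p' : Fin τ.params → B) (Z : ℕ → List (M × B) → Prop) (R : ℕ)
    (π : τ.Elem M p → Q) (enc : τ.Pre B → ℕ) (D : FinData) (r : ℕ) (l : List (Q × D.Model S)) :
    Prop :=
  ∃ l₀ : List (M × B), (∀ i, (p i, p' i) ∈ l₀) ∧
    Z (2 * τ.dimBound * r + (R + 3 * τ.dimBound)) l₀ ∧ ∀ x ∈ l, Linked π enc l₀ x.1 x.2.1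

/-- In `M` the translated identity is equality of images under `π`. Any three tuples of `B` can be
pulled back to `M` with `3 * τ.dimBound` moves, and the remaining `R` moves transfer the formulas,
so the laws of equivalence hold in `B`. -/
theorem isEquivalence_of_isQuotientMap (hπ : τ.IsQuotientMap π) (hZ : BackAndForth (L := L) M B Z)
    (hR : τ.SizeBound R) {l : List (M × B)} (hp : ∀ i, (p i, p' i) ∈ l)
    (h : Z (R + 3 * τ.dimBound) l) : IsEquivalence p' := by
  have key : ∀ {r : ℕ} {l : List (M × B)}, R ≤ r → Z (r + τ.dimBound) l →
      (∀ i, (p i, p' i) ∈ l) → ∀ e : τ.Pre B, DomHolds p' e →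
      ∃ (e' : τ.Pre (M × B)) (l' : List (M × B)) (_ : DomHolds p (e'.map Prod.fst)),
        e'.map Prod.snd = e ∧ (∀ x ∈ l, x ∈ l') ∧ e'.In l' ∧ Z r l' := by
    intro r l hr hl hp e he
    obtain ⟨e', l', rfl, h2, h3, h4⟩ := exists_back hZ hl e
    exact ⟨e', l', (domHolds_iff hZ hR hr h4 (fun i => h2 _ (hp i)) h3).2 he, rfl, h2, h3, h4⟩
  have heqv : ∀ {l : List (M × B)} {e e' : τ.Pre (M × B)} (h1 : DomHolds p (e.map Prod.fst))
      (h2 : DomHolds p (e'.map Prod.fst)), Z R l → (∀ i, (p i, p' i) ∈ l) → e.In l → e'.In l →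
      (EqvHolds p' (e.map Prod.snd) (e'.map Prod.snd) ↔
        π ((e.map Prod.fst).toElem h1) = π ((e'.map Prod.fst).toElem h2)) := by
    intro l e e' h1 h2 hl hp he he'
    rw [← eqvHolds_iff hZ hR le_rfl hl hp he he']
    exact (hπ.map_eq ((e.map Prod.fst).toElem h1) ((e'.map Prod.fst).toElem h2)).symm
  have h3 : Z (R + τ.dimBound + τ.dimBound + τ.dimBound) l :=
    hZ.mono h (by omega) fun _ => id
  have triple : ∀ e e' e'' : τ.Pre B, DomHolds p' e → DomHolds p' e' → DomHolds p' e'' →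
      ∃ x y z : Q, (EqvHolds p' e e ↔ x = x) ∧ (EqvHolds p' e e' ↔ x = y) ∧
        (EqvHolds p' e' e ↔ y = x) ∧ (EqvHolds p' e' e'' ↔ y = z) ∧
        (EqvHolds p' e e'' ↔ x = z) := by
    intro e e' e'' he he' he''
    obtain ⟨a, l₁, ha, rfl, a1, a2, a3⟩ := key (by omega) h3 hp e he
    have hp1 := fun i => a1 _ (hp i)
    obtain ⟨b, l₂, hb, rfl, b1, b2, b3⟩ := key (by omega) a3 hp1 e' he'
    have hp2 := fun i => b1 _ (hp1 i)
    obtain ⟨c, l₃, hc, rfl, c1, c2, c3⟩ := key le_rfl b3 hp2 e'' he''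
    have hp3 := fun i => c1 _ (hp2 i)
    have a4 := (a2.mono b1).mono c1
    have b4 := b2.mono c1
    exact ⟨_, _, _, heqv ha ha c3 hp3 a4 a4, heqv ha hb c3 hp3 a4 b4, heqv hb ha c3 hp3 b4 a4,
      heqv hb hc c3 hp3 b4 c2, heqv ha hc c3 hp3 a4 c2⟩
  refine ⟨fun e he => ?_, fun e e' he he' h => ?_, fun e e' e'' he he' he'' h h' => ?_⟩
  · obtain ⟨x, y, z, h1, -⟩ := triple e e e he he he
    exact h1.2 rfl
  · obtain ⟨x, y, z, -, h1, h2, -⟩ := triple e e' e' he he' he'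
    exact h2.2 (h1.1 h).symm
  · obtain ⟨x, y, z, -, h1, -, h2, h3⟩ := triple e e' e'' he he' he''
    exact h3.2 ((h1.1 h).trans (h2.1 h'))

/-- One move between the interpreted structures costs `2 * τ.dimBound` moves below: an element of
`Q` is given by a tuple of `M`, which is matched with a tuple of `B`; that tuple is replaced by the
representative of its class, which must in turn be matched in `M`. In the other direction the
element is a representative already. The margin `R + 3 * τ.dimBound` pays for comparing formulas and
values. -/
theorem backAndForth_linkSystem [Nonempty Q] (hπ : τ.IsQuotientMap π)
    (hZ : BackAndForth (L := L) M B Z) (hR : τ.SizeBound R) (hD : Presents τ p' D enc reps)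
    (hE : IsEquivalence p') {l₀ : List (M × B)} (hp₀ : ∀ i, (p i, p' i) ∈ l₀)
    (h₀ : Z (R + 2 * τ.dimBound) l₀) :
    BackAndForth (L := S.lang) Q (D.Model S) (linkSystem p' Z R π enc D) := by
  have forth : ∀ {r : ℕ} {l : List (M × B)}, R ≤ r → Z (r + 2 * τ.dimBound) l →
      (∀ i, (p i, p' i) ∈ l) → ∀ x : Q, ∃ y ∈ D.1, ∃ l', (∀ x ∈ l, x ∈ l') ∧ Z r l' ∧
        Linked π enc l' x y := by
    intro r l hr hl hp x
    obtain ⟨⟨i, u, hu⟩, rfl⟩ := hπ.surjective x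
    obtain ⟨e, l₁, h1, h2, h3, h4⟩ := exists_forth (r := r + τ.dimBound) hZ
      (by rwa [add_assoc, ← two_mul]) (⟨i, u⟩ : τ.Pre M)
    have hp1 := fun i => h2 _ (hp i)
    have hdom : DomHolds p (e.map Prod.fst) := by rw [h1]; exact hu
    obtain ⟨e', he', hee'⟩ := hD.exists_rep hE _
      ((domHolds_iff hZ hR (by omega) h4 hp1 h3).1 hdom)
    obtain ⟨b, l₂, rfl, b1, b2, b3⟩ := exists_back hZ h4 e'
    have hp2 := fun i => b1 _ (hp1 i)
    have hb := (domHolds_iff hZ hR hr b3 hp2 b2).2 (hD.domHolds _ he')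
    refine ⟨_, (hD.mem_iff _).2 ⟨_, he', rfl⟩, l₂, fun x hx => b1 _ (h2 _ hx), b3, b, hb, b2,
      ?_, rfl⟩
    rw [← eqvHolds_iff hZ hR hr b3 hp2 b2 (h3.mono b1), h1] at hee'
    exact (hπ.map_eq ((b.map Prod.fst).toElem hb) ⟨i, u, hu⟩).2 hee'
  -- `D.elems` always contains the default element; since `Q` is nonempty, the list `D.1` is too, so
  -- the default element is no junk and codes a representative.
  have hne : D.base ∈ D.1 := by
    obtain ⟨x⟩ := ‹Nonempty Q›
    obtain ⟨y, hy, -⟩ := forth le_rfl h₀ hp₀ x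
    rw [FinData.base]
    cases hd : D.1 with
    | nil => rw [hd] at hy; simp at hy
    | cons a t => simp
  have helems : ∀ {v}, v ∈ D.elems → ∃ e ∈ reps, enc e = v := by
    intro v hv
    rcases List.mem_cons.1 hv with rfl | hv
    exacts [(hD.mem_iff _).1 hne, (hD.mem_iff _).1 hv]
  have back : ∀ {r : ℕ} {l : List (M × B)}, R ≤ r → Z (r + τ.dimBound) l →
      (∀ i, (p i, p' i) ∈ l) → ∀ y ∈ D.elems, ∃ x : Q, ∃ l', (∀ x ∈ l, x ∈ l') ∧ Z r l' ∧
        Linked π enc l' x y := by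
    intro r l hr hl hp y hy
    obtain ⟨e, he, rfl⟩ := helems hy
    obtain ⟨b, l₂, rfl, b1, b2, b3⟩ := exists_back hZ hl e
    have hb := (domHolds_iff hZ hR hr b3 (fun i => b1 _ (hp i)) b2).2 (hD.domHolds _ he)
    exact ⟨_, l₂, b1, b3, b, hb, b2, rfl, rfl⟩
  have hrep : ∀ {e : τ.Pre B}, enc e ∈ D.elems → e ∈ reps := by
    intro e he
    obtain ⟨e', he', h⟩ := helems he
    rwa [← hD.enc_injective h]
  have eq_iff : ∀ {l : List (M × B)}, Z R l → (∀ i, (p i, p' i) ∈ l) → ∀ {x x' : Q} {y y' : ℕ},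
      y ∈ D.elems → y' ∈ D.elems → Linked π enc l x y → Linked π enc l x' y' →
        (x = x' ↔ y = y') := by
    rintro l hl hp x x' y y' hy hy' ⟨e, h1, h2, rfl, rfl⟩ ⟨e', h1', h2', rfl, rfl⟩
    refine (hπ.map_eq _ _).trans
      ((eqvHolds_iff hZ hR le_rfl hl hp h2 h2').trans ⟨fun h => ?_, fun h => ?_⟩)
    · rw [hD.unique hE _ (hrep hy) _ (hrep hy') h]
    · rw [← hD.enc_injective h]
      exact hE.refl _ (hD.domHolds _ (hrep hy))
  have fun_of : ∀ {l : List (M × B)}, Z (R + τ.dimBound) l → (∀ i, (p i, p' i) ∈ l) →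
      ∀ {n : ℕ} (f : S.lang.Functions n) (a : Fin n → Q × D.Model S) {x : Q} {y : ℕ},
      y ∈ D.elems → (∀ k, Linked π enc l (a k).1 (a k).2.1) → Linked π enc l x y →
      Structure.funMap f (fun k => (a k).1) = x →
      D.value (f.1 : Fin S.funcs.length) (List.ofFn fun k => (a k).2.1) = y := by
    intro l hl hp n f a x y hy ha hxy hfx
    -- The translated graph need not be known to be functional in `B`. Pulling a candidate value `v`
    -- back to `Q`, where the graph is that of a function, shows that `y` is the only value
    -- recorded, so the search in `FinData.value` returns it.
    have hfact : ∀ v ∈ D.elems, ((f.1 : Fin S.funcs.length).1,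
        v :: List.ofFn fun k => (a k).2.1) ∈ D.2.2 ↔ v = y := by
      intro v hv
      obtain ⟨x', l', hl1, hl2, hx'⟩ := back le_rfl hl hp v hv
      have hp' := fun i => hl1 _ (hp i)
      rw [eq_comm (a := v), ← eq_iff hl2 hp' hy hv (hxy.mono hl1) hx', ← hfx]
      obtain ⟨b, hb1, hb2, rfl, rfl⟩ := hx'
      choose e he1 he2 he3 he4 using fun k => (ha k).mono hl1
      have h1 : (fun k => (a k).2.1) = fun k => enc ((e k).map Prod.snd) :=
        funext fun k => (he4 k).symm
      have h2 : (fun k => (a k).1) = fun k => π (((e k).map Prod.fst).toElem (he1 k)) :=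
        funext fun k => (he3 k).symm
      rw [h1, h2, hD.func_iff f _ _ (fun k => hrep (by rw [he4]; exact (a k).2.2)) (hrep hv),
        ← funHolds_iff hZ hR le_rfl hl2 hp' f he2 hb2]
      exact (hπ.map_func f (fun k => ((e k).map Prod.fst).toElem (he1 k))
        ((b.map Prod.fst).toElem hb1)).symm
    rw [FinData.value, List.getD_eq_getElem?_getD]
    have hmem : y ∈ D.elems.filter fun v => decide
        (((f.1 : Fin S.funcs.length).1, v :: List.ofFn fun k => (a k).2.1) ∈ D.2.2) :=
      List.mem_filter.2 ⟨hy, by simpa using (hfact y hy).2 rfl⟩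
    have hpos := List.length_pos_of_mem hmem
    rw [List.getElem?_eq_getElem hpos, Option.getD_some]
    have h1 := List.mem_filter.1 (List.getElem_mem hpos)
    exact (hfact _ h1.1).1 (by simpa using h1.2)
  refine ⟨?_, ?_, ?_, ?_, ?_, ?_⟩
  · rintro r r' l l' ⟨l₀, h1, h2, h3⟩ hr hl
    refine ⟨l₀, h1, hZ.mono h2 ?_ fun _ => id, fun x hx => h3 x (hl x hx)⟩
    have := Nat.mul_le_mul_left (2 * τ.dimBound) hr
    omega
  · rintro r l ⟨l₀, h1, h2, h3⟩ x
    obtain ⟨y, hy, l', h4, h5, h6⟩ := forth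
      (r := 2 * τ.dimBound * r + (R + 3 * τ.dimBound)) (by omega)
      (by convert h2 using 1; ring) h1 x
    refine ⟨⟨y, List.mem_cons_of_mem _ hy⟩, l', fun i => h4 _ (h1 i), h5, ?_⟩
    simp only [List.forall_mem_cons]
    exact ⟨h6, fun z hz => (h3 z hz).mono h4⟩
  · rintro r l ⟨l₀, h1, h2, h3⟩ y
    obtain ⟨x, l', h4, h5, h6⟩ := back
      (r := 2 * τ.dimBound * r + (R + 3 * τ.dimBound)) (by omega)
      (hZ.mono h2 (by rw [mul_add]; omega) fun _ => id) h1 y.1 y.2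
    refine ⟨x, l', fun i => h4 _ (h1 i), h5, ?_⟩
    simp only [List.forall_mem_cons]
    exact ⟨h6, fun z hz => (h3 z hz).mono h4⟩
  · rintro r l ⟨l₀, h1, h2, h3⟩ x hx x' hx'
    exact (eq_iff (hZ.mono h2 (by omega) fun _ => id) h1 x.2.2 x'.2.2 (h3 x hx) (h3 x' hx')).trans
      Subtype.ext_iff.symm
  · rintro r l ⟨l₀, h1, h2, h3⟩ n P a ha
    choose e he1 he2 he3 he4 using fun k => h3 _ (ha k)
    have e1 : (fun k => (a k).2.1) = fun k => enc ((e k).map Prod.snd) :=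
      funext fun k => (he4 k).symm
    have e2 : (fun k => (a k).1) = fun k => π (((e k).map Prod.fst).toElem (he1 k)) :=
      funext fun k => (he3 k).symm
    show _ ↔ ((P.1 : Fin S.rels.length).1, List.ofFn fun k => (a k).2.1) ∈ D.2.1
    rw [e1, e2, hD.rel_iff P _ (fun k => hrep (by rw [he4]; exact (a k).2.2)),
      ← relHolds_iff hZ hR le_rfl (hZ.mono h2 (by omega) fun _ => id) h1 P he2]
    exact hπ.map_rel P _
  · rintro r l ⟨l₀, h1, h2, h3⟩ n f a ha x hx
    have hval : (Structure.funMap f (fun i => (a i).2) = x.2) ↔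
        D.value (f.1 : Fin S.funcs.length) (List.ofFn fun k => (a k).2.1) = x.2.1 :=
      Subtype.ext_iff
    rw [hval]
    have h2' : Z (R + τ.dimBound + 2 * τ.dimBound) l₀ := hZ.mono h2 (by omega) fun _ => id
    constructor
    · intro h
      exact fun_of (hZ.mono h2 (by omega) fun _ => id) h1 f a x.2.2 (fun k => h3 _ (ha k))
        (h3 x hx) h
    · intro h
      -- Conversely, the actual value in `Q` receives a partner `y`; by the first direction `y` is
      -- the value in the finite structure, and equality transfers back.
      obtain ⟨y, hy, l', h4, h5, h6⟩ := forth (by omega) h2' h1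
        (Structure.funMap f fun i => (a i).1)
      have hp' := fun i => h4 _ (h1 i)
      have hy' : y ∈ D.elems := List.mem_cons_of_mem _ hy
      have h7 := fun_of h5 hp' f a hy' (fun k => (h3 _ (ha k)).mono h4) h6 rfl
      exact (eq_iff (hZ.mono h5 (by omega) fun _ => id) hp' hy' x.2.2 h6
        ((h3 x hx).mono h4)).2 (h7.symm.trans h)

end

end Interp

theorem PrimrecPred.exists_finite {α ι : Type*} [Primcodable α] [Finite ι] {p : α → ι → Prop}
    (hp : ∀ i, PrimrecPred fun a => p a i) : PrimrecPred fun a => ∃ i, p a i := by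
  obtain ⟨n, ⟨e⟩⟩ := Finite.exists_equiv_fin ι
  exact (exists_fin fun i => hp (e.symm i)).of_eq fun a => e.symm.surjective.exists.symm

namespace Interp

open FirstOrder FirstOrder.Language

/-! ### Canonical representatives in lists -/

open Classical in
/-- The elements of the list that are the first ones of their classes. -/
noncomputable def firsts {α : Type*} (V : List α) (ρ : α → α → Prop) : List α :=
  V.filter fun x => decide ((V.filter fun y => decide (ρ y x)).head? = some x)

section Firsts

variable {α : Type*} {V : List α} {ρ : α → α → Prop}

theorem mem_of_mem_firsts {x : α} (h : x ∈ firsts V ρ) : x ∈ V := (List.mem_filter.1 h).1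

variable (hrefl : ∀ x ∈ V, ρ x x) (hsymm : ∀ x ∈ V, ∀ y ∈ V, ρ x y → ρ y x)
  (htrans : ∀ x ∈ V, ∀ y ∈ V, ∀ z ∈ V, ρ x y → ρ y z → ρ x z)

include hsymm htrans in
theorem filter_eq_of_rel [∀ x, DecidablePred (ρ · x)] {x y : α} (hx : x ∈ V) (hy : y ∈ V)
    (h : ρ x y) : V.filter (fun z => decide (ρ z x)) = V.filter fun z => decide (ρ z y) := by
  refine List.filter_congr fun z hz => ?_
  rw [decide_eq_decide]
  exact ⟨fun h' => htrans z hz x hx y hy h' h,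
    fun h' => htrans z hz y hy x hx h' (hsymm x hx y hy h)⟩

include hrefl hsymm htrans in
-- The first element related to `x` works, since it has the same class as `x`.
theorem exists_mem_firsts {x : α} (hx : x ∈ V) : ∃ y ∈ firsts V ρ, ρ y x := by
  classical
  have h1 : x ∈ V.filter fun z => decide (ρ z x) :=
    List.mem_filter.2 ⟨hx, by simpa using hrefl x hx⟩
  cases h : (V.filter fun z => decide (ρ z x)).head? with
  | none => simp [List.head?_eq_none_iff.1 h] at h1
  | some y =>
    have h2 := List.mem_filter.1 (List.mem_of_mem_head? h)
    have h3 : ρ y x := by simpa using h2.2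
    refine ⟨y, List.mem_filter.2 ⟨h2.1, ?_⟩, h3⟩
    rw [decide_eq_true_eq, ← h]
    congr 1
    convert filter_eq_of_rel hsymm htrans h2.1 hx h3

include hsymm htrans in
theorem eq_of_mem_firsts {x y : α} (hx : x ∈ firsts V ρ) (hy : y ∈ firsts V ρ) (h : ρ x y) :
    x = y := by
  classical
  have hx' := List.mem_filter.1 hx
  have hy' := List.mem_filter.1 hy
  have h1 := of_decide_eq_true hx'.2
  have h2 := of_decide_eq_true hy'.2
  have h3 := filter_eq_of_rel hsymm htrans hx'.1 hy'.1 h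
  refine Option.some_injective _ (h1.symm.trans (Eq.trans ?_ h2))
  congr 1

end Firsts

open Classical in
theorem primrec_firsts {α β : Type*} [Primcodable α] [Primcodable β] {f : α → List β}
    (hf : Primrec f) {ρ : α → β → β → Prop}
    (hρ : PrimrecPred fun x : α × β × β => ρ x.1 x.2.1 x.2.2) :
    Primrec fun a => firsts (f a) (ρ a) := by
  refine primrec_filter hf
    (p := fun a x => ((f a).filter fun y => decide (ρ a y x)).head? = some x) ?_
  refine Primrec.eq.comp (Primrec.list_head?.comp ?_) (Primrec.option_some.comp Primrec.snd)
  exact primrec_filter (hf.comp Primrec.fst) (p := fun (x : α × β) y => ρ x.1 y x.2)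
    (hρ.comp (Primrec.pair (Primrec.fst.comp Primrec.fst)
      (Primrec.pair Primrec.snd (Primrec.snd.comp Primrec.fst))))

/-! ### The finite structures defined by a translation -/

section

variable {S : Signature} (τ : Translation S.extend.lang S.lang) (q : Fin τ.params → ℕ)

/-- The formula holds in the structure of equivalence classes with domain `l`. -/
def ListSat {α : Type} (l : List ℕ) (v : α → ℕ) (φ : S.extend.lang.Formula (Fin τ.params ⊕ α)) :
    Prop :=
  classSat {x | x ∈ l} (Sum.elim q v) φ fun i : Fin 0 => i.elim0

theorem listSat_iff {α : Type} {l : List ℕ} (p : Fin τ.params → Carrier S {x | x ∈ l})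
    (hp : ∀ i, (p i).1 = q i) (v : α → Carrier S {x | x ∈ l}) {w : α → ℕ}
    (hw : ∀ a, w a = (v a).1) (φ : S.extend.lang.Formula (Fin τ.params ⊕ α)) :
    ListSat τ q l w φ ↔ φ.Realize (Sum.elim p v) := by
  have h := classSat_iff (Sum.elim p v) φ (default : Fin 0 → Carrier S {x | x ∈ l})
  have h1 : Sum.elim q w = fun i => (Sum.elim p v i).1 := by
    funext i
    rcases i with i | a
    exacts [(hp i).symm, hw a]
  unfold ListSat
  rw [h1, Subsingleton.elim (fun i : Fin 0 => (i.elim0 : ℕ))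
    fun i => ((default : Fin 0 → Carrier S {x | x ∈ l}) i).1]
  exact h

theorem primrecPred_listSat {α β : Type} [Primcodable β]
    (φ : S.extend.lang.Formula (Fin τ.params ⊕ α)) {l : β → List ℕ} (hl : Primrec l)
    {v : α → β → ℕ} (hv : ∀ a, Primrec (v a)) :
    PrimrecPred fun b => ListSat τ q (l b) (fun a => v a b) φ := by
  refine (primrecPred_classSat φ hl (v := Sum.elim (fun i _ => q i) v) (fun a => ?_)
    (xs := fun (i : Fin 0) (_ : β) => (i.elim0 : ℕ)) fun i => i.elim0).of_eq fun b => ?_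
  · rcases a with i | a
    exacts [Primrec.const _, hv a]
  · unfold ListSat
    have : (fun a => (Sum.elim (fun i _ => q i) v : _ → β → ℕ) a b) =
        Sum.elim q fun a => v a b := by
      funext a
      cases a <;> rfl
    rw [this]

/-- The number of a piece and the list of the entries of a tuple in this piece. -/
def preCode {D : Set ℕ} (e : τ.Pre (Carrier S D)) : ℕ × List ℕ :=
  (e.1, List.ofFn fun k => (e.2 k).1)

theorem preCode_injective {D : Set ℕ} :
    Function.Injective (preCode τ : τ.Pre (Carrier S D) → ℕ × List ℕ) := by
  rintro ⟨i, t⟩ ⟨j, u⟩ h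
  obtain rfl : i = j := Fin.ext (congrArg Prod.fst h)
  have h2 := List.ofFn_injective (congrArg Prod.snd h)
  rw [show t = u from funext fun k => Carrier.ext_iff.2 (congrFun h2 k)]

theorem getD_preCode {D : Set ℕ} (e : τ.Pre (Carrier S D)) (k : Fin (τ.dim e.1)) :
    (preCode τ e).2.getD k 0 = (e.2 k).1 := by
  simp [preCode, List.getD_eq_getElem?_getD]

/-- The codes of all tuples. -/
def candidates (l : List ℕ) : List (ℕ × List ℕ) :=
  (List.range τ.pieces).flatMap fun i =>
    (listsOver (basePoint :: l) ((List.ofFn τ.dim).getD i 0)).map fun t => (i, t)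

theorem mem_candidates {l : List ℕ} {c : ℕ × List ℕ} :
    c ∈ candidates τ l ↔ ∃ e : τ.Pre (Carrier S {x | x ∈ l}), preCode τ e = c := by
  simp only [candidates, List.mem_flatMap, List.mem_range, List.mem_map, mem_listsOver]
  constructor
  · rintro ⟨i, hi, t, ⟨h1, h2⟩, rfl⟩
    have h3 : t.length = τ.dim ⟨i, hi⟩ := by
      rw [h1, List.getD_eq_getElem _ _ (by simpa using hi), List.getElem_ofFn]
    refine ⟨⟨⟨i, hi⟩, fun k => ⟨t[k.1]'(k.2.trans_eq h3.symm), ?_⟩⟩, ?_⟩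
    · exact List.mem_cons.1 (h2 _ (List.getElem_mem _))
    · refine Prod.ext rfl (List.ext_getElem (by simp [preCode, h3]) fun k _ _ => ?_)
      simp [preCode]
  · rintro ⟨e, rfl⟩
    refine ⟨e.1, e.1.2, List.ofFn fun k => (e.2 k).1, ⟨?_, ?_⟩, rfl⟩
    · rw [List.length_ofFn, List.getD_eq_getElem _ _ (by simp), List.getElem_ofFn]
    · intro x hx
      obtain ⟨k, rfl⟩ := List.mem_ofFn.1 hx
      exact List.mem_cons.2 (e.2 k).2

theorem primrec_candidates : Primrec (candidates τ) :=
  Primrec.list_flatMap (Primrec.const _) (Primrec.list_map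
    (primrec_listsOver.comp (Primrec.list_cons.comp (Primrec.const _) Primrec.fst)
      ((Primrec.list_getD 0).comp (Primrec.const _) Primrec.snd))
    (Primrec.pair (Primrec.snd.comp Primrec.fst) Primrec.snd))

/-- The domain formula for codes of tuples. -/
def CodeDom (l : List ℕ) (c : ℕ × List ℕ) : Prop :=
  ∃ i : Fin τ.pieces, c.1 = i ∧ ListSat τ q l (fun k : Fin (τ.dim i) => c.2.getD k 0) (τ.dom i)

/-- The translation of identity for codes of tuples. -/
def CodeEqv (l : List ℕ) (c d : ℕ × List ℕ) : Prop :=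
  ∃ i j : Fin τ.pieces, c.1 = i ∧ d.1 = j ∧
    ListSat τ q l (Sum.elim (fun k : Fin (τ.dim i) => c.2.getD k 0)
      fun k : Fin (τ.dim j) => d.2.getD k 0) (τ.eqv i j)

/-- The translation of the relation symbols for lists of codes of tuples. -/
def CodeRel (l : List ℕ) (m : ℕ) (a : List (ℕ × List ℕ)) : Prop :=
  ∃ (R : Fin S.rels.length) (s : Fin (S.rels.get R) → Fin τ.pieces), m = R ∧
    (∀ k : Fin (S.rels.get R), (a.getD k default).1 = s k) ∧
      ListSat τ q l (fun x : Σ k, Fin (τ.dim (s k)) => (a.getD x.1 default).2.getD x.2 0)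
        (τ.rel (n := S.rels.get R) ⟨R, rfl⟩ s)

/-- The translation of the function symbols for lists of codes of tuples, with the value before
the arguments. -/
def CodeFun (l : List ℕ) (m : ℕ) (a : List (ℕ × List ℕ)) : Prop :=
  ∃ (f : Fin S.funcs.length) (s : Fin (S.funcs.get f) → Fin τ.pieces) (j : Fin τ.pieces),
    m = f ∧ (a.getD 0 default).1 = j ∧ (∀ k : Fin (S.funcs.get f), (a.getD (k + 1) default).1 = s k) ∧
      ListSat τ q l (Sum.elim
        (fun x : Σ k, Fin (τ.dim (s k)) => (a.getD (x.1 + 1) default).2.getD x.2 0)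
        fun k : Fin (τ.dim j) => (a.getD 0 default).2.getD k 0)
        (τ.func (n := S.funcs.get f) ⟨f, rfl⟩ s j)

section Codes

variable {l : List ℕ} {p : Fin τ.params → Carrier S {x | x ∈ l}} (hp : ∀ i, (p i).1 = q i)

include hp

theorem codeDom_iff (e : τ.Pre (Carrier S {x | x ∈ l})) :
    CodeDom τ q l (preCode τ e) ↔ Translation.DomHolds p e := by
  have h := listSat_iff τ q p hp e.2 (getD_preCode τ e) (τ.dom e.1)
  constructor
  · rintro ⟨i, hi, h'⟩
    obtain rfl : e.1 = i := Fin.ext hi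
    exact h.1 h'
  · exact fun h' => ⟨e.1, rfl, h.2 h'⟩

theorem codeEqv_iff (e e' : τ.Pre (Carrier S {x | x ∈ l})) :
    CodeEqv τ q l (preCode τ e) (preCode τ e') ↔ Translation.EqvHolds p e e' := by
  have h := listSat_iff τ q p hp (Sum.elim e.2 e'.2)
    (w := Sum.elim (fun k : Fin (τ.dim e.1) => (preCode τ e).2.getD k 0)
      fun k : Fin (τ.dim e'.1) => (preCode τ e').2.getD k 0)
    (by rintro (k | k); exacts [getD_preCode τ e k, getD_preCode τ e' k]) (τ.eqv e.1 e'.1)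
  constructor
  · rintro ⟨i, j, hi, hj, h'⟩
    obtain rfl : e.1 = i := Fin.ext hi
    obtain rfl : e'.1 = j := Fin.ext hj
    exact h.1 h'
  · exact fun h' => ⟨e.1, e'.1, rfl, rfl, h.2 h'⟩

theorem codeRel_iff {n : ℕ} (R : S.lang.Relations n) (a : Fin n → τ.Pre (Carrier S {x | x ∈ l})) :
    CodeRel τ q l (R.1 : Fin S.rels.length).1 (List.ofFn fun k => preCode τ (a k)) ↔
      Translation.RelHolds p R a := by
  obtain ⟨R, rfl⟩ := R
  have hget : ∀ k : Fin (S.rels.get R),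
      (List.ofFn fun k => preCode τ (a k)).getD k default = preCode τ (a k) := by
    intro k
    simp [List.getD_eq_getElem?_getD]
  have h := listSat_iff τ q p hp (fun x : Σ k, Fin (τ.dim (a k).1) => (a x.1).2 x.2)
    (w := fun x => ((List.ofFn fun k => preCode τ (a k)).getD x.1 default).2.getD x.2 0)
    (by rintro ⟨k, m⟩; rw [hget]; exact getD_preCode τ (a k) m)
    (τ.rel (n := S.rels.get R) ⟨R, rfl⟩ fun k => (a k).1)
  constructor
  · rintro ⟨R', s, hR, hs, h'⟩
    obtain rfl : R = R' := Fin.ext hR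
    obtain rfl : (fun k => (a k).1) = s :=
      funext fun k => Fin.ext (by rw [← hs k, hget]; rfl)
    exact h.1 h'
  · exact fun h' => ⟨R, fun k => (a k).1, rfl, fun k => by rw [hget]; rfl, h.2 h'⟩

theorem codeFun_iff {n : ℕ} (f : S.lang.Functions n) (a : Fin n → τ.Pre (Carrier S {x | x ∈ l}))
    (b : τ.Pre (Carrier S {x | x ∈ l})) :
    CodeFun τ q l (f.1 : Fin S.funcs.length).1
      (preCode τ b :: List.ofFn fun k => preCode τ (a k)) ↔ Translation.FunHolds p f a b := by
  obtain ⟨f, rfl⟩ := f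
  have hget : ∀ k : Fin (S.funcs.get f),
      (preCode τ b :: List.ofFn fun k => preCode τ (a k)).getD (k + 1) default =
        preCode τ (a k) := by
    intro k
    simp [List.getD_eq_getElem?_getD]
  have h := listSat_iff τ q p hp
    (Sum.elim (fun x : Σ k, Fin (τ.dim (a k).1) => (a x.1).2 x.2) b.2)
    (w := Sum.elim (fun x => ((preCode τ b ::
      List.ofFn fun k => preCode τ (a k)).getD (x.1 + 1) default).2.getD x.2 0)
      fun k : Fin (τ.dim b.1) => (preCode τ b).2.getD k 0)
    (by
      rintro (⟨k, m⟩ | k)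
      · simp only [Sum.elim_inl]
        rw [hget]
        exact getD_preCode τ (a k) m
      · exact getD_preCode τ b k)
    (τ.func (n := S.funcs.get f) ⟨f, rfl⟩ (fun k => (a k).1) b.1)
  constructor
  · rintro ⟨f', s, j, hf, hj, hs, h'⟩
    obtain rfl : f = f' := Fin.ext hf
    obtain rfl : b.1 = j := Fin.ext hj
    obtain rfl : (fun k => (a k).1) = s :=
      funext fun k => Fin.ext (by rw [← hs k, hget]; rfl)
    exact h.1 h'
  · exact fun h' => ⟨f, fun k => (a k).1, b.1, rfl, rfl, fun k => by rw [hget]; rfl, h.2 h'⟩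

end Codes

section Primrec

variable {β : Type} [Primcodable β] {l : β → List ℕ} (hl : Primrec l)

include hl

theorem primrecPred_codeDom {c : β → ℕ × List ℕ} (hc : Primrec c) :
    PrimrecPred fun b => CodeDom τ q (l b) (c b) :=
  PrimrecPred.exists_finite fun i => (Primrec.eq.comp (Primrec.fst.comp hc) (Primrec.const _)).and
    (primrecPred_listSat τ q (τ.dom i) hl (v := fun k b => (c b).2.getD k 0) fun _ =>
      (Primrec.list_getD 0).comp (Primrec.snd.comp hc) (Primrec.const _))

theorem primrecPred_codeEqv {c d : β → ℕ × List ℕ} (hc : Primrec c) (hd : Primrec d) :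
    PrimrecPred fun b => CodeEqv τ q (l b) (c b) (d b) := by
  refine PrimrecPred.exists_finite fun i => PrimrecPred.exists_finite fun j =>
    (Primrec.eq.comp (Primrec.fst.comp hc) (Primrec.const _)).and
      ((Primrec.eq.comp (Primrec.fst.comp hd) (Primrec.const _)).and
        ((primrecPred_listSat τ q (τ.eqv i j) hl
          (v := Sum.elim (fun k b => (c b).2.getD k 0) fun k b => (d b).2.getD k 0)
          ?_).of_eq fun b => ?_))
  · rintro (k | k)
    exacts [(Primrec.list_getD 0).comp (Primrec.snd.comp hc) (Primrec.const _),
      (Primrec.list_getD 0).comp (Primrec.snd.comp hd) (Primrec.const _)]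
  · refine iff_of_eq (congrArg (fun v => ListSat τ q (l b) v _) ?_)
    funext k
    cases k <;> rfl

theorem primrecPred_codeRel {m : β → ℕ} (hm : Primrec m) {a : β → List (ℕ × List ℕ)}
    (ha : Primrec a) : PrimrecPred fun b => CodeRel τ q (l b) (m b) (a b) := by
  have hget : ∀ k, Primrec fun b => (a b).getD k default := fun k =>
    (Primrec.list_getD default).comp ha (Primrec.const k)
  exact PrimrecPred.exists_finite fun R => PrimrecPred.exists_finite fun s =>
    (Primrec.eq.comp hm (Primrec.const _)).and ((PrimrecPred.forall_fin fun k =>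
      Primrec.eq.comp (Primrec.fst.comp (hget k)) (Primrec.const _)).and
        (primrecPred_listSat τ q (τ.rel (n := S.rels.get R) ⟨R, rfl⟩ s) hl
          (v := fun x b => ((a b).getD x.1 default).2.getD x.2 0) fun x =>
          (Primrec.list_getD 0).comp (Primrec.snd.comp (hget _)) (Primrec.const _)))

theorem primrecPred_codeFun {m : β → ℕ} (hm : Primrec m) {a : β → List (ℕ × List ℕ)}
    (ha : Primrec a) : PrimrecPred fun b => CodeFun τ q (l b) (m b) (a b) := by
  have hget : ∀ k, Primrec fun b => (a b).getD k default := fun k =>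
    (Primrec.list_getD default).comp ha (Primrec.const k)
  refine PrimrecPred.exists_finite fun f => PrimrecPred.exists_finite fun s =>
    PrimrecPred.exists_finite fun j => (Primrec.eq.comp hm (Primrec.const _)).and
      ((Primrec.eq.comp (Primrec.fst.comp (hget 0)) (Primrec.const _)).and
        ((PrimrecPred.forall_fin fun k =>
          Primrec.eq.comp (Primrec.fst.comp (hget (k + 1))) (Primrec.const _)).and
        ((primrecPred_listSat τ q (τ.func (n := S.funcs.get f) ⟨f, rfl⟩ s j) hl
          (v := Sum.elim (fun x b => ((a b).getD (x.1 + 1) default).2.getD x.2 0)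
            fun k b => ((a b).getD 0 default).2.getD k 0) ?_).of_eq fun b => ?_)))
  · rintro (x | k)
    exacts [(Primrec.list_getD 0).comp (Primrec.snd.comp (hget _)) (Primrec.const _),
      (Primrec.list_getD 0).comp (Primrec.snd.comp (hget _)) (Primrec.const _)]
  · refine iff_of_eq (congrArg (fun v => ListSat τ q (l b) v _) ?_)
    funext k
    cases k <;> rfl

end Primrec

open Classical in
/-- The codes of the tuples that satisfy the domain formulas. -/
noncomputable def valids (l : List ℕ) : List (ℕ × List ℕ) :=
  (candidates τ l).filter fun c => decide (CodeDom τ q l c)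

/-- The codes of representatives of the classes of tuples. -/
noncomputable def repList (l : List ℕ) : List (ℕ × List ℕ) :=
  firsts (valids τ q l) (CodeEqv τ q l)

open Classical in
/-- The facts about the symbols with the given arities. -/
noncomputable def facts (V : List (ℕ × List ℕ)) (ar : List ℕ)
    (P : ℕ → List (ℕ × List ℕ) → Prop) : List (ℕ × List ℕ) :=
  (List.range ar.length).flatMap fun m =>
    ((listsOver V (ar.getD m 0)).filter fun a => decide (P m a)).map fun a =>
      (m, a.map Encodable.encode)

theorem mem_facts {V : List (ℕ × List ℕ)} {ar : List ℕ} {P : ℕ → List (ℕ × List ℕ) → Prop}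
    {m : ℕ} {a : List (ℕ × List ℕ)} (hm : m < ar.length) (ha : a.length = ar.getD m 0)
    (haV : ∀ x ∈ a, x ∈ V) : (m, a.map Encodable.encode) ∈ facts V ar P ↔ P m a := by
  simp only [facts, List.mem_flatMap, List.mem_range, List.mem_map, List.mem_filter,
    mem_listsOver, decide_eq_true_eq, Prod.mk.injEq]
  constructor
  · rintro ⟨m', -, a', ⟨-, h⟩, rfl, h'⟩
    rwa [← List.map_injective_iff.2 Encodable.encode_injective h']
  · exact fun h => ⟨m, hm, a, ⟨⟨ha, haV⟩, h⟩, rfl, rfl⟩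

open Classical in
theorem primrec_facts {β : Type} [Primcodable β] {V : β → List (ℕ × List ℕ)} (hV : Primrec V)
    (ar : List ℕ) {P : β → ℕ → List (ℕ × List ℕ) → Prop}
    (hP : PrimrecPred fun x : (β × ℕ) × List (ℕ × List ℕ) => P x.1.1 x.1.2 x.2) :
    Primrec fun b => facts (V b) ar (P b) :=
  Primrec.list_flatMap (Primrec.const _) (Primrec.list_map
    (primrec_filter (primrec_listsOver.comp (hV.comp Primrec.fst)
      ((Primrec.list_getD 0).comp (Primrec.const _) Primrec.snd))
      (p := fun (x : β × ℕ) a => P x.1 x.2 a) hP)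
    (Primrec.pair (Primrec.snd.comp Primrec.fst)
      (Primrec.list_map Primrec.snd (Primrec.encode.comp Primrec.snd))))

/-- The data of the finite structure defined by the translation in the structure of equivalence
classes with domain `l`. -/
noncomputable def translationData (l : List ℕ) : FinData :=
  ((repList τ q l).map Encodable.encode, facts (repList τ q l) S.rels (CodeRel τ q l),
    facts (repList τ q l) (S.funcs.map (· + 1)) (CodeFun τ q l))

theorem primrec_translationData : Primrec (translationData τ q) := by
  have hv : Primrec (valids τ q) := by
    classical
    exact primrec_filter (primrec_candidates τ)
      (primrecPred_codeDom τ q Primrec.fst Primrec.snd)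
  have hr : Primrec (repList τ q) := primrec_firsts hv
    (primrecPred_codeEqv τ q Primrec.fst (Primrec.fst.comp Primrec.snd)
      (Primrec.snd.comp Primrec.snd))
  refine Primrec.pair (Primrec.list_map hr (Primrec.encode.comp Primrec.snd))
    (Primrec.pair (primrec_facts hr _ ?_) (primrec_facts hr _ ?_))
  · exact primrecPred_codeRel τ q (Primrec.fst.comp Primrec.fst) (Primrec.snd.comp Primrec.fst)
      Primrec.snd
  · exact primrecPred_codeFun τ q (Primrec.fst.comp Primrec.fst) (Primrec.snd.comp Primrec.fst)
      Primrec.snd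

/-- The data are computed for every list `l` by taking first elements among tuples related by the
translated identity. They are a system of representatives only where that relation is an
equivalence, which explains the conditional form of `exists_rep` and `unique`. -/
theorem presents_translationData {l : List ℕ} {p : Fin τ.params → Carrier S {x | x ∈ l}}
    (hp : ∀ i, (p i).1 = q i) :
    Presents τ p (translationData τ q l) (fun e => Encodable.encode (preCode τ e))
      {e | preCode τ e ∈ repList τ q l} := by
  classical
  have hV : ∀ {c}, c ∈ valids τ q l ↔
      ∃ e : τ.Pre (Carrier S {x | x ∈ l}), preCode τ e = c ∧ Translation.DomHolds p e := by
    intro c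
    rw [valids, List.mem_filter, mem_candidates, decide_eq_true_eq]
    constructor
    · rintro ⟨⟨e, rfl⟩, h⟩
      exact ⟨e, rfl, (codeDom_iff τ q hp e).1 h⟩
    · rintro ⟨e, rfl, h⟩
      exact ⟨⟨e, rfl⟩, (codeDom_iff τ q hp e).2 h⟩
  have hdom : ∀ e : τ.Pre (Carrier S {x | x ∈ l}), preCode τ e ∈ valids τ q l →
      Translation.DomHolds p e := by
    intro e he
    obtain ⟨e', h1, h2⟩ := hV.1 he
    rwa [← preCode_injective τ h1]
  have hsymm : Translation.IsEquivalence p → ∀ x ∈ valids τ q l, ∀ y ∈ valids τ q l,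
      CodeEqv τ q l x y → CodeEqv τ q l y x := by
    intro hE x hx y hy
    obtain ⟨e, rfl, he⟩ := hV.1 hx
    obtain ⟨e', rfl, he'⟩ := hV.1 hy
    rw [codeEqv_iff τ q hp, codeEqv_iff τ q hp]
    exact hE.symm e e' he he'
  have htrans : Translation.IsEquivalence p → ∀ x ∈ valids τ q l, ∀ y ∈ valids τ q l,
      ∀ z ∈ valids τ q l, CodeEqv τ q l x y → CodeEqv τ q l y z → CodeEqv τ q l x z := by
    intro hE x hx y hy z hz
    obtain ⟨e, rfl, he⟩ := hV.1 hx
    obtain ⟨e', rfl, he'⟩ := hV.1 hy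
    obtain ⟨e'', rfl, he''⟩ := hV.1 hz
    rw [codeEqv_iff τ q hp, codeEqv_iff τ q hp, codeEqv_iff τ q hp]
    exact hE.trans e e' e'' he he' he''
  refine ⟨fun e e' h => preCode_injective τ (Encodable.encode_injective h), fun v => ?_,
    fun e he => hdom e (mem_of_mem_firsts he), fun hE e he => ?_, fun hE e he e' he' h => ?_,
    fun {n} R a ha => ?_, fun {n} f a b ha hb => ?_⟩
  · simp only [translationData, List.mem_map, Set.mem_ofPred_eq]
    constructor
    · rintro ⟨c, hc, rfl⟩
      obtain ⟨e, rfl, -⟩ := hV.1 (mem_of_mem_firsts hc)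
      exact ⟨e, hc, rfl⟩
    · rintro ⟨e, he, rfl⟩
      exact ⟨_, he, rfl⟩
  · obtain ⟨c, hc, h⟩ := exists_mem_firsts (fun x hx => by
      obtain ⟨e, rfl, he⟩ := hV.1 hx
      exact (codeEqv_iff τ q hp e e).2 (hE.refl e he)) (hsymm hE) (htrans hE)
      (hV.2 ⟨e, rfl, he⟩)
    obtain ⟨e', rfl, -⟩ := hV.1 (mem_of_mem_firsts hc)
    exact ⟨e', hc, (codeEqv_iff τ q hp e' e).1 h⟩
  · exact preCode_injective τ (eq_of_mem_firsts (hsymm hE) (htrans hE) he he'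
      ((codeEqv_iff τ q hp e e').2 h))
  · rw [← codeRel_iff τ q hp]
    have h1 : (List.ofFn fun k => Encodable.encode (preCode τ (a k))) =
        (List.ofFn fun k => preCode τ (a k)).map Encodable.encode := by
      rw [List.map_ofFn]; rfl
    rw [h1]
    exact mem_facts (R.1 : Fin S.rels.length).2 (by rw [List.length_ofFn, getD_rels])
      (List.forall_mem_ofFn_iff.2 ha)
  · rw [← codeFun_iff τ q hp]
    have h1 : (Encodable.encode (preCode τ b) ::
        List.ofFn fun k => Encodable.encode (preCode τ (a k))) =
        (preCode τ b :: List.ofFn fun k => preCode τ (a k)).map Encodable.encode := by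
      rw [List.map_cons, List.map_ofFn]; rfl
    rw [h1]
    have h2 := (f.1 : Fin S.funcs.length).2
    refine mem_facts (by simp) ?_ ?_
    · have h3 := getD_funcs f
      rw [List.getD_eq_getElem _ _ h2] at h3
      rw [List.length_cons, List.length_ofFn, List.getD_eq_getElem _ _ (by simp),
        List.getElem_map, h3]
    · simp only [List.mem_cons, forall_eq_or_imp]
      exact ⟨hb, List.forall_mem_ofFn_iff.2 ha⟩

end

end Interp

/-! ### No interpretation in the structures of equivalence classes of a sparse set -/

namespace Interp

open FirstOrder FirstOrder.Language

variable {S : Signature}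

/-- The signature and the set of pieces are finite, so a translation consists of finitely many
formulas. -/
theorem exists_sizeBound {L : FirstOrder.Language.{0, 0}} (τ : Translation L S.lang) :
    ∃ R, τ.SizeBound R := by
  let R1 := ∑ i, formulaSize (τ.dom i)
  let R2 := ∑ i, ∑ j, formulaSize (τ.eqv i j)
  let R3 := ∑ R : Fin S.rels.length, ∑ s : Fin (S.rels.get R) → Fin τ.pieces,
    formulaSize (τ.rel (n := S.rels.get R) ⟨R, rfl⟩ s)
  let R4 := ∑ f : Fin S.funcs.length, ∑ s : Fin (S.funcs.get f) → Fin τ.pieces, ∑ j,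
    formulaSize (τ.func (n := S.funcs.get f) ⟨f, rfl⟩ s j)
  have le_sum : ∀ {ι : Type} [Fintype ι] (f : ι → ℕ) (i : ι), f i ≤ ∑ i, f i := fun f i =>
    Finset.single_le_sum (fun _ _ => Nat.zero_le _) (Finset.mem_univ i)
  refine ⟨R1 + R2 + R3 + R4, fun i => ?_, fun i j => ?_, fun P s => ?_, fun f s j => ?_⟩
  · have : formulaSize (τ.dom i) ≤ R1 := le_sum (fun i => formulaSize (τ.dom i)) i
    omega
  · have : formulaSize (τ.eqv i j) ≤ R2 :=
      (le_sum (fun j => formulaSize (τ.eqv i j)) j).trans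
        (le_sum (fun i => ∑ j, formulaSize (τ.eqv i j)) i)
    omega
  · obtain ⟨P, rfl⟩ := P
    have : formulaSize (τ.rel (n := S.rels.get P) ⟨P, rfl⟩ s) ≤ R3 :=
      (le_sum (fun s => formulaSize (τ.rel (n := S.rels.get P) ⟨P, rfl⟩ s)) s).trans
        (le_sum (fun R : Fin S.rels.length => ∑ s : Fin (S.rels.get R) → Fin τ.pieces,
          formulaSize (τ.rel (n := S.rels.get R) ⟨R, rfl⟩ s)) P)
    omega
  · obtain ⟨f, rfl⟩ := f
    have : formulaSize (τ.func (n := S.funcs.get f) ⟨f, rfl⟩ s j) ≤ R4 :=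
      ((le_sum (fun j => formulaSize (τ.func (n := S.funcs.get f) ⟨f, rfl⟩ s j)) j).trans
        (le_sum (fun s => ∑ j, formulaSize (τ.func (n := S.funcs.get f) ⟨f, rfl⟩ s j)) s)).trans
        (le_sum (fun f : Fin S.funcs.length => ∑ s : Fin (S.funcs.get f) → Fin τ.pieces, ∑ j,
          formulaSize (τ.func (n := S.funcs.get f) ⟨f, rfl⟩ s j)) f)
    omega

/-- Lets the parameters of an interpretation be fixed numbers, belonging to all sufficiently large
approximations. -/
theorem mem_finDom_of_mem_infDom {X : ℕ → Bool} {N s x : ℕ} (h : ∀ i < N, s.testBit i = X i)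
    (hx : x = basePoint ∨ x ∈ infDom X) (hN : x < N) : x ∈ finDom N s := by
  have h1 := Nat.unpair_left_le x
  have h2 := Nat.unpair_right_le x
  rw [mem_finDom]
  rcases hx with rfl | hx | ⟨h3, h4, h5⟩
  · left
    rw [basePoint, cls_pair, Nat.unpair_pair]
    exact ⟨rfl, by omega, Nat.zero_le _⟩
  · left
    have : cls x ≤ x := h1
    omega
  · right
    have : cls x ≤ x := h1
    exact ⟨h3, by omega, by rwa [h _ (by omega)], h5⟩

/-- For a sufficiently sparse set, no essentially undecidable theory is interpreted in the structure
of equivalence classes that is given by the set. -/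
theorem exists_sparse_sequence_not_isQuotientMap {A : S.lang.Theory} (hA : RESet A)
    (hE : EssentiallyUndecidable A) :
    ∃ x : ℕ → ℕ, Computable x ∧ StrictMono x ∧
      ∀ X : ℕ → Bool, (∀ n, X n = true → n ∈ Set.range x) →
        ∀ (τ : Translation S.extend.lang S.lang) (p : Fin τ.params → Carrier S (infDom X))
          (Q : Theory.ModelType.{0, 0, 0} A) (π : τ.Elem (Carrier S (infDom X)) p → Q),
          ¬ τ.IsQuotientMap π := by
  obtain ⟨x, hx, hmono, h⟩ := exists_sparse_sequence_of_essentiallyUndecidable hA hE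
  refine ⟨x, hx, hmono, fun X hX τ p Q π hπ => ?_⟩
  obtain ⟨R, hR⟩ := exists_sizeBound τ
  let q : Fin τ.params → ℕ := fun i => (p i).1
  -- The first summand is the price of a move, the second the margin of `linkSystem`. The initial
  -- matching `l₀` has `τ.params + 1` pairs, and the last sum places all parameters below `N`.
  let K := 2 * τ.dimBound + (R + 3 * τ.dimBound) + τ.params + 2 + ∑ i, q i
  -- The parameters are built into the primitive recursive family, and the theory to which it
  -- converges is the complete theory of `Q`.
  refine h X hX (fun N s => translationData τ q (finDom N s))
    ((primrec_translationData τ q).comp₂ primrec_finDom) K {φ | Q ⊨ φ}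
    (fun φ hφ => Theory.realize_sentence_of_mem A hφ) fun φ N s hN hs hsX => ?_
  have hKN : K ≤ N := (Nat.le_mul_of_pos_right K (Nat.succ_pos _)).trans hN
  have hq : ∀ i, q i < N := fun i => by
    have : q i ≤ ∑ i, q i := Finset.single_le_sum (fun _ _ => Nat.zero_le _) (Finset.mem_univ i)
    omega
  let p' : Fin τ.params → Carrier S {x | x ∈ finDom N s} := fun i =>
    ⟨q i, .inr (mem_finDom_of_mem_infDom hsX (p i).2 (hq i))⟩
  have hZ := backAndForth_classSystem (S := S) (rich_infDom X N) (rich_finDom N s)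
    (infDom_agree_finDom hsX)
  have hD := presents_translationData τ q (l := finDom N s) (p := p') fun _ => rfl
  let l₀ : List (Carrier S (infDom X) × Carrier S {x | x ∈ finDom N s}) :=
    (⟨basePoint, .inl rfl⟩, ⟨basePoint, .inl rfl⟩) :: List.ofFn fun i => (p i, p' i)
  have hp : ∀ i, (p i, p' i) ∈ l₀ := fun i =>
    List.mem_cons_of_mem _ (List.mem_ofFn.2 ⟨i, rfl⟩)
  have hl₀ : ∀ z ∈ l₀, z.1.1 = z.2.1 := by
    simp only [l₀, List.mem_cons, forall_eq_or_imp, List.forall_mem_ofFn_iff, true_and]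
    exact fun _ => rfl
  have hmatch : Matching N (l₀.map fun z => (z.1.1, z.2.1)) := by
    refine ⟨?_, ?_, ?_⟩ <;> simp only [List.forall_mem_map]
    · exact fun a ha b hb => by rw [hl₀ a ha, hl₀ b hb]
    · exact fun a ha b hb => by rw [hl₀ a ha, hl₀ b hb]
    · exact fun a ha _ => hl₀ a ha
  have hsys : ∀ {r}, τ.params + 1 + r ≤ N →
      classSystem S N (infDom X) {x | x ∈ finDom N s} r l₀ := fun {r} hr =>
    ⟨l₀, fun _ => id, by simpa [l₀] using hr, ⟨_, List.mem_cons_self, rfl, rfl⟩, hmatch⟩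
  have hE' := isEquivalence_of_isQuotientMap hπ hZ hR hp (hsys (by omega))
  have hsize : 2 * τ.dimBound * formulaSize φ + K ≤ N := by
    have h1 : formulaSize φ ≤ code φ := formulaSize_le_codeFormula φ
    have h2 : 2 * τ.dimBound * formulaSize φ ≤ K * code φ :=
      Nat.mul_le_mul (by omega) h1
    rw [mul_add, mul_one] at hN
    omega
  exact ((backAndForth_linkSystem hπ hZ hR hD hE' hp (hsys (by omega))).realize_sentence_iff φ
    (l := []) ⟨l₀, hp, hsys (by omega), by simp⟩).symm

end Interp

namespace Interp

open FirstOrder FirstOrder.Language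

variable {S : Signature}

/-! ### Sentences about the sizes of equivalence classes -/

/-- Guards a formula by the assumption that `x_k` is different from `x_0, …, x_{j-1}`. -/
def guardDistinct {k : ℕ} (θ : S.extend.lang.BoundedFormula Empty (k + 1)) :
    ℕ → S.extend.lang.BoundedFormula Empty (k + 1)
  | 0 => θ
  | j + 1 => .imp (.imp (.equal (.var (.inr (Fin.last k)))
      (.var (.inr ⟨j % (k + 1), Nat.mod_lt _ k.succ_pos⟩))) .falsum) (guardDistinct θ j)

/-- All `x_k` in the class of `x_0` that are different from `x_0, …, x_{k-1}` satisfy `θ`. -/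
def forallNew {k : ℕ} (θ : S.extend.lang.BoundedFormula Empty (k + 1)) :
    S.extend.lang.BoundedFormula Empty k :=
  .all (.imp (.rel (symE S) ![.var (.inr 0), .var (.inr (Fin.last k))]) (guardDistinct θ k))

/-- There are exactly `j` elements in the class of `x_0` that are different from
`x_0, …, x_{k-1}`. -/
def exactlyNew : (k j : ℕ) → S.extend.lang.BoundedFormula Empty k
  | _, 0 => forallNew .falsum
  | k, j + 1 => .imp (forallNew (.imp (exactlyNew (k + 1) j) .falsum)) .falsum

/-- There is a class with exactly `n + 1` elements. -/
def existsClass (S : Signature) (n : ℕ) : S.extend.lang.Sentence := exactlyNew 0 (n + 1)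

section Semantics

variable {D : Set ℕ}

theorem realize_guardDistinct {k : ℕ} (θ : S.extend.lang.BoundedFormula Empty (k + 1))
    {v : Empty → Carrier S D} {xs : Fin (k + 1) → Carrier S D} {j : ℕ} (hj : j ≤ k) :
    (guardDistinct θ j).Realize v xs ↔
      ((∀ i : Fin k, i.1 < j → xs (Fin.last k) ≠ xs i.castSucc) → θ.Realize v xs) := by
  induction j with
  | zero => simp [guardDistinct]
  | succ j ih =>
    have h1 : (guardDistinct θ (j + 1)).Realize v xs ↔
        (¬ xs (Fin.last k) = xs (Fin.castSucc ⟨j, hj⟩) → (guardDistinct θ j).Realize v xs) := by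
      have : (⟨j % (k + 1), Nat.mod_lt _ k.succ_pos⟩ : Fin (k + 1)) = Fin.castSucc ⟨j, hj⟩ :=
        Fin.ext (Nat.mod_eq_of_lt (by omega))
      simp only [guardDistinct, this]
      rfl
    rw [h1, ih (by omega)]
    constructor
    · exact fun h h' => h (h' ⟨j, hj⟩ (Nat.lt_succ_self j)) fun i hi => h' i (by omega)
    · intro h h2 h3
      refine h fun i hi => ?_
      rcases Nat.lt_succ_iff_lt_or_eq.1 hi with hi | hi
      · exact h3 i hi
      · obtain rfl : i = ⟨j, hj⟩ := Fin.ext hi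
        exact h2

theorem realize_forallNew {k : ℕ} (θ : S.extend.lang.BoundedFormula Empty (k + 1))
    {v : Empty → Carrier S D} {xs : Fin k → Carrier S D} :
    (forallNew θ).Realize v xs ↔ ∀ y : Carrier S D,
      cls (Fin.snoc xs y (α := fun _ => Carrier S D) 0).1 = cls y.1 → y ∉ Set.range xs →
        θ.Realize v (Fin.snoc xs y) := by
  refine forall_congr' fun y => ?_
  have h1 : (BoundedFormula.rel (symE S) ![.var (.inr 0), .var (.inr (Fin.last k))] :
      S.extend.lang.BoundedFormula Empty (k + 1)).Realize v (Fin.snoc xs y) ↔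
      cls (Fin.snoc xs y (α := fun _ => Carrier S D) 0).1 = cls y.1 := by
    refine (relMap_symE _).trans ?_
    simp
  refine imp_congr h1 ((realize_guardDistinct θ le_rfl).trans (imp_congr ?_ Iff.rfl))
  simp only [Fin.snoc_last, Fin.snoc_castSucc, Fin.is_lt, forall_const, Set.mem_range, not_exists]
  exact forall_congr' fun i => ne_comm

/-- The class of an element, as a set of elements. -/
def classSet (S : Signature) (D : Set ℕ) (c : ℕ) : Set (Carrier S D) := {y | cls y.1 = c}

/-- Induction on `j`: with `k + 1` distinct members already named, either none is left, or a further
one is named and `j` decreases. -/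
theorem realize_exactlyNew {k j : ℕ} {v : Empty → Carrier S D}
    {xs : Fin (k + 1) → Carrier S D} (hinj : Function.Injective xs)
    (hcls : ∀ i, cls (xs i).1 = cls (xs 0).1) :
    (exactlyNew (S := S) (k + 1) j).Realize v xs ↔
      (classSet S D (cls (xs 0).1)).encard = ((k + 1 + j : ℕ) : ℕ∞) := by
  have hsnoc : ∀ y : Carrier S D,
      (Fin.snoc xs y (α := fun _ => Carrier S D) 0) = xs 0 := fun y => by
    rw [← Fin.castSucc_zero, Fin.snoc_castSucc]
  have hsub : Set.range xs ⊆ classSet S D (cls (xs 0).1) := by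
    rintro _ ⟨i, rfl⟩
    exact hcls i
  have hcard : (Set.range xs).encard = ((k + 1 : ℕ) : ℕ∞) := by
    rw [← Set.image_univ, hinj.encard_image, Set.encard_univ]
    simp
  induction j generalizing k with
  | zero =>
    refine realize_forallNew _ |>.trans ?_
    simp only [hsnoc]
    constructor
    · intro h
      have : Set.range xs = classSet S D (cls (xs 0).1) :=
        hsub.antisymm fun y hy => by_contra fun hy' => h y hy.symm hy'
      rw [← this, hcard, add_zero]
    · intro h y hy hy'
      rw [add_zero, ← hcard] at h
      have := (Set.finite_range xs).eq_of_subset_of_encard_le hsub h.le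
      exact hy' (this ▸ hy.symm)
  | succ j ih =>
    have h1 : (exactlyNew (S := S) (k + 1) (j + 1)).Realize v xs ↔
        ∃ y : Carrier S D, cls (xs 0).1 = cls y.1 ∧ y ∉ Set.range xs ∧
          (exactlyNew (S := S) (k + 1 + 1) j).Realize v (Fin.snoc xs y) := by
      show ¬ (forallNew _).Realize v xs ↔ _
      rw [realize_forallNew]
      simp only [hsnoc]
      push Not
      refine exists_congr fun y => and_congr_right fun _ => and_congr_right fun _ => ?_
      exact not_not
    have h2 : ∀ y : Carrier S D, cls (xs 0).1 = cls y.1 → y ∉ Set.range xs →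
        ((exactlyNew (S := S) (k + 1 + 1) j).Realize v (Fin.snoc xs y) ↔
          (classSet S D (cls (xs 0).1)).encard = ((k + 1 + (j + 1) : ℕ) : ℕ∞)) := by
      intro y hy hy'
      have hi := Fin.snoc_injective_of_injective hinj hy'
      have hc : ∀ i, cls (Fin.snoc xs y (α := fun _ => Carrier S D) i).1 =
          cls (Fin.snoc xs y (α := fun _ => Carrier S D) 0).1 := by
        intro i
        rw [hsnoc]
        refine Fin.lastCases ?_ (fun i => ?_) i
        · rw [Fin.snoc_last, hy]
        · rw [Fin.snoc_castSucc, hcls]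
      have := ih (k := k + 1) hi hc (fun z => by
          rw [← Fin.castSucc_zero, Fin.snoc_castSucc]) (by rintro _ ⟨i, rfl⟩; exact hc i) (by
          rw [← Set.image_univ, hi.encard_image, Set.encard_univ]
          simp)
      refine this.trans ?_
      rw [hsnoc, show k + 1 + 1 + j = k + 1 + (j + 1) by omega]
    rw [h1]
    constructor
    · rintro ⟨y, hy, hy', h⟩
      exact (h2 y hy hy').1 h
    · intro h
      have hne : ¬ classSet S D (cls (xs 0).1) ⊆ Set.range xs := by
        intro hs
        have := Set.encard_le_encard hs
        rw [h, hcard, Nat.cast_le] at this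
        omega
      obtain ⟨y, hy, hy'⟩ := Set.not_subset.1 hne
      exact ⟨y, hy.symm, hy', (h2 y hy.symm hy').2 h⟩

theorem realize_existsClass (n : ℕ) :
    Carrier S D ⊨ existsClass S n ↔
      ∃ x : Carrier S D, (classSet S D (cls x.1)).encard = ((n + 1 : ℕ) : ℕ∞) := by
  -- At `k = 0` the variable `x_0` is the quantified variable itself: the guard of `forallNew`
  -- reduces to reflexivity, and nothing has been named yet.
  show ¬ (forallNew _).Realize _ _ ↔ _
  rw [realize_forallNew]
  push Not
  refine exists_congr fun y => ?_
  have h0 : (Fin.snoc (default : Fin 0 → Carrier S D) y (α := fun _ => Carrier S D) 0) = y := rfl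
  have h := realize_exactlyNew (S := S) (D := D) (k := 0) (j := n) (v := default)
    (xs := Fin.snoc (default : Fin 0 → Carrier S D) y)
    (fun a b _ => Subsingleton.elim (α := Fin 1) a b)
    fun i => by rw [Subsingleton.elim (α := Fin 1) i 0]
  rw [h0, show 0 + 1 + n = n + 1 by omega] at h
  rw [h0, ← h]
  constructor
  · rintro ⟨-, -, h⟩
    exact not_not.1 h
  · exact fun h => ⟨rfl, fun ⟨i, _⟩ => i.elim0, not_not.2 h⟩

/-- Odd classes are infinite, and class `2 * m` has `m + 1` elements or none. The default element
lies in the odd class `1`, so it does not disturb the finite sizes. -/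
theorem realize_existsClass_infDom (X : ℕ → Bool) (n : ℕ) :
    Carrier S (infDom X) ⊨ existsClass S n ↔ X n = true := by
  have hinj : Function.Injective fun x : Carrier S (infDom X) => x.1 :=
    fun _ _ => Carrier.ext_iff.2
  have heven : ∀ m, X m = true →
      (classSet S (infDom X) (2 * m)).encard = ((m + 1 : ℕ) : ℕ∞) := by
    intro m hm
    have h1 : (fun x : Carrier S (infDom X) => x.1) '' classSet S (infDom X) (2 * m) =
        ((Finset.range (m + 1)).image (Nat.pair (2 * m)) : Finset ℕ) := by
      ext y
      simp only [Set.mem_image, Finset.coe_image, Finset.coe_range, Set.mem_Iio]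
      constructor
      · rintro ⟨⟨z, hz⟩, h1, hzy⟩
        replace h1 : cls z = 2 * m := h1
        replace hzy : z = y := hzy
        rcases hz with hz | hz | ⟨-, -, hz⟩
        · rw [hz, basePoint, cls_pair] at h1
          omega
        · omega
        · exact ⟨z.unpair.2, by omega, by rw [← hzy, ← h1]; exact Nat.pair_unpair z⟩
      · rintro ⟨j, hj, hjy⟩
        refine ⟨⟨Nat.pair (2 * m) j, .inr (.inr ?_)⟩, cls_pair _ _, hjy⟩
        rw [cls_pair, Nat.unpair_pair, Nat.mul_div_cancel_left _ two_pos]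
        exact ⟨Nat.mul_mod_right 2 m, hm, Nat.lt_succ_iff.1 hj⟩
    rw [← hinj.encard_image, h1, Set.encard_coe_eq_coe_finsetCard,
      Finset.card_image_of_injective _ fun a b hab => (Nat.pair_eq_pair.1 hab).2,
      Finset.card_range]
  rw [realize_existsClass]
  constructor
  · rintro ⟨⟨x, hx⟩, h⟩
    have hx' : cls x % 2 = 1 ∨ (cls x % 2 = 0 ∧ X (cls x / 2) = true) := by
      rcases hx with hx | hx | hx
      · exact .inl (by rw [hx, basePoint, cls_pair])
      · exact .inl hx
      · exact .inr ⟨hx.1, hx.2.1⟩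
    rcases hx' with ho | ⟨he, hX⟩
    · exfalso
      have hinf : (classSet S (infDom X) (cls x)).Infinite :=
        Set.infinite_of_injective_forall_mem
          (f := fun j => (⟨Nat.pair (cls x) j, .inr (.inl (by rwa [cls_pair]))⟩ :
            Carrier S (infDom X)))
          (fun a b hab => (Nat.pair_eq_pair.1 (Carrier.ext_iff.1 hab)).2) fun j => cls_pair _ _
      rw [hinf.encard_eq] at h
      exact ENat.top_ne_natCast _ h
    · have h1 := heven _ hX
      rw [show 2 * (cls x / 2) = cls x by omega, h, Nat.cast_inj] at h1
      rwa [show n = cls x / 2 by omega]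
  · intro h
    refine ⟨⟨Nat.pair (2 * n) 0, .inr (.inr ?_)⟩, ?_⟩
    · rw [cls_pair, Nat.unpair_pair, Nat.mul_div_cancel_left _ two_pos]
      exact ⟨Nat.mul_mod_right 2 n, h, Nat.zero_le _⟩
    · dsimp only
      rw [cls_pair]
      exact heven n h

end Semantics

/-! ### Gödel numbers -/

/-- The Gödel number of an implication. -/
def codeImp (a b : ℕ) : ℕ := Nat.pair 3 (Nat.pair a b)

/-- The Gödel number of a negation. -/
def codeNot (a : ℕ) : ℕ := codeImp a (Nat.pair 0 0)

theorem primrec_codeImp : Primrec₂ codeImp :=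
  Primrec₂.natPair.comp (Primrec.const 3) Primrec₂.natPair

theorem primrec_codeNot : Primrec codeNot :=
  primrec_codeImp.comp Primrec.id (Primrec.const _)

/-- The Gödel number of a guarded formula. -/
def codeGuard (k c : ℕ) : ℕ → ℕ
  | 0 => c
  | j + 1 => codeImp (codeNot (Nat.pair 1 (Nat.pair (Nat.pair 0 k) (Nat.pair 0 (j % (k + 1))))))
      (codeGuard k c j)

theorem codeFormula_guardDistinct {k : ℕ} (θ : S.extend.lang.BoundedFormula Empty (k + 1))
    (j : ℕ) : codeFormula (guardDistinct θ j) = codeGuard k (codeFormula θ) j := by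
  induction j with
  | zero => rfl
  | succ j ih =>
    rw [codeGuard, ← ih]
    rfl

theorem primrec_codeGuard : Primrec fun x : (ℕ × ℕ) × ℕ => codeGuard x.1.1 x.1.2 x.2 := by
  let e : ℕ → ℕ → ℕ := fun k j => Nat.pair 1 (Nat.pair (Nat.pair 0 k) (Nat.pair 0 (j % (k + 1))))
  have he : Primrec₂ e := Primrec₂.natPair.comp (Primrec.const 1) (Primrec₂.natPair.comp
    (Primrec₂.natPair.comp (Primrec.const 0) Primrec.fst) (Primrec₂.natPair.comp (Primrec.const 0)
      (Primrec.nat_mod.comp Primrec.snd (Primrec.succ.comp Primrec.fst))))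
  let g : (ℕ × ℕ) × ℕ → ℕ × ℕ → ℕ := fun x p => codeImp (codeNot (e x.1.1 p.1)) p.2
  have hg : Primrec₂ g := by
    have h1 : Primrec fun x : ((ℕ × ℕ) × ℕ) × (ℕ × ℕ) => e x.1.1.1 x.2.1 :=
      he.comp (Primrec.fst.comp (Primrec.fst.comp Primrec.fst)) (Primrec.fst.comp Primrec.snd)
    exact primrec_codeImp.comp (primrec_codeNot.comp h1) (Primrec.snd.comp Primrec.snd)
  refine (Primrec.nat_rec' (f := fun x : (ℕ × ℕ) × ℕ => x.2) (g := fun x => x.1.2) Primrec.snd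
    (Primrec.snd.comp Primrec.fst) hg).of_eq fun x => ?_
  induction x.2 with
  | zero => rfl
  | succ j ih => rw [codeGuard, ← ih]

/-- The Gödel number of a formula about all new elements. -/
def codeForallNew (r k c : ℕ) : ℕ :=
  Nat.pair 4 (codeImp (Nat.pair 2 (Nat.pair (r + 1)
    (Encodable.encode [Nat.pair 0 0, Nat.pair 0 k]))) (codeGuard k c k))

theorem codeFormula_forallNew {k : ℕ} (θ : S.extend.lang.BoundedFormula Empty (k + 1)) :
    codeFormula (forallNew θ) = codeForallNew S.rels.length k (codeFormula θ) := by
  rw [codeForallNew, ← codeFormula_guardDistinct]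
  rfl

theorem primrec_codeForallNew (r : ℕ) : Primrec₂ (codeForallNew r) := by
  refine Primrec₂.natPair.comp (Primrec.const 4) (primrec_codeImp.comp ?_
    (primrec_codeGuard.comp (Primrec.pair Primrec.id Primrec.fst)))
  exact Primrec₂.natPair.comp (Primrec.const 2) (Primrec₂.natPair.comp (Primrec.const _)
    (Primrec.encode.comp (Primrec.list_cons.comp (Primrec.const _)
      (Primrec.list_cons.comp (Primrec₂.natPair.comp (Primrec.const 0) Primrec.fst)
        (Primrec.const [])))))

/-- In the recursion for `exactlyNew` the number of variables rises as `j` falls, but their sum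
stays constant. Fixing the sum `n` turns it into a primitive recursion on `j` that builds the
formula from the inside. -/
theorem primrec_code_existsClass : Primrec fun n => code (existsClass S n) := by
  let r := S.rels.length
  let g : ℕ → ℕ → ℕ := fun n j => Nat.rec (motive := fun _ => ℕ)
    (codeForallNew r n (Nat.pair 0 0))
    (fun j c => codeNot (codeForallNew r (n - (j + 1)) (codeNot c))) j
  have hg : ∀ j n, j ≤ n → codeFormula (exactlyNew (S := S) (n - j) j) = g n j := by
    intro j
    induction j with
    | zero => exact fun n _ => codeFormula_forallNew _
    | succ j ih =>
      intro n hn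
      have h1 := ih n (by omega)
      show codeNot (codeFormula (forallNew _)) =
        codeNot (codeForallNew r (n - (j + 1)) (codeNot (g n j)))
      rw [codeFormula_forallNew, ← h1]
      have : ∀ a b, a = b → codeFormula (exactlyNew (S := S) a j) =
          codeFormula (exactlyNew (S := S) b j) := by rintro a _ rfl; rfl
      rw [← this (n - (j + 1) + 1) (n - j) (by omega)]
      rfl
  have hp : Primrec₂ g := by
    refine Primrec.nat_rec' (f := fun x : ℕ × ℕ => x.2)
      (g := fun x => codeForallNew r x.1 (Nat.pair 0 0))
      (h := fun x p => codeNot (codeForallNew r (x.1 - (p.1 + 1)) (codeNot p.2))) Primrec.snd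
      ((primrec_codeForallNew r).comp Primrec.fst (Primrec.const _)) ?_
    exact primrec_codeNot.comp ((primrec_codeForallNew r).comp
      (Primrec.nat_sub.comp (Primrec.fst.comp Primrec.fst)
        (Primrec.succ.comp (Primrec.fst.comp Primrec.snd)))
      (primrec_codeNot.comp (Primrec.snd.comp Primrec.snd)))
  refine (hp.comp Primrec.succ Primrec.succ).of_eq fun n => ?_
  rw [← hg (n + 1) (n + 1) le_rfl]
  have : ∀ a, a = 0 → codeFormula (exactlyNew (S := S) a (n + 1)) =
      codeFormula (exactlyNew (S := S) 0 (n + 1)) := by rintro a rfl; rfl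
  exact this _ (Nat.sub_self _)

end Interp

namespace Interp

open FirstOrder FirstOrder.Language

variable {S : Signature}

/-! ### The theory -/

/-- The additional propositional symbol as a sentence. -/
def atomP (S : Signature) : S.extend.lang.Sentence :=
  BoundedFormula.rel (symP S) (default : Fin 0 → S.extend.lang.Term (Empty ⊕ Fin 0))

/-- The theory that contains the axioms of `A` under the assumption of the additional
propositional symbol, and that fixes the sizes of some equivalence classes under the assumption of
its negation. -/
def classTheory (A : S.lang.Theory) (X Y : ℕ → Prop) : S.extend.lang.Theory :=
  {ψ | (∃ φ ∈ A, ψ = (atomP S).imp ((inclusion S).onSentence φ)) ∨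
    (∃ n, X n ∧ ψ = (atomP S).not.imp (existsClass S n)) ∨
    ∃ n, Y n ∧ ψ = (atomP S).not.imp (existsClass S n).not}

theorem models_classTheory_iff {A : S.lang.Theory} {X Y : ℕ → Prop} {M : Type}
    [S.extend.lang.Structure M] : M ⊨ classTheory A X Y ↔
      (M ⊨ atomP S → ∀ φ ∈ A, M ⊨ (inclusion S).onSentence φ) ∧
      (¬ M ⊨ atomP S → ∀ n, (X n → M ⊨ existsClass S n) ∧ (Y n → ¬ M ⊨ existsClass S n)) := by
  constructor
  · intro h
    have h' : ∀ φ ∈ classTheory A X Y, M ⊨ φ := fun φ hφ => Theory.realize_sentence_of_mem _ hφ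
    exact ⟨fun hP φ hφ => h' _ (.inl ⟨φ, hφ, rfl⟩) hP, fun hP n =>
      ⟨fun hn => h' _ (.inr (.inl ⟨n, hn, rfl⟩)) hP,
        fun hn => h' _ (.inr (.inr ⟨n, hn, rfl⟩)) hP⟩⟩
  · rintro ⟨h1, h2⟩
    refine ⟨fun ψ hψ => ?_⟩
    rcases hψ with ⟨φ, hφ, rfl⟩ | ⟨n, hn, rfl⟩ | ⟨n, hn, rfl⟩
    · exact fun hP => h1 hP φ hφ
    · exact fun hP => (h2 hP n).1 hn
    · exact fun hP => (h2 hP n).2 hn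

theorem rePred_eq {α : Type*} [Primcodable α] {f g : α → ℕ} (hf : Computable f)
    (hg : Computable g) : REPred fun a => f a = g a :=
  REPred.comp (p := fun x : ℕ × ℕ => x.1 = x.2)
    (PrimrecPred.computablePred Primrec.eq).to_re (hf.pair hg)

theorem rePred_lt {α : Type*} [Primcodable α] {f g : α → ℕ} (hf : Computable f)
    (hg : Computable g) : REPred fun a => f a < g a :=
  REPred.comp (p := fun x : ℕ × ℕ => x.1 < x.2)
    (PrimrecPred.computablePred Primrec.nat_lt).to_re (hf.pair hg)

theorem code_imp {S : Signature} (φ ψ : S.lang.Sentence) :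
    code (φ.imp ψ) = codeImp (code φ) (code ψ) := rfl

theorem code_not {S : Signature} (φ : S.lang.Sentence) : code φ.not = codeNot (code φ) := rfl

theorem reSet_classTheory {A : S.lang.Theory} {X Y : ℕ → Prop} (hA : RESet A) (hX : REPred X)
    (hY : REPred Y) : RESet (classTheory A X Y) := by
  let cP := code (atomP S)
  have h1 : REPred fun m : ℕ => ∃ a, (∃ φ ∈ A, code φ = a) ∧ m = codeImp cP a :=
    REPred.exists (REPred.and (REPred.comp (p := fun a => ∃ φ ∈ A, code φ = a) hA
      Computable.snd) (rePred_eq Computable.fst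
      (primrec_codeImp.comp (Primrec.const _) Primrec.snd).to_comp))
  have h2 : REPred fun m : ℕ => ∃ n, X n ∧ m = codeImp (codeNot cP) (code (existsClass S n)) :=
    REPred.exists (REPred.and (REPred.comp hX Computable.snd) (rePred_eq Computable.fst
      (primrec_codeImp.comp (Primrec.const _)
        (primrec_code_existsClass.comp Primrec.snd)).to_comp))
  have h3 : REPred fun m : ℕ =>
      ∃ n, Y n ∧ m = codeImp (codeNot cP) (codeNot (code (existsClass S n))) :=
    REPred.exists (REPred.and (REPred.comp hY Computable.snd) (rePred_eq Computable.fst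
      (primrec_codeImp.comp (Primrec.const _)
        (primrec_codeNot.comp (primrec_code_existsClass.comp Primrec.snd))).to_comp))
  have hc : ∀ φ : S.lang.Sentence, code ((atomP S).imp ((inclusion S).onSentence φ)) =
      codeImp cP (code φ) := fun φ => by
    rw [← code_onSentence φ, code_imp]
  have hc' : ∀ n, code ((atomP S).not.imp (existsClass S n)) =
      codeImp (codeNot cP) (code (existsClass S n)) := fun n => by rw [code_imp, code_not]
  have hc'' : ∀ n, code ((atomP S).not.imp (existsClass S n).not) =
      codeImp (codeNot cP) (codeNot (code (existsClass S n))) := fun n => by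
    rw [code_imp, code_not, code_not]
  refine (REPred.or h1 (REPred.or h2 h3)).of_eq fun m => ?_
  constructor
  · rintro (⟨a, ⟨φ, hφ, ha⟩, hm⟩ | ⟨n, hn, hm⟩ | ⟨n, hn, hm⟩)
    · exact ⟨_, .inl ⟨φ, hφ, rfl⟩, by rw [hm, hc, ha]⟩
    · exact ⟨_, .inr (.inl ⟨n, hn, rfl⟩), by rw [hm, hc']⟩
    · exact ⟨_, .inr (.inr ⟨n, hn, rfl⟩), by rw [hm, hc'']⟩
  · rintro ⟨ψ, ⟨φ, hφ, hψ⟩ | ⟨n, hn, hψ⟩ | ⟨n, hn, hψ⟩, hm⟩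
    · exact .inl ⟨_, ⟨φ, hφ, rfl⟩, by rw [← hm, hψ, hc]⟩
    · exact .inr (.inl ⟨n, hn, by rw [← hm, hψ, hc']⟩)
    · exact .inr (.inr ⟨n, hn, by rw [← hm, hψ, hc'']⟩)

theorem computablePred_theorems {T : S.lang.Theory} (hT : DecidableTheory T) {α : Type*}
    [Primcodable α] {f : α → ℕ} (hf : Computable f) :
    ComputablePred fun a => ∃ φ ∈ theorems T, code φ = f a := by
  classical
  obtain ⟨d, hd⟩ := hT
  exact ⟨fun a => d (f a), hd.comp hf⟩

/-- The theory of the reducts of the models in which the propositional symbol is true. -/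
theorem exists_decidableTheory_of_satisfiable {T : S.extend.lang.Theory}
    (hT : DecidableTheory T) (M : Theory.ModelType.{0, 0, 0} T) (hM : M ⊨ atomP S) :
    ∃ T' : S.lang.Theory, T'.IsSatisfiable ∧ DecidableTheory T' ∧
      ∀ φ, (atomP S).imp ((inclusion S).onSentence φ) ∈ theorems T → φ ∈ theorems T' := by
  -- Deductively closed, because reducts of models of `T` with true propositional symbol are models
  -- of `T'`; hence deciding `T'` reduces to deciding theoremhood in `T`.
  let T' : S.lang.Theory := {φ | (atomP S).imp ((inclusion S).onSentence φ) ∈ theorems T}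
  have hred : ∀ N : Theory.ModelType.{0, 0, 0} T, N ⊨ atomP S →
      ∃ N' : Theory.ModelType.{0, 0, 0} T', ∀ φ : S.lang.Sentence,
        (N' : Type) ⊨ φ ↔ (N : Type) ⊨ (inclusion S).onSentence φ := by
    intro N hN
    let _ := (inclusion S).reduct N
    have hiff : ∀ φ : S.lang.Sentence, (N : Type) ⊨ φ ↔ N ⊨ (inclusion S).onSentence φ :=
      fun φ => ((inclusion S).realize_onSentence (M := N) φ).symm
    have : (N : Type) ⊨ T' := ⟨fun φ hφ => (hiff φ).2 (mem_theorems_iff.1 hφ N hN)⟩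
    exact ⟨Theory.ModelType.of T' N, hiff⟩
  have hthm : theorems T' = T' := by
    refine (subset_theorems T').antisymm' fun φ hφ => mem_theorems_iff.2 fun N hN => ?_
    obtain ⟨N', h⟩ := hred N hN
    exact (h φ).1 (mem_theorems_iff.1 hφ N')
  refine ⟨T', ⟨(hred M hM).choose⟩, ?_, fun φ hφ => subset_theorems T' hφ⟩
  have h1 := computablePred_theorems hT (f := fun m => codeImp (code (atomP S)) m)
    (primrec_codeImp.comp (Primrec.const _) Primrec.id).to_comp
  -- Numbers coding sentences that contain the new symbols have to be excluded.
  have h2 := (primrecPred_exists_code S).computablePred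
  have h3 : ComputablePred fun m => (∃ φ : S.lang.Sentence, code φ = m) ∧
      ∃ ψ ∈ theorems T, code ψ = codeImp (code (atomP S)) m := by
    obtain ⟨d1, h1⟩ := h1
    obtain ⟨d2, h2⟩ := h2
    exact ⟨fun _ => instDecidableAnd, (Primrec.and.to_comp.comp h2 h1).of_eq fun m =>
      (Bool.decide_and _ _).symm⟩
  refine h3.of_eq fun m => ?_
  rw [hthm]
  constructor
  · rintro ⟨⟨φ, rfl⟩, ψ, hψ, h⟩
    refine ⟨φ, ?_, rfl⟩
    have : ψ = (atomP S).imp ((inclusion S).onSentence φ) := code_injective (by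
      rw [h, ← code_onSentence φ]
      rfl)
    rw [this] at hψ
    exact hψ
  · rintro ⟨φ, hφ, rfl⟩
    exact ⟨⟨φ, rfl⟩, _, hφ, by rw [← code_onSentence φ]; rfl⟩

/-! ### Diagonalisation along a sequence -/

open Nat.Partrec in
/-- The terms of the sequence at which the function with the index of the term has the value
`v`. -/
def DiagonalValue (x : ℕ → ℕ) (v n : ℕ) : Prop :=
  ∃ k, n = x k ∧ v ∈ (Denumerable.ofNat Code k).eval n

open Nat.Partrec in
theorem rePred_diagonalValue {x : ℕ → ℕ} (hx : Computable x) (v : ℕ) :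
    REPred (DiagonalValue x v) := by
  have h : REPred fun y : ℕ × ℕ => v ∈ (Denumerable.ofNat Code y.2).eval y.1 := by
    have h1 : PrimrecPred fun y : (ℕ × ℕ) × ℕ =>
        Code.evaln y.2 (Denumerable.ofNat Code y.1.2) y.1.1 = some v :=
      Primrec.eq.comp (Code.primrec_evaln.comp (Primrec.pair (Primrec.pair Primrec.snd
        ((Primrec.ofNat Code).comp (Primrec.snd.comp Primrec.fst)))
        (Primrec.fst.comp Primrec.fst))) (Primrec.const _)
    refine (REPred.exists (p := fun (y : ℕ × ℕ) t =>
      Code.evaln t (Denumerable.ofNat Code y.2) y.1 = some v) h1.computablePred.to_re).of_eq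
        fun y => ?_
    rw [Code.evaln_complete]
    exact Iff.rfl
  exact REPred.exists (REPred.and (rePred_eq Computable.fst (hx.comp Computable.snd)) h)

/-- A number is missed by an increasing sequence iff it lies below the first term or strictly
between two consecutive ones. -/
theorem rePred_notMem_range {x : ℕ → ℕ} (hx : Computable x) (hmono : StrictMono x) :
    REPred fun n => n ∉ Set.range x := by
  have h1 : REPred fun n => ∃ k, x k < n ∧ n < x (k + 1) :=
    REPred.exists (REPred.and (rePred_lt (hx.comp Computable.snd) Computable.fst)
      (rePred_lt Computable.fst (hx.comp (Computable.succ.comp Computable.snd))))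
  refine (REPred.or (rePred_lt Computable.id (Computable.const (x 0))) h1).of_eq fun n => ?_
  constructor
  · rintro (h | ⟨k, h2, h3⟩) ⟨j, rfl⟩
    · exact absurd (hmono.lt_iff_lt.1 h) (Nat.not_lt_zero j)
    · have := hmono.lt_iff_lt.1 h2
      have := hmono.lt_iff_lt.1 h3
      omega
  · intro h
    by_contra hno
    push Not at hno
    obtain ⟨h0, hstep⟩ := hno
    have : ∀ k, x k < n := by
      intro k
      induction k with
      | zero => exact lt_of_le_of_ne h0 fun e => h ⟨0, e⟩
      | succ k ih => exact lt_of_le_of_ne (hstep k ih) fun e => h ⟨k + 1, e⟩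
    exact absurd ((hmono.id_le n).trans_lt (this n)) (lt_irrefl n)

-- If `T` refutes the propositional symbol, it decides by theoremhood which classes exist, and the
-- index `k` of this decision function is diagonalised at `x k`: value 1 makes the existence
-- refutable as well, value 0 makes it an axiom. Otherwise `T` has a model in which the symbol is
-- true, and the reducts of such models give a decidable consistent extension of `A`.
open Nat.Partrec in
theorem essentiallyUndecidable_classTheory {A : S.lang.Theory} (hE : EssentiallyUndecidable A)
    {x : ℕ → ℕ} {Y : ℕ → Prop} (hY : ∀ n, DiagonalValue x 1 n → Y n) :
    EssentiallyUndecidable (classTheory A (DiagonalValue x 0) Y) := by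
  classical
  intro T hT hsat hdec
  rw [theorems_subset_iff] at hT
  by_cases hP : (atomP S).not ∈ theorems T
  · obtain ⟨M⟩ := hsat
    have hmem : ∀ φ, (atomP S).not.imp φ ∈ classTheory A (DiagonalValue x 0) Y →
        φ ∈ theorems T := fun φ hφ => mem_theorems_iff.2 fun N =>
      mem_theorems_iff.1 (hT hφ) N (mem_theorems_iff.1 hP N)
    obtain ⟨d, hd⟩ := computablePred_theorems hdec (f := fun n => code (existsClass S n))
      primrec_code_existsClass.to_comp
    have hf : Computable fun n => cond
        (decide (∃ φ ∈ theorems T, code φ = code (existsClass S n))) 1 0 :=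
      Computable.cond hd (Computable.const 1) (Computable.const 0)
    obtain ⟨c, hc⟩ := Code.exists_code.1 (Partrec.nat_iff.1 hf)
    let k := Encodable.encode c
    have hk : ∀ v, v ∈ (Denumerable.ofNat Code k).eval (x k) → DiagonalValue x v (x k) :=
      fun v hv => ⟨k, rfl, hv⟩
    rw [Denumerable.ofNat_encode, hc] at hk
    have hthm : (∃ φ ∈ theorems T, code φ = code (existsClass S (x k))) ↔
        existsClass S (x k) ∈ theorems T :=
      ⟨fun ⟨φ, h1, h2⟩ => code_injective h2 ▸ h1, fun h => ⟨_, h, rfl⟩⟩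
    by_cases hx : existsClass S (x k) ∈ theorems T
    · have h1 := hmem (existsClass S (x k)).not (.inr (.inr ⟨x k, hY _ (hk 1 (by
        simp [hthm, hx])), rfl⟩))
      exact mem_theorems_iff.1 h1 M (mem_theorems_iff.1 hx M)
    · exact hx (hmem _ (.inr (.inl ⟨x k, hk 0 (by simp [hthm, hx]), rfl⟩)))
  · rw [mem_theorems_iff] at hP
    push Not at hP
    obtain ⟨M, hM⟩ := hP
    obtain ⟨T', h1, h2, h3⟩ := exists_decidableTheory_of_satisfiable hdec M (not_not.1 hM)
    refine hE T' (theorems_subset_iff.2 fun φ hφ => ?_) h1 h2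
    exact h3 φ (hT (.inl ⟨φ, hφ, rfl⟩))

end Interp

namespace Interp

open FirstOrder FirstOrder.Language

variable {S : Signature}

/-! ### Interpretability -/

/-- The relation symbol of the original signature with the same index. -/
def restrictRel {n : ℕ} (R : S.extend.lang.Relations n)
    (h : (R.1 : Fin S.extend.rels.length).1 < S.rels.length) : S.lang.Relations n :=
  ⟨⟨(R.1 : Fin S.extend.rels.length).1, h⟩, by
    obtain ⟨R, rfl⟩ := R
    exact (List.getElem_append_left h).symm⟩

/-- The translation of the extended signature that interprets the new symbols by truth. -/
def identityTranslation (S : Signature) : Translation S.lang S.extend.lang where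
  pieces := 1
  dim _ := 1
  params := 0
  paramDom := ⊤
  dom _ := ⊤
  eqv _ _ := Term.equal (.var (.inr (.inl 0))) (.var (.inr (.inr 0)))
  rel R _ := if h : (R.1 : Fin S.extend.rels.length).1 < S.rels.length then
      Relations.formula (restrictRel R h) fun k => .var (.inr ⟨k, 0⟩)
    else ⊤
  func f _ _ := Term.equal (.func f fun k => .var (.inr (.inl ⟨k, 0⟩))) (.var (.inr (.inr 0)))

theorem admits_identityTranslation (I : InterpretationNotion) (S : Signature) :
    I.Admits (identityTranslation S) where
  dimensions _ := by
    cases h : I.dimensions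
    exacts [rfl, Nat.one_pos, trivial]
  pieces _ := rfl
  params _ := rfl
  unrelativised _ _ _ _ _ _ _ := fun h => h
  identity _ M _ _ p i j x y := by
    have h : ((identityTranslation S).eqv i j).Realize (Sum.elim p (Sum.elim x y)) ↔
        x (0 : Fin 1) = y (0 : Fin 1) := by
      simp only [identityTranslation, Formula.realize_equal]
      rfl
    obtain rfl : i = j := Subsingleton.elim (α := Fin 1) i j
    rw [h]
    constructor
    · intro h
      rw [show x = y from funext fun k => by
        rw [Subsingleton.elim (α := Fin 1) k 0]; exact h]
    · intro h
      exact congrFun (eq_of_heq (Sigma.mk.inj h).2) (0 : Fin 1)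

/-- A structure in which the new symbols are true. -/
abbrev trueExpansion (M : Type) [S.lang.Structure M] : S.extend.lang.Structure M where
  funMap f := Structure.funMap (L := S.lang) f
  RelMap R xs := ∀ h : (R.1 : Fin S.extend.rels.length).1 < S.rels.length,
    Structure.RelMap (restrictRel R h) xs

/-- With the propositional symbol read as true, only the axioms of `A` remain to be verified,
whatever `X` and `Y` are. -/
theorem interprets_classTheory (I : InterpretationNotion) {U A : S.lang.Theory}
    (hA : theorems A = theorems U) (X Y : ℕ → Prop) : Interprets I U (classTheory A X Y) := by
  refine ⟨identityTranslation S, admits_identityTranslation I S, fun M =>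
    ⟨⟨Fin.elim0, fun h => h⟩, fun p _ => ?_⟩⟩
  let _ : S.extend.lang.Structure M := trueExpansion M
  have hexp : (inclusion S).IsExpansionOn M :=
    ⟨fun _ _ => rfl, fun R _ => propext ⟨fun h => h R.1.2, fun h _ => h⟩⟩
  have hM : (M : Type) ⊨ classTheory A X Y := by
    have hP : (M : Type) ⊨ atomP S := fun h => absurd h (lt_irrefl S.rels.length)
    refine models_classTheory_iff.2 ⟨fun _ φ hφ => ?_, fun h => absurd hP h⟩
    rw [LHom.realize_onSentence]
    exact mem_theorems_iff.1 (hA ▸ subset_theorems A hφ) M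
  refine ⟨Theory.ModelType.of _ M, fun e => e.2.1 (0 : Fin 1), fun x =>
    ⟨⟨(0 : Fin 1), fun _ => x, fun h => h⟩, rfl⟩, fun a b => ?_, fun R a => ?_, fun f a b => ?_⟩
  · simp only [identityTranslation, Formula.realize_equal]
    rfl
  · simp only [identityTranslation]
    split_ifs with h
    · exact ⟨fun h' => Formula.realize_rel.2 (h' h), fun h' _ => Formula.realize_rel.1 h'⟩
    · exact iff_of_true (fun h' => absurd h' h) fun h => h
  · simp only [identityTranslation, Formula.realize_equal]
    rfl

/-- The structure of equivalence classes for the set of diagonal value 0 is a model of the theory,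
and that set lies in the range of the sparse sequence. An interpretation would, for some choice of
parameters, define a model of `A` in it. -/
theorem not_interprets_of_sparse {I : InterpretationNotion} {U A : S.lang.Theory}
    (hA : theorems A = theorems U) {x : ℕ → ℕ} (hx : StrictMono x)
    (h : ∀ X : ℕ → Bool, (∀ n, X n = true → n ∈ Set.range x) →
        ∀ (τ : Translation S.extend.lang S.lang) (p : Fin τ.params → Carrier S (infDom X))
          (Q : Theory.ModelType.{0, 0, 0} A) (π : τ.Elem (Carrier S (infDom X)) p → Q),
          ¬ τ.IsQuotientMap π) :
    ¬ Interprets I (classTheory A (DiagonalValue x 0)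
      fun n => n ∉ Set.range x ∨ DiagonalValue x 1 n) U := by
  classical
  rintro ⟨τ, -, hτ⟩
  let X : ℕ → Bool := fun n => decide (DiagonalValue x 0 n)
  have hM : Carrier S (infDom X) ⊨ classTheory A (DiagonalValue x 0)
      fun n => n ∉ Set.range x ∨ DiagonalValue x 1 n := by
    refine models_classTheory_iff.2 ⟨fun hP => absurd hP (not_relMap_symP _), fun _ n => ?_⟩
    rw [realize_existsClass_infDom, decide_eq_true_eq]
    refine ⟨id, ?_⟩
    -- No number demanded to be absent is in `X`: it is off the sequence, or the same computation
    -- would have both values 0 and 1, the index being unique by injectivity of `x`.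
    rintro (hn | ⟨k, rfl, hk⟩) ⟨j, hj, hj'⟩
    · exact hn ⟨j, hj.symm⟩
    · obtain rfl := hx.injective hj
      exact absurd (Part.mem_unique hk hj') one_ne_zero
  obtain ⟨⟨p, hp⟩, hτ⟩ := hτ (Theory.ModelType.of _ (Carrier S (infDom X)))
  obtain ⟨Q, π, hπ⟩ := hτ p hp
  have hQ : (Q : Type) ⊨ A :=
    ⟨fun φ hφ => mem_theorems_iff.1 (hA ▸ subset_theorems A hφ : φ ∈ theorems U) Q⟩
  refine h X (fun n hn => ?_) τ p (Theory.ModelType.of A Q) π hπ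
  obtain ⟨k, rfl, -⟩ := of_decide_eq_true hn
  exact ⟨k, rfl⟩

end Interp

theorem theorem1 (I : Interp.InterpretationNotion) :
    ¬ ∃ (S : Interp.Signature) (U : S.lang.Theory), Interp.IsInterpretabilityMinimal I U := by
  open Interp in
  rintro ⟨S, U, ⟨A, hA, hAU⟩, hU, hmin⟩
  have hE : EssentiallyUndecidable A := fun T' h => hU T' (hAU ▸ h)
  -- The sequence depends on `A` alone; the diagonal sets are defined from it afterwards, which is
  -- why sparseness had to work for all subsets of its range.
  obtain ⟨x, hx, hmono, h⟩ := exists_sparse_sequence_not_isQuotientMap hA hE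
  have hV := reSet_classTheory hA (rePred_diagonalValue hx 0)
    (Interp.REPred.or (rePred_notMem_range hx hmono) (rePred_diagonalValue hx 1))
  exact not_interprets_of_sparse hAU hmono h (hmin S.extend _ ⟨_, hV, rfl⟩
    (essentiallyUndecidable_classTheory hE fun _ => Or.inr) (interprets_classTheory I hAU _ _))
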